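/- Let $d\ge 1$, let $B\subset\mathbb{R}^d$ be an open Euclidean ball of radius $R>0$, and put $\nu=d/2-1$. For $\mu\in\mathbb{R}$ let $J_\mu$ and $I_\mu$ denote the Bessel and modified Bessel functions of the first kind of order $\mu$ on $(0,\infty)$. A real number $\Lambda$ is an eigenvalue of the Dirichlet (clamped) bilaplacian on $B$, with eigenfunction $u$, if $u\in H^2_0(B)$ (the closure of $C_c^\infty(B)$ in $H^2(B)$), $u\neq 0$, and $$\int_B \Delta u\,\Delta v=\Lambda\int_B u\,v\qquad\text{for all } v\in H^2_0(B).$$ A first $L^2$-normalised eigenfunction is a real-valued eigenfunction $u$ associated with the smallest eigenvalue and such that $\int_B u^2=1$. The function $J_{\nu+1}/J_\nu+I_{\nu+1}/I_\nu$ (defined at the points of $(0,\infty)$ where $J_\nu$ does not vanish) has a smallest positive zero $\gamma_\nu$; a first $L^2$-normalised eigenfunction on $B$ exists; and every first $L^2$-normalised eigenfunction $u_{B,0}$ on $B$ satisfies $$\int_B|\nabla u_{B,0}|^2=\frac{\gamma_\nu^2}{R^2}\,\frac{|J_{\nu+1}(\gamma_\nu)\,J_{\nu-1}(\gamma_\nu)|}{J_\nu(\gamma_\nu)^2}.$$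 -/

import Mathlib

open MeasureTheory TopologicalSpace
open scoped Distributions ENNReal

noncomputable section

namespace ClampedPlate

/-! ### Bessel functions of real order, on the positive half-line -/

/-- The Bessel function of the first kind `J_μ(x) = ∑ (-1)^m / (m! Γ(m+μ+1)) (x/2)^(2m+μ)`,
for `μ : ℝ` and `x > 0`. As usual `1/Γ` is zero at the poles of `Γ`; this is Mathlib's convention,
since `Real.Gamma (-n) = 0` and `0⁻¹ = 0`. -/
def besselJ (μ x : ℝ) : ℝ :=
  ∑' m : ℕ, (-1) ^ m * ((m.factorial : ℝ) * Real.Gamma (m + μ + 1))⁻¹ * (x / 2) ^ (2 * (m : ℝ) + μ)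

/-- The modified Bessel function of the first kind
`I_μ(x) = ∑ 1 / (m! Γ(m+μ+1)) (x/2)^(2m+μ)`, for `μ : ℝ` and `x > 0`. -/
def besselI (μ x : ℝ) : ℝ :=
  ∑' m : ℕ, ((m.factorial : ℝ) * Real.Gamma (m + μ + 1))⁻¹ * (x / 2) ^ (2 * (m : ℝ) + μ)

/-- The positive zeros of `J_{μ+1}/J_μ + I_{μ+1}/I_μ`; the zeros of the denominators are not in
the domain of that function. -/
def besselQuotientZeros (μ : ℝ) : Set ℝ :=
  {x | 0 < x ∧ besselJ μ x ≠ 0 ∧ besselI μ x ≠ 0 ∧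
    besselJ (μ + 1) x / besselJ μ x + besselI (μ + 1) x / besselI μ x = 0}

/-- The smallest positive zero `γ_μ` of `J_{μ+1}/J_μ + I_{μ+1}/I_μ`. -/
def firstZero (μ : ℝ) : ℝ := sInf (besselQuotientZeros μ)

/-! ### Weak derivatives and the space `H₀²(Ω)` -/

variable {d : ℕ}

/-- The classical partial derivative `∂ᵢ φ`. -/
def classicalPartial (i : Fin d) (φ : EuclideanSpace ℝ (Fin d) → ℝ)
    (x : EuclideanSpace ℝ (Fin d)) : ℝ :=
  fderiv ℝ φ x (EuclideanSpace.single i 1)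

/-- `g` is the weak partial derivative `∂ᵢ u` on the open set `Ω`. -/
def HasWeakPartial (Ω : Opens (EuclideanSpace ℝ (Fin d))) (i : Fin d)
    (u g : EuclideanSpace ℝ (Fin d) → ℝ) : Prop :=
  LocallyIntegrableOn u (Ω : Set (EuclideanSpace ℝ (Fin d))) ∧
  LocallyIntegrableOn g (Ω : Set (EuclideanSpace ℝ (Fin d))) ∧
  ∀ φ : 𝓓(Ω, ℝ), ∫ x in Ω, u x * classicalPartial i φ x = -∫ x in Ω, g x * φ x

open Classical in
/-- The weak partial derivative `∂ᵢ u` on `Ω` (unique up to a null set); zero if `u` has none. -/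
def weakPartial (Ω : Opens (EuclideanSpace ℝ (Fin d))) (i : Fin d)
    (u : EuclideanSpace ℝ (Fin d) → ℝ) : EuclideanSpace ℝ (Fin d) → ℝ :=
  if h : ∃ g, HasWeakPartial Ω i u g then h.choose else 0

/-- The weak Laplacian `Δu = ∑ ∂ᵢ∂ᵢ u` on `Ω`. -/
def weakLaplacian (Ω : Opens (EuclideanSpace ℝ (Fin d)))
    (u : EuclideanSpace ℝ (Fin d) → ℝ) (x : EuclideanSpace ℝ (Fin d)) : ℝ :=
  ∑ i, weakPartial Ω i (weakPartial Ω i u) x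

/-- `|∇u|²` for the weak gradient of `u` on `Ω`. -/
def gradSq (Ω : Opens (EuclideanSpace ℝ (Fin d)))
    (u : EuclideanSpace ℝ (Fin d) → ℝ) (x : EuclideanSpace ℝ (Fin d)) : ℝ :=
  ∑ i, weakPartial Ω i u x ^ 2

/-- `u ∈ H²(Ω)`: the function and its weak derivatives of order one and two exist and are
in `L²(Ω)`. -/
structure MemH2 (Ω : Opens (EuclideanSpace ℝ (Fin d)))
    (u : EuclideanSpace ℝ (Fin d) → ℝ) : Prop where
  memLp : MemLp u 2 (volume.restrict Ω)
  first : ∀ i, ∃ g, HasWeakPartial Ω i u g ∧ MemLp g 2 (volume.restrict Ω)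
  second : ∀ i j, ∃ h, HasWeakPartial Ω j (weakPartial Ω i u) h ∧
    MemLp h 2 (volume.restrict Ω)

/-- The distance in `H²(Ω)` between `u` and a test function `φ`, as the sum of the `L²(Ω)`
distances of the derivatives of order at most two. -/
def h2Dist (Ω : Opens (EuclideanSpace ℝ (Fin d)))
    (u : EuclideanSpace ℝ (Fin d) → ℝ) (φ : 𝓓(Ω, ℝ)) : ℝ≥0∞ :=
  eLpNorm (fun x => u x - φ x) 2 (volume.restrict Ω) +
  ∑ i, eLpNorm (fun x => weakPartial Ω i u x - classicalPartial i φ x) 2 (volume.restrict Ω) +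
  ∑ i, ∑ j, eLpNorm (fun x => weakPartial Ω j (weakPartial Ω i u) x -
    classicalPartial j (classicalPartial i φ) x) 2 (volume.restrict Ω)

/-- `u ∈ H₀²(Ω)`: the closure of `C_c^∞(Ω)` in `H²(Ω)`. -/
def MemH20 (Ω : Opens (EuclideanSpace ℝ (Fin d)))
    (u : EuclideanSpace ℝ (Fin d) → ℝ) : Prop :=
  MemH2 Ω u ∧ ∀ ε : ℝ≥0∞, 0 < ε → ∃ φ : 𝓓(Ω, ℝ), h2Dist Ω u φ < ε

/-! ### The Dirichlet bilaplacian -/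

/-- `u` is an eigenfunction, for the eigenvalue `Λ`, of `Δ²` on `Ω` with the clamped boundary
conditions `u = ∂ₙu = 0`, in the weak sense. -/
structure IsEigenfunction (Ω : Opens (EuclideanSpace ℝ (Fin d))) (Λ : ℝ)
    (u : EuclideanSpace ℝ (Fin d) → ℝ) : Prop where
  memH20 : MemH20 Ω u
  ne_zero : ¬ (∀ᵐ x ∂(volume.restrict (Ω : Set (EuclideanSpace ℝ (Fin d)))), u x = 0)
  weak_eq : ∀ v, MemH20 Ω v →
    ∫ x in Ω, weakLaplacian Ω u x * weakLaplacian Ω v x = Λ * ∫ x in Ω, u x * v x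

/-- The eigenvalues of the Dirichlet bilaplacian on `Ω`. -/
def eigenvalues (Ω : Opens (EuclideanSpace ℝ (Fin d))) : Set ℝ :=
  {Λ | ∃ u, IsEigenfunction Ω Λ u}

/-- `u` is an `L²`-normalised eigenfunction of the Dirichlet bilaplacian on `Ω` for its smallest
eigenvalue. -/
def IsFirstNormalisedEigenfunction (Ω : Opens (EuclideanSpace ℝ (Fin d)))
    (u : EuclideanSpace ℝ (Fin d) → ℝ) : Prop :=
  ∃ Λ, IsLeast (eigenvalues Ω) Λ ∧ IsEigenfunction Ω Λ u ∧ ∫ x in Ω, u x ^ 2 = 1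

/-- The open ball of `ℝ^d` with centre `c` and radius `R`. -/
def openBall (c : EuclideanSpace ℝ (Fin d)) (R : ℝ) : Opens (EuclideanSpace ℝ (Fin d)) :=
  ⟨Metric.ball c R, Metric.isOpen_ball⟩

end ClampedPlate

end

noncomputable section

namespace ClampedPlate

open Filter Topology Set

/-! ### The entire function behind the Bessel functions -/

/-! The lowest eigenspace is shown to be spanned by an explicit radial function, and the integral is
then computed. Neither compactness nor the spectral theorem is used: the eigenfunction is exhibited
and every competitor is excluded by hand.

Both `J` and `I` are powers times one entire function `bes μ`, taken at `-x²/4` and `x²/4`. Since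
`bes μ' = bes (μ+1)`, the recurrence `bes_recurrence` is at once Bessel's equation and the radial
Helmholtz equation. Clearing denominators, the zeros of the quotient become zeros of `besWronskian`.
The ODE argument behind `firstZero_spec` shows that the first zero `γ` exists, that `J_ν(γ) < 0`,
and that `J_{ν+1}` is positive on `(0, γ]`.

The last fact forces symmetry. The function `⟪v, x⟫ h(|x|²)` built from `J_{ν+1}` is a positive
solution of `Δψ = -sψ` on a half ball for some `s > γ²/R²`. So test functions odd under a reflection
satisfy `∫|∇φ|² ≥ s∫φ²`, and hence `∫(Δφ)² ≥ s²∫φ²` (`integral_lap_sq_ge_of_odd`). An eigenfunction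
`u` with `Λ ≤ γ⁴/R⁴` therefore has no odd part under any reflection. Reflections generate the
orthogonal group, so `u` is radial.

Write `Λ = κ²` with `κ > 0` and `b = Δu + κu`. Then `b` is radial with `(Δ - κ)b = 0` weakly, so `b`
is a multiple `β` of the regular solution (`ae_eq_radialSol_of_weak`). Pairing `b` with the regular
solution of `Δf = -κf` gives `β · besWronskian = 0`, because clamped functions produce no boundary
terms. Below `γ²/R²` this yields `β = 0`, hence `Δu = -κu`. A clamped solution of that equation has
a continuous Fourier transform supported on a sphere, so it vanishes
(`ClampedPair.ae_eq_zero_of_helmholtz`). At `κ = γ²/R²`, subtracting a multiple of `groundState`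
removes `b`, and the same argument applies.

Finally `∫|∇u|² = -∫uΔu`. Lommel's integrals evaluate this, and the two Helmholtz components of the
ground state are orthogonal because the Wronskian vanishes at `γ`. -/

theorem mul_inv_Gamma_add_one (s : ℝ) : s * (Real.Gamma (s + 1))⁻¹ = (Real.Gamma s)⁻¹ := by
  rcases eq_or_ne s 0 with rfl | hs
  · simp [Real.Gamma_zero]
  · rw [Real.Gamma_add_one hs, mul_inv, ← mul_assoc, mul_inv_cancel₀ hs, one_mul]

/-- The coefficient `1 / (m! Γ(m+μ+1))`. -/
def besCoeff (μ : ℝ) (m : ℕ) : ℝ := ((m.factorial : ℝ) * Real.Gamma (m + μ + 1))⁻¹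

/-- The entire function `∑ yᵐ / (m! Γ(m+μ+1))`. -/
def bes (μ y : ℝ) : ℝ := ∑' m : ℕ, besCoeff μ m * y ^ m

theorem besCoeff_succ (μ : ℝ) (m : ℕ) :
    ((m : ℝ) + 1) * besCoeff μ (m + 1) = besCoeff (μ + 1) m := by
  have h : ((m : ℝ) + 1) ≠ 0 := by positivity
  unfold besCoeff
  rw [Nat.factorial_succ]
  push_cast
  rw [show (m : ℝ) + 1 + μ + 1 = m + (μ + 1) + 1 by ring, mul_inv, mul_inv, mul_inv]
  field_simp

theorem besCoeff_pred (μ : ℝ) (m : ℕ) :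
    besCoeff (μ - 1) m = ((m : ℝ) + μ) * besCoeff μ m := by
  unfold besCoeff
  rw [show (m : ℝ) + (μ - 1) + 1 = m + μ by ring, mul_inv, mul_inv,
    ← mul_inv_Gamma_add_one ((m : ℝ) + μ)]
  ring

/-- Once `m ≥ -μ`, passing from `m` to `m + 1` divides `1/Γ` by a number at least `1`, so only
finitely many terms matter. No restriction on `μ` is needed, poles of `Γ` included. -/
theorem exists_abs_inv_Gamma_le (μ : ℝ) :
    ∃ C, ∀ m : ℕ, |(Real.Gamma ((m : ℝ) + μ + 1))⁻¹| ≤ C := by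
  obtain ⟨M, hM⟩ := exists_nat_ge (-μ)
  refine ⟨∑ m ∈ Finset.range (M + 1), |(Real.Gamma ((m : ℝ) + μ + 1))⁻¹|, fun m => ?_⟩
  induction m with
  | zero =>
    exact Finset.single_le_sum (f := fun m : ℕ => |(Real.Gamma ((m : ℝ) + μ + 1))⁻¹|)
      (fun _ _ => abs_nonneg _) (Finset.mem_range.2 (Nat.succ_pos M))
  | succ m ih =>
    rcases lt_or_ge m M with h | h
    · exact Finset.single_le_sum (f := fun m : ℕ => |(Real.Gamma ((m : ℝ) + μ + 1))⁻¹|)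
        (fun _ _ => abs_nonneg _) (Finset.mem_range.2 (Nat.succ_lt_succ h))
    · refine le_trans ?_ ih
      have h' : (M : ℝ) ≤ m := by exact_mod_cast h
      rw [← mul_inv_Gamma_add_one ((m : ℝ) + μ + 1), abs_mul]
      push_cast
      rw [show (m : ℝ) + 1 + μ + 1 = m + μ + 1 + 1 by ring]
      refine le_mul_of_one_le_left (abs_nonneg _) ?_
      rw [abs_of_nonneg] <;> linarith

theorem exists_abs_besCoeff_le (μ : ℝ) :
    ∃ C, 0 ≤ C ∧ ∀ m : ℕ, |besCoeff μ m| ≤ C * ((m.factorial : ℝ))⁻¹ := by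
  obtain ⟨C, hC⟩ := exists_abs_inv_Gamma_le μ
  refine ⟨C, (abs_nonneg _).trans (hC 0), fun m => ?_⟩
  unfold besCoeff
  rw [mul_inv, abs_mul, abs_of_nonneg (by positivity : (0 : ℝ) ≤ ((m.factorial : ℝ))⁻¹), mul_comm]
  exact mul_le_mul_of_nonneg_right (hC m) (by positivity)

theorem summable_besCoeff_mul_pow (μ r : ℝ) :
    Summable fun m : ℕ => |besCoeff μ m| * |r| ^ m := by
  obtain ⟨C, hC0, hC⟩ := exists_abs_besCoeff_le μ
  refine Summable.of_nonneg_of_le (fun m => by positivity) (fun m => ?_)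
    ((Real.summable_pow_div_factorial |r|).mul_left C)
  rw [div_eq_mul_inv, mul_comm (|r| ^ m), ← mul_assoc]
  exact mul_le_mul_of_nonneg_right (hC m) (by positivity)

theorem summable_bes (μ y : ℝ) : Summable fun m : ℕ => besCoeff μ m * y ^ m := by
  refine Summable.of_norm ?_
  simpa [abs_mul, abs_pow] using summable_besCoeff_mul_pow μ y

theorem hasDerivAt_bes (μ y : ℝ) : HasDerivAt (bes μ) (bes (μ + 1) y) y := by
  have key : HasDerivAt (fun z => ∑' m : ℕ, besCoeff μ m * z ^ m)
      (∑' m : ℕ, besCoeff μ m * ((m : ℝ) * y ^ (m - 1))) y := by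
    refine hasDerivAt_tsum_of_isPreconnected (𝕜 := ℝ) (F := ℝ)
      (g := fun (m : ℕ) (z : ℝ) => besCoeff μ m * z ^ m)
      (g' := fun (m : ℕ) (z : ℝ) => besCoeff μ m * ((m : ℝ) * z ^ (m - 1)))
      (u := fun m : ℕ => |besCoeff μ m| * ((m : ℝ) * (|y| + 1) ^ (m - 1)))
      (t := Metric.ball (0 : ℝ) (|y| + 1)) (y₀ := y) ?_ Metric.isOpen_ball
      (convex_ball _ _).isPreconnected (fun m z _ => ?_) (fun m z hz => ?_) ?_
      (summable_bes μ y) ?_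
    -- Dropping the term `m = 0`, where `m - 1` truncates but the factor `m` vanishes, turns the
    -- majorant into the absolute series of order `μ + 1`.
    · rw [← summable_nat_add_iff 1]
      refine (summable_besCoeff_mul_pow (μ + 1) (|y| + 1)).congr (fun m => ?_)
      rw [← besCoeff_succ, abs_mul, abs_of_nonneg (by positivity : (0 : ℝ) ≤ (m : ℝ) + 1),
        abs_of_nonneg (by positivity : (0 : ℝ) ≤ |y| + 1)]
      push_cast
      ring
    · exact (hasDerivAt_pow m z).const_mul _
    · rw [norm_mul, norm_mul, norm_pow]
      simp only [Real.norm_eq_abs, Nat.abs_cast]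
      have : |z| ≤ |y| + 1 := by simpa using (Metric.mem_ball.1 hz).le
      gcongr
    · simp
    · simp
  have h2 : (∑' m : ℕ, besCoeff μ m * ((m : ℝ) * y ^ (m - 1))) = bes (μ + 1) y := by
    have hs : Summable fun m : ℕ => besCoeff μ m * ((m : ℝ) * y ^ (m - 1)) := by
      rw [← summable_nat_add_iff 1]
      refine (summable_bes (μ + 1) y).congr (fun m => ?_)
      rw [← besCoeff_succ]
      push_cast
      ring
    rw [hs.tsum_eq_zero_add]
    simp only [Nat.cast_zero, zero_mul, mul_zero, zero_add]
    refine tsum_congr (fun m => ?_)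
    rw [← besCoeff_succ]
    push_cast
    ring
  rw [h2] at key
  exact key

theorem contDiff_bes (μ : ℝ) : ContDiff ℝ (⊤ : ℕ∞) (bes μ) := by
  rw [contDiff_infty]
  intro n
  induction n generalizing μ with
  | zero =>
    exact contDiff_zero.2 (continuous_iff_continuousAt.2 fun y => (hasDerivAt_bes μ y).continuousAt)
  | succ n ih =>
    have hd : deriv (bes μ) = bes (μ + 1) := funext fun y => (hasDerivAt_bes μ y).deriv
    have := (contDiff_succ_iff_deriv (n := n) (f := bes μ) (𝕜 := ℝ)).2
      ⟨fun y => (hasDerivAt_bes μ y).differentiableAt, by simp, by rw [hd]; exact ih _⟩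
    exact_mod_cast this

theorem continuous_bes (μ : ℝ) : Continuous (bes μ) := (contDiff_bes μ).continuous

/-- Arbitrary real order matters here: the final formula involves order `ν - 1`, which is `-3/2` for
`d = 1`. For `d = 2` it is `-1`, where the coefficient `m = 0` sits at a pole of `Γ` and is zero by
convention. -/
theorem bes_pred (μ y : ℝ) : bes (μ - 1) y = μ * bes μ y + y * bes (μ + 1) y := by
  have hs : Summable fun m : ℕ => (m : ℝ) * besCoeff μ m * y ^ m := by
    rw [← summable_nat_add_iff 1]
    refine ((summable_bes (μ + 1) y).mul_left y).congr (fun m => ?_)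
    rw [← besCoeff_succ]
    push_cast
    ring
  have h1 : y * bes (μ + 1) y = ∑' m : ℕ, (m : ℝ) * besCoeff μ m * y ^ m := by
    rw [hs.tsum_eq_zero_add]
    simp only [Nat.cast_zero, zero_mul, zero_add]
    unfold bes
    rw [← tsum_mul_left]
    refine tsum_congr (fun m => ?_)
    rw [← besCoeff_succ]
    push_cast
    ring
  rw [h1]
  unfold bes
  rw [← tsum_mul_left, ← ((summable_bes μ y).mul_left μ).tsum_add hs]
  refine tsum_congr (fun m => ?_)
  rw [besCoeff_pred]
  ring

/-- As orders `μ + 1` and `μ + 2` are the first two derivatives of `f = bes μ`, this is the equation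
`y f'' + (μ + 1) f' = f`. The sign of `y` decides between `I` and `J`. -/
theorem bes_recurrence (μ y : ℝ) : y * bes (μ + 2) y = bes μ y - (μ + 1) * bes (μ + 1) y := by
  have := bes_pred (μ + 1) y
  rw [show μ + 1 - 1 = μ by ring, show μ + 1 + 1 = μ + 2 by ring] at this
  linarith

theorem bes_pos {μ y : ℝ} (hμ : -1 < μ) (hy : 0 ≤ y) : 0 < bes μ y := by
  have hc : ∀ m : ℕ, 0 < besCoeff μ m := fun m =>
    inv_pos.2 (mul_pos (by positivity) (Real.Gamma_pos_of_pos (by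
      have : (0 : ℝ) ≤ m := m.cast_nonneg
      linarith)))
  exact (summable_bes μ y).tsum_pos (fun m => mul_nonneg (hc m).le (by positivity)) 0
    (by simpa using hc 0)

/-! ### From the entire function back to `I` and `J` -/

theorem besselI_eq (μ : ℝ) {x : ℝ} (hx : 0 < x) :
    besselI μ x = (x / 2) ^ μ * bes μ (x ^ 2 / 4) := by
  unfold besselI bes
  rw [← tsum_mul_left]
  refine tsum_congr (fun m => ?_)
  rw [Real.rpow_add (by positivity), show (2 * (m : ℝ)) = ((2 * m : ℕ) : ℝ) by push_cast; rfl,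
    Real.rpow_natCast, pow_mul, show (x / 2) ^ 2 = x ^ 2 / 4 by ring]
  unfold besCoeff
  ring

theorem besselJ_eq (μ : ℝ) {x : ℝ} (hx : 0 < x) :
    besselJ μ x = (x / 2) ^ μ * bes μ (-(x ^ 2 / 4)) := by
  unfold besselJ bes
  rw [← tsum_mul_left]
  refine tsum_congr (fun m => ?_)
  rw [Real.rpow_add (by positivity), show (2 * (m : ℝ)) = ((2 * m : ℕ) : ℝ) by push_cast; rfl,
    Real.rpow_natCast, pow_mul, show (x / 2) ^ 2 = x ^ 2 / 4 by ring, neg_pow (x ^ 2 / 4)]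
  unfold besCoeff
  ring

/-! ### The Wronskian of the regular radial solutions -/

/-- `J_μ I_{μ+1} + I_μ J_{μ+1}` up to a power, in the variable `z = x²/4`. -/
def besWronskian (μ z : ℝ) : ℝ := bes μ (-z) * bes (μ + 1) z + bes μ z * bes (μ + 1) (-z)

theorem hasDerivAt_bes_neg (μ z : ℝ) :
    HasDerivAt (fun z => bes μ (-z)) (-bes (μ + 1) (-z)) z := by
  have h := HasDerivAt.scomp z (hasDerivAt_bes μ (-z)) (hasDerivAt_neg z)
  exact h.congr_deriv (by simp)

theorem continuous_besWronskian (μ : ℝ) : Continuous (besWronskian μ) := by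
  have := continuous_bes μ
  have := continuous_bes (μ + 1)
  unfold besWronskian
  fun_prop

theorem hasDerivAt_besWronskian (μ z : ℝ) :
    HasDerivAt (besWronskian μ)
      (bes μ (-z) * bes (μ + 2) z - bes μ z * bes (μ + 2) (-z)) z := by
  have h := (((hasDerivAt_bes_neg μ z).mul (hasDerivAt_bes (μ + 1) z)).add
    ((hasDerivAt_bes μ z).mul (hasDerivAt_bes_neg (μ + 1) z)))
  rw [show μ + 1 + 1 = μ + 2 by ring] at h
  refine h.congr_deriv ?_
  ring

/-- The hypothesis says `(zᵃ f)' = zᵃ⁻¹ g`, so `zᵃ f` increases strictly from its value `0` at the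
origin. Positivity of `g` is needed only on the open interval, yet the conclusion reaches the
endpoint `Z`. -/
theorem pos_of_deriv_rpow_mul {f f' g : ℝ → ℝ} {a Z : ℝ} (ha : 0 < a)
    (hf : ∀ z, HasDerivAt f (f' z) z)
    (h : ∀ z, 0 < z → a * f z + z * f' z = g z) (hg : ∀ z, 0 < z → z < Z → 0 < g z) :
    ∀ z, 0 < z → z ≤ Z → 0 < f z := by
  intro z hz hzZ
  have hcont : Continuous f := continuous_iff_continuousAt.2 fun y => (hf y).continuousAt
  have hmono : StrictMonoOn (fun t : ℝ => t ^ a * f t) (Set.Icc 0 Z) := by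
    refine strictMonoOn_of_deriv_pos (convex_Icc _ _)
      ((Real.continuous_rpow_const ha.le).mul hcont).continuousOn (fun t ht => ?_)
    rw [interior_Icc] at ht
    have hd := (Real.hasDerivAt_rpow_const (p := a) (Or.inl ht.1.ne')).mul (hf t)
    have e : a * t ^ (a - 1) * f t + t ^ a * f' t = t ^ (a - 1) * g t := by
      rw [← h t ht.1, show t ^ a = t ^ (a - 1) * t by
        rw [← Real.rpow_add_one ht.1.ne']; congr 1; ring]
      ring
    have hd' : deriv (fun t : ℝ => t ^ a * f t) t = _ := hd.deriv
    rw [hd', e]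
    exact mul_pos (Real.rpow_pos_of_pos ht.1 _) (hg t ht.1 ht.2)
  have h0 := hmono ⟨le_rfl, hz.le.trans hzZ⟩ ⟨hz.le, hzZ⟩ hz
  simp only [Real.zero_rpow ha.ne', zero_mul] at h0
  exact pos_of_mul_pos_right h0 (Real.rpow_nonneg hz.le _)

/-- The product `p(z) = bes (μ+1) z * bes (μ+1) (-z)` satisfies `2(μ+1)p + z p' = besWronskian μ`.
Including the endpoint `Z` is what places the first zero of the Wronskian strictly before that of
`J_{μ+1}`. -/
theorem bes_succ_neg_pos_of_besWronskian_pos {μ Z : ℝ} (hμ : -1 < μ)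
    (h : ∀ z, 0 < z → z < Z → 0 < besWronskian μ z) :
    ∀ z, 0 < z → z ≤ Z → 0 < bes (μ + 1) (-z) := by
  intro z hz hzZ
  have := pos_of_deriv_rpow_mul (f := fun z => bes (μ + 1) z * bes (μ + 1) (-z))
    (f' := fun z => bes (μ + 2) z * bes (μ + 1) (-z) - bes (μ + 1) z * bes (μ + 2) (-z))
    (g := besWronskian μ) (a := 2 * (μ + 1)) (Z := Z) (by linarith) (fun z => ?_)
    (fun z _ => ?_) h z hz hzZ
  · exact (pos_iff_pos_of_mul_pos this).1 (bes_pos (by linarith) hz.le)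
  · have h := (hasDerivAt_bes (μ + 1) z).mul (hasDerivAt_bes_neg (μ + 1) z)
    rw [show μ + 1 + 1 = μ + 2 by ring] at h
    refine h.congr_deriv ?_
    ring
  · have h1 := bes_recurrence μ z
    have h2 := bes_recurrence μ (-z)
    unfold besWronskian
    linear_combination bes (μ + 1) (-z) * h1 + bes (μ + 1) z * h2

/-- Here the first-order equation is `(μ+1)W + zW' = 2 bes μ z * bes μ (-z)`. Together with the
preceding lemma it allows positivity to climb from one order to the next. -/
theorem besWronskian_pos_of_bes_neg_pos {μ Z : ℝ} (hμ : -1 < μ)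
    (h : ∀ z, 0 < z → z < Z → 0 < bes μ (-z)) :
    ∀ z, 0 < z → z ≤ Z → 0 < besWronskian μ z := by
  refine pos_of_deriv_rpow_mul (g := fun z => 2 * (bes μ z * bes μ (-z))) (a := μ + 1)
    (by linarith) (hasDerivAt_besWronskian μ) (fun z _ => ?_)
    (fun z hz hzZ => mul_pos two_pos (mul_pos (bes_pos hμ hz.le) (h z hz hzZ)))
  have h1 := bes_recurrence μ z
  have h2 := bes_recurrence μ (-z)
  unfold besWronskian
  linear_combination bes μ (-z) * h1 + bes μ z * h2

/-- If the Wronskian stayed positive, the two preceding lemmas used alternately would make `bes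
(μ+k) (-z)` positive for `k = 1, …, 4` and all `z > 0`. Two instances of the recurrence contradict
this at a suitable `z`, so no oscillation theory is required. -/
theorem exists_besWronskian_nonpos {μ : ℝ} (hμ : -1 < μ) :
    ∃ z, 0 < z ∧ besWronskian μ z ≤ 0 := by
  by_contra! hcon
  have step : ∀ η : ℝ, -1 < η → (∀ z, 0 < z → 0 < besWronskian η z) →
      (∀ z, 0 < z → 0 < bes (η + 1) (-z)) ∧ ∀ z, 0 < z → 0 < besWronskian (η + 1) z := by
    intro η hη h
    have h1 : ∀ z, 0 < z → 0 < bes (η + 1) (-z) := fun z hz =>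
      bes_succ_neg_pos_of_besWronskian_pos hη (Z := z) (fun z hz _ => h z hz) z hz le_rfl
    exact ⟨h1, fun z hz => besWronskian_pos_of_bes_neg_pos (by linarith) (Z := z)
      (fun z hz _ => h1 z hz) z hz le_rfl⟩
  obtain ⟨j1, w1⟩ := step μ hμ hcon
  obtain ⟨j2, w2⟩ := step (μ + 1) (by linarith) w1
  obtain ⟨j3, w3⟩ := step (μ + 1 + 1) (by linarith) w2
  obtain ⟨j4, -⟩ := step (μ + 1 + 1 + 1) (by linarith) w3
  -- With `bₖ = bes (μ+k) (-z)`, positivity of `b₁` and `b₄` gives `z b₃ < (μ+2) b₂` and `b₂ < (μ+3)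
  -- b₃`. These are incompatible as soon as `z ≥ (μ+2)(μ+3)`.
  set z : ℝ := (μ + 2) * (μ + 3) with hz
  have hz0 : 0 < z := mul_pos (by linarith) (by linarith)
  have r1 := bes_recurrence (μ + 1) (-z)
  have r2 := bes_recurrence (μ + 2) (-z)
  have p1 := j1 z hz0
  have p2 := j2 z hz0
  have p3 := j3 z hz0
  have p4 := j4 z hz0
  rw [show μ + 1 + 1 = μ + 2 by ring] at p2 p3 p4 r1
  rw [show μ + 2 + 1 = μ + 3 by ring] at p3 p4 r2
  rw [show μ + 3 + 1 = μ + 4 by ring] at p4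
  rw [show μ + 1 + 2 = μ + 3 by ring] at r1
  rw [show μ + 2 + 2 = μ + 4 by ring] at r2
  have a1 : bes (μ + 2) (-z) < (μ + 3) * bes (μ + 3) (-z) := by
    nlinarith [mul_pos hz0 p4]
  have a2 : z * bes (μ + 3) (-z) < (μ + 2) * bes (μ + 2) (-z) := by
    nlinarith
  have a3 := mul_lt_mul_of_pos_left a1 (show 0 < μ + 2 by linarith)
  rw [hz] at a2 a3
  nlinarith

theorem besWronskian_zero_pos {μ : ℝ} (hμ : -1 < μ) : 0 < besWronskian μ 0 := by
  unfold besWronskian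
  rw [neg_zero]
  have h1 := bes_pos hμ le_rfl
  have h2 := bes_pos (show -1 < μ + 1 by linarith) le_rfl
  positivity

/-- The least positive zero of the Wronskian. -/
theorem exists_least_zero_besWronskian {μ : ℝ} (hμ : -1 < μ) :
    ∃ z, 0 < z ∧ besWronskian μ z = 0 ∧ ∀ t, 0 ≤ t → t < z → 0 < besWronskian μ t := by
  have hc := continuous_besWronskian μ
  set S : Set ℝ := {z | 0 ≤ z ∧ besWronskian μ z ≤ 0} with hS
  have hcl : IsClosed S := isClosed_Ici.inter (isClosed_le hc continuous_const)
  obtain ⟨z1, hz1, hw1⟩ := exists_besWronskian_nonpos hμ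
  have hbdd : BddBelow S := ⟨0, fun _ h => h.1⟩
  have hmem : sInf S ∈ S := hcl.csInf_mem ⟨z1, hz1.le, hw1⟩ hbdd
  have hbelow : ∀ t, 0 ≤ t → t < sInf S → 0 < besWronskian μ t := fun t ht hlt => by
    by_contra! h
    exact absurd (csInf_le hbdd (show t ∈ S from ⟨ht, h⟩)) (not_le.2 hlt)
  have hpos : 0 < sInf S := by
    refine lt_of_le_of_ne hmem.1 (fun h => ?_)
    have := hmem.2
    rw [← h] at this
    exact absurd this (not_le.2 (besWronskian_zero_pos hμ))
  refine ⟨sInf S, hpos, le_antisymm hmem.2 ?_, hbelow⟩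
  -- Closedness of `S` gave `W ≤ 0` at the infimum; the limit from the left gives `W ≥ 0`.
  refine ge_of_tendsto (hc.continuousAt.tendsto.mono_left nhdsWithin_le_nhds :
    Tendsto (besWronskian μ) (𝓝[<] (sInf S)) _) ?_
  filter_upwards [Ioo_mem_nhdsLT hpos] with t ht
  exact (hbelow t ht.1.le ht.2).le

/-- The powers of `x/2` cancel up to one nonzero factor and `I_μ` has no positive zero, so only
nonvanishing of `J_μ` survives as a side condition. -/
theorem mem_besselQuotientZeros_iff {μ x : ℝ} (hμ : -1 < μ) (hx : 0 < x) :
    x ∈ besselQuotientZeros μ ↔ bes μ (-(x ^ 2 / 4)) ≠ 0 ∧ besWronskian μ (x ^ 2 / 4) = 0 := by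
  have hI := bes_pos hμ (show 0 ≤ x ^ 2 / 4 by positivity)
  have hx2 : 0 < x / 2 := by positivity
  have hp := Real.rpow_pos_of_pos hx2 μ
  have hp1 := Real.rpow_add_one hx2.ne' μ
  simp only [besselQuotientZeros, Set.mem_ofPred_eq, besselJ_eq _ hx, besselI_eq _ hx, hp1]
  constructor
  · rintro ⟨-, hJ, -, h⟩
    have hJ' := right_ne_zero_of_mul hJ
    refine ⟨hJ', ?_⟩
    field_simp at h
    rw [mul_zero] at h
    unfold besWronskian
    linarith [(mul_eq_zero.1 h).resolve_left hx.ne']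
  · rintro ⟨hJ, h⟩
    refine ⟨hx, mul_ne_zero hp.ne' hJ, mul_ne_zero hp.ne' hI.ne', ?_⟩
    unfold besWronskian at h
    field_simp
    rw [mul_zero]
    exact mul_eq_zero_of_right _ (by linarith)

/-- The least zero of the Bessel quotient, and the signs that come with it. -/
theorem firstZero_spec {μ : ℝ} (hμ : -1 < μ) :
    IsLeast (besselQuotientZeros μ) (firstZero μ) ∧ 0 < firstZero μ ∧
    besWronskian μ (firstZero μ ^ 2 / 4) = 0 ∧
    (∀ t, 0 ≤ t → t < firstZero μ ^ 2 / 4 → 0 < besWronskian μ t) ∧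
    bes μ (-(firstZero μ ^ 2 / 4)) < 0 ∧
    ∀ t, 0 ≤ t → t ≤ firstZero μ ^ 2 / 4 → 0 < bes (μ + 1) (-t) := by
  obtain ⟨z, hz, hwz, hlt⟩ := exists_least_zero_besWronskian hμ
  have hj1 : ∀ t, 0 ≤ t → t ≤ z → 0 < bes (μ + 1) (-t) := by
    intro t ht htz
    rcases ht.eq_or_lt with rfl | ht
    · rw [neg_zero]; exact bes_pos (by linarith) le_rfl
    · exact bes_succ_neg_pos_of_besWronskian_pos hμ (fun t ht h => hlt t ht.le h) t ht htz
  -- In `W(z) = 0` the summand `bes μ z * bes (μ+1) (-z)` is positive, so the other one is negative.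
  -- In particular `J_μ` does not vanish there, and this zero of `W` lies in the domain of the
  -- quotient.
  have hj0 : bes μ (-z) < 0 := by
    have h1 := mul_pos (bes_pos hμ hz.le) (hj1 z hz.le le_rfl)
    have h2 := bes_pos (show -1 < μ + 1 by linarith) hz.le
    unfold besWronskian at hwz
    nlinarith
  have hs : 0 < 2 * √z := by positivity
  have hsz : (2 * √z) ^ 2 / 4 = z := by
    rw [mul_pow, Real.sq_sqrt hz.le]; ring
  have hleast : IsLeast (besselQuotientZeros μ) (2 * √z) := by
    refine ⟨(mem_besselQuotientZeros_iff hμ hs).2 (by rw [hsz]; exact ⟨hj0.ne, hwz⟩), ?_⟩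
    intro x hx
    have hx0 : 0 < x := hx.1
    have h := ((mem_besselQuotientZeros_iff hμ hx0).1 hx).2
    by_contra! hcon
    have : x ^ 2 / 4 < z := by rw [← hsz]; gcongr
    exact (hlt _ (by positivity) this).ne' h
  have hfz : firstZero μ = 2 * √z := hleast.csInf_eq
  rw [hfz, hsz]
  exact ⟨hleast, hs, hwz, hlt, hj0, hj1⟩

/-! ### Partial derivatives of smooth functions -/

/-- The Euclidean space of dimension `d`. -/
abbrev Euc (d : ℕ) : Type := EuclideanSpace ℝ (Fin d)

/-- The classical Laplacian. -/
def lap {d : ℕ} (φ : Euc d → ℝ) (x : Euc d) : ℝ :=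
  ∑ i, classicalPartial i (classicalPartial i φ) x

/-- Smooth functions on `ℝ^d`. -/
abbrev Smooth {d : ℕ} (φ : Euc d → ℝ) : Prop := ContDiff ℝ (⊤ : ℕ∞) φ

section Calculus

variable {d : ℕ} {φ ψ : Euc d → ℝ} {i j : Fin d}

theorem Smooth.differentiable (h : Smooth φ) : Differentiable ℝ φ :=
  ContDiff.differentiable h (by simp)

theorem Smooth.classicalPartial (h : Smooth φ) (i : Fin d) :
    Smooth (classicalPartial i φ) :=
  (ContDiff.fderiv_right h (m := ((⊤ : ℕ∞) : WithTop ℕ∞)) (by simp)).clm_apply contDiff_const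

theorem Smooth.lap (h : Smooth φ) : Smooth (lap φ) :=
  ContDiff.sum fun i _ => (h.classicalPartial i).classicalPartial i

theorem tsupport_classicalPartial_subset (i : Fin d) (φ : Euc d → ℝ) :
    tsupport (classicalPartial i φ) ⊆ tsupport φ := by
  refine closure_minimal (fun x hx => ?_) (isClosed_tsupport _)
  by_contra h
  refine hx ?_
  have : fderiv ℝ φ x = 0 := by
    by_contra h0
    exact h (support_fderiv_subset ℝ h0)
  simp [classicalPartial, this]

theorem tsupport_lap_subset (φ : Euc d → ℝ) : tsupport (lap φ) ⊆ tsupport φ := by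
  refine closure_minimal (fun x hx => ?_) (isClosed_tsupport _)
  by_contra h
  refine hx (Finset.sum_eq_zero fun i _ => ?_)
  refine image_eq_zero_of_notMem_tsupport fun h' => h ?_
  exact tsupport_classicalPartial_subset i _ (tsupport_classicalPartial_subset i _ h')

theorem hasCompactSupport_classicalPartial (h : HasCompactSupport φ) (i : Fin d) :
    HasCompactSupport (classicalPartial i φ) :=
  h.of_isClosed_subset (isClosed_tsupport _) (tsupport_classicalPartial_subset i φ)

theorem hasCompactSupport_lap (h : HasCompactSupport φ) : HasCompactSupport (lap φ) :=
  h.of_isClosed_subset (isClosed_tsupport _) (tsupport_lap_subset φ)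

theorem classicalPartial_add (hφ : Smooth φ) (hψ : Smooth ψ) (i : Fin d) :
    classicalPartial i (fun x => φ x + ψ x) =
      fun x => classicalPartial i φ x + classicalPartial i ψ x := by
  funext x
  simp [classicalPartial, fderiv_fun_add (hφ.differentiable x) (hψ.differentiable x)]

theorem classicalPartial_const_mul (hφ : Smooth φ) (a : ℝ) (i : Fin d) :
    classicalPartial i (fun x => a * φ x) = fun x => a * classicalPartial i φ x := by
  funext x
  simp [classicalPartial, fderiv_const_mul (hφ.differentiable x)]

theorem classicalPartial_mul (hφ : Smooth φ) (hψ : Smooth ψ) (i : Fin d) :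
    classicalPartial i (fun x => φ x * ψ x) =
      fun x => φ x * classicalPartial i ψ x + ψ x * classicalPartial i φ x := by
  funext x
  simp [classicalPartial, fderiv_fun_mul (hφ.differentiable x) (hψ.differentiable x)]

theorem lap_add (hφ : Smooth φ) (hψ : Smooth ψ) :
    lap (fun x => φ x + ψ x) = fun x => lap φ x + lap ψ x := by
  funext x
  unfold lap
  rw [← Finset.sum_add_distrib]
  refine Finset.sum_congr rfl fun i _ => ?_
  rw [classicalPartial_add hφ hψ,
    classicalPartial_add (hφ.classicalPartial i) (hψ.classicalPartial i)]

theorem lap_const_mul (hφ : Smooth φ) (a : ℝ) :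
    lap (fun x => a * φ x) = fun x => a * lap φ x := by
  funext x
  unfold lap
  rw [Finset.mul_sum]
  refine Finset.sum_congr rfl fun i _ => ?_
  rw [classicalPartial_const_mul hφ, classicalPartial_const_mul (hφ.classicalPartial i)]

theorem classicalPartial_comp_add (φ : Euc d → ℝ) (c : Euc d) (i : Fin d) :
    classicalPartial i (fun x => φ (x + c)) = fun x => classicalPartial i φ (x + c) := by
  funext x
  simp [classicalPartial, fderiv_comp_add_right]

theorem lap_comp_add (φ : Euc d → ℝ) (c : Euc d) :
    lap (fun x => φ (x + c)) = fun x => lap φ (x + c) := by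
  funext x
  unfold lap
  refine Finset.sum_congr rfl fun i _ => ?_
  rw [classicalPartial_comp_add, classicalPartial_comp_add]

theorem classicalPartial_classicalPartial (hφ : Smooth φ) (i j : Fin d) (x : Euc d) :
    classicalPartial j (classicalPartial i φ) x =
      fderiv ℝ (fderiv ℝ φ) x (EuclideanSpace.single j 1) (EuclideanSpace.single i 1) := by
  have h : DifferentiableAt ℝ (fderiv ℝ φ) x :=
    (ContDiff.fderiv_right hφ (m := 1) (by norm_cast)).differentiable (by simp) x
  have e : classicalPartial i φ = fun y => fderiv ℝ φ y (EuclideanSpace.single i 1) := rfl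
  rw [e, classicalPartial, fderiv_clm_apply h (differentiableAt_const _)]
  simp

/-- The basis-free Laplacian can be expanded in any orthonormal basis, which is what rotation
invariance requires. -/
theorem lap_eq_laplacian (hφ : Smooth φ) : lap φ = Laplacian.laplacian φ := by
  rw [InnerProductSpace.laplacian_eq_iteratedFDeriv_orthonormalBasis φ
    (EuclideanSpace.basisFun (Fin d) ℝ)]
  funext x
  refine Finset.sum_congr rfl fun i _ => ?_
  rw [classicalPartial_classicalPartial hφ, iteratedFDeriv_two_apply]
  simp

theorem Smooth.comp_linearIsometryEquiv (hφ : Smooth φ) (g : Euc d ≃ₗᵢ[ℝ] Euc d) :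
    Smooth fun x => φ (g x) :=
  ContDiff.comp hφ g.contDiff

/-- By the chain rule, second derivatives of `φ ∘ g` along `eᵢ` are those of `φ` along `g eᵢ`, and
the vectors `g eᵢ` again form an orthonormal basis. -/
theorem lap_comp_linearIsometryEquiv (hφ : Smooth φ) (g : Euc d ≃ₗᵢ[ℝ] Euc d) :
    lap (fun x => φ (g x)) = fun x => lap φ (g x) := by
  funext x
  have h2 : ∀ y, DifferentiableAt ℝ (fderiv ℝ φ) y := fun y =>
    (ContDiff.fderiv_right hφ (m := 1) (by norm_cast)).differentiable (by simp) y
  have h1 : ∀ y v, fderiv ℝ (fun x => φ (g x)) y v = fderiv ℝ φ (g y) (g v) := by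
    intro y v
    have := ((hφ.differentiable (g y)).hasFDerivAt.comp y
      (g.toContinuousLinearEquiv.hasFDerivAt (x := y))).fderiv
    have e : fderiv ℝ (fun x => φ (g x)) y = _ := this
    rw [e]
    rfl
  rw [lap_eq_laplacian hφ, InnerProductSpace.laplacian_eq_iteratedFDeriv_orthonormalBasis φ
    ((EuclideanSpace.basisFun (Fin d) ℝ).map g)]
  refine Finset.sum_congr rfl fun i _ => ?_
  rw [iteratedFDeriv_two_apply]
  have e : classicalPartial i (fun x => φ (g x)) =
      fun y => fderiv ℝ φ (g y) (g (EuclideanSpace.single i 1)) := funext fun y => h1 y _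
  have hd : HasFDerivAt (fun y => fderiv ℝ φ (g y) (g (EuclideanSpace.single i 1)))
      (((ContinuousLinearMap.apply ℝ ℝ (g (EuclideanSpace.single i 1))).comp
        ((fderiv ℝ (fderiv ℝ φ) (g x)).comp g.toContinuousLinearEquiv.toContinuousLinearMap))) x :=
    (ContinuousLinearMap.apply ℝ ℝ (g (EuclideanSpace.single i 1))).hasFDerivAt.comp x
      ((h2 (g x)).hasFDerivAt.comp x (g.toContinuousLinearEquiv.hasFDerivAt (x := x)))
  rw [e, classicalPartial, hd.fderiv]
  simp

/-! ### Integration by parts -/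

theorem integrable_mul_of_hasCompactSupport (hφ : Continuous φ) (hψ : Continuous ψ)
    (hc : HasCompactSupport φ) : Integrable fun x => φ x * ψ x :=
  (hφ.mul hψ).integrable_of_hasCompactSupport hc.mul_right

theorem integral_mul_classicalPartial (hφ : Smooth φ) (hψ : Smooth ψ)
    (hc : HasCompactSupport φ) (i : Fin d) :
    ∫ x, φ x * classicalPartial i ψ x = -∫ x, classicalPartial i φ x * ψ x :=
  integral_mul_fderiv_eq_neg_fderiv_mul_of_integrable
    (integrable_mul_of_hasCompactSupport (hφ.classicalPartial i).continuous hψ.continuous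
      (hasCompactSupport_classicalPartial hc i))
    (integrable_mul_of_hasCompactSupport hφ.continuous (hψ.classicalPartial i).continuous hc)
    (integrable_mul_of_hasCompactSupport hφ.continuous hψ.continuous hc)
    (fun x _ => hφ.differentiable x) (fun x _ => hψ.differentiable x)

theorem integral_sum_classicalPartial_mul (hφ : Smooth φ) (hψ : Smooth ψ)
    (hc : HasCompactSupport φ) :
    ∫ x, ∑ i, classicalPartial i φ x * classicalPartial i ψ x = -∫ x, φ x * lap ψ x := by
  have hi : ∀ i, Integrable fun x => classicalPartial i φ x * classicalPartial i ψ x := fun i =>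
    integrable_mul_of_hasCompactSupport (hφ.classicalPartial i).continuous
      (hψ.classicalPartial i).continuous (hasCompactSupport_classicalPartial hc i)
  have hi2 : ∀ i, Integrable fun x => φ x * classicalPartial i (classicalPartial i ψ) x := fun i =>
    integrable_mul_of_hasCompactSupport hφ.continuous
      ((hψ.classicalPartial i).classicalPartial i).continuous hc
  rw [integral_finsetSum _ fun i _ => hi i]
  simp only [lap, Finset.mul_sum]
  rw [integral_finsetSum _ fun i _ => hi2 i, ← Finset.sum_neg_distrib]
  refine Finset.sum_congr rfl fun i _ => ?_
  rw [integral_mul_classicalPartial hφ (hψ.classicalPartial i) hc, neg_neg]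

/-- Green's formula. -/
theorem integral_lap_mul (hφ : Smooth φ) (hψ : Smooth ψ) (hc : HasCompactSupport φ) :
    ∫ x, lap φ x * ψ x = ∫ x, φ x * lap ψ x := by
  have hi2 : ∀ i, Integrable fun x => classicalPartial i (classicalPartial i φ) x * ψ x := fun i =>
    integrable_mul_of_hasCompactSupport ((hφ.classicalPartial i).classicalPartial i).continuous
      hψ.continuous (hasCompactSupport_classicalPartial (hasCompactSupport_classicalPartial hc i) i)
  have hi : ∀ i, Integrable fun x => classicalPartial i φ x * classicalPartial i ψ x := fun i =>
    integrable_mul_of_hasCompactSupport (hφ.classicalPartial i).continuous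
      (hψ.classicalPartial i).continuous (hasCompactSupport_classicalPartial hc i)
  rw [← neg_eq_iff_eq_neg.2 (integral_sum_classicalPartial_mul hφ hψ hc)]
  simp only [lap, Finset.sum_mul]
  rw [integral_finsetSum _ fun i _ => hi i, integral_finsetSum _ fun i _ => hi2 i,
    ← Finset.sum_neg_distrib]
  refine Finset.sum_congr rfl fun i _ => ?_
  rw [integral_mul_classicalPartial (hφ.classicalPartial i) hψ
    (hasCompactSupport_classicalPartial hc i), neg_neg]

theorem integral_sum_sq_classicalPartial (hφ : Smooth φ) (hc : HasCompactSupport φ) :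
    ∫ x, ∑ i, classicalPartial i φ x ^ 2 = -∫ x, φ x * lap φ x := by
  simp only [sq]
  exact integral_sum_classicalPartial_mul hφ hφ hc

/-! ### Radial functions -/

/-- Radial functions are written in the variable `|x - c|²`, so that a smooth profile gives a smooth
function at the centre too. -/
theorem hasFDerivAt_radial {F : ℝ → ℝ} {F' : ℝ} {c x : Euc d}
    (hF : HasDerivAt F F' (‖x - c‖ ^ 2)) :
    HasFDerivAt (fun x => F (‖x - c‖ ^ 2)) (F' • (2 • innerSL ℝ (x - c))) x := by
  have h : HasFDerivAt (fun x : Euc d => ‖x - c‖ ^ 2) (2 • innerSL ℝ (x - c)) x := by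
    have := (((hasFDerivAt_id x).sub_const c)).norm_sq
    simpa using this
  exact hF.comp_hasFDerivAt x h

theorem classicalPartial_radial {F F' : ℝ → ℝ} (c : Euc d)
    (hF : ∀ y, HasDerivAt F (F' y) y) (i : Fin d) :
    classicalPartial i (fun x => F (‖x - c‖ ^ 2)) =
      fun x => (x i - c i) * (2 * F' (‖x - c‖ ^ 2)) := by
  funext x
  rw [classicalPartial, (hasFDerivAt_radial (hF _)).fderiv]
  simp [EuclideanSpace.inner_single_right]
  ring

theorem classicalPartial_coord_mul_radial {F F' : ℝ → ℝ} (c : Euc d)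
    (hF : ∀ y, HasDerivAt F (F' y) y) (i j : Fin d) :
    classicalPartial j (fun x => (x i - c i) * F (‖x - c‖ ^ 2)) =
      fun x => (if i = j then F (‖x - c‖ ^ 2) else 0) +
        2 * (x i - c i) * (x j - c j) * F' (‖x - c‖ ^ 2) := by
  funext x
  have h1 : HasFDerivAt (fun x : Euc d => x i - c i) (EuclideanSpace.proj i : Euc d →L[ℝ] ℝ) x :=
    (EuclideanSpace.proj i : Euc d →L[ℝ] ℝ).hasFDerivAt.sub_const _
  have h2 := (h1.mul (hasFDerivAt_radial (c := c) (x := x) (hF _))).fderiv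
  have e : classicalPartial j (fun x => (x i - c i) * F (‖x - c‖ ^ 2)) x =
    fderiv ℝ ((fun x : Euc d => x i - c i) * fun x => F (‖x - c‖ ^ 2)) x
      (EuclideanSpace.single j 1) := rfl
  rw [e, h2]
  simp [EuclideanSpace.inner_single_right]
  split_ifs <;> ring

theorem classicalPartial_classicalPartial_radial {F F' F'' : ℝ → ℝ} (c : Euc d)
    (hF : ∀ y, HasDerivAt F (F' y) y) (hF' : ∀ y, HasDerivAt F' (F'' y) y) (i j : Fin d) :
    classicalPartial j (classicalPartial i (fun x => F (‖x - c‖ ^ 2))) =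
      fun x => (if i = j then 2 * F' (‖x - c‖ ^ 2) else 0) +
        4 * (x i - c i) * (x j - c j) * F'' (‖x - c‖ ^ 2) := by
  rw [classicalPartial_radial c hF, classicalPartial_coord_mul_radial (F := fun y => 2 * F' y) c
    (fun y => (hF' y).const_mul 2)]
  funext x
  ring

theorem sum_sub_sq (x c : Euc d) : ∑ i, (x i - c i) ^ 2 = ‖x - c‖ ^ 2 := by
  simp [EuclideanSpace.norm_sq_eq]

theorem lap_radial {F F' F'' : ℝ → ℝ} (c : Euc d)
    (hF : ∀ y, HasDerivAt F (F' y) y) (hF' : ∀ y, HasDerivAt F' (F'' y) y) :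
    lap (fun x => F (‖x - c‖ ^ 2)) =
      fun x => 2 * d * F' (‖x - c‖ ^ 2) + 4 * ‖x - c‖ ^ 2 * F'' (‖x - c‖ ^ 2) := by
  funext x
  simp only [lap, classicalPartial_classicalPartial_radial c hF hF', if_true]
  rw [Finset.sum_add_distrib, ← sum_sub_sq]
  simp only [Finset.sum_const, Finset.card_univ, Fintype.card_fin, nsmul_eq_mul, Finset.mul_sum,
    Finset.sum_mul]
  congr 1
  · ring
  · exact Finset.sum_congr rfl fun i _ => by ring

theorem smooth_radial {F : ℝ → ℝ} (c : Euc d) (hF : ContDiff ℝ (⊤ : ℕ∞) F) :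
    Smooth fun x => F (‖x - c‖ ^ 2) :=
  hF.comp ((contDiff_id.sub contDiff_const).norm_sq ℝ)

/-- The regular radial solution of `Δf = s f`. -/
def radialSol (s : ℝ) (c x : Euc d) : ℝ := bes ((d : ℝ) / 2 - 1) (s * ‖x - c‖ ^ 2 / 4)

theorem hasDerivAt_bes_scaled (μ s y : ℝ) :
    HasDerivAt (fun y => bes μ (s * y / 4)) (s / 4 * bes (μ + 1) (s * y / 4)) y := by
  have h : HasDerivAt (fun y : ℝ => s * y / 4) (s / 4) y := by
    simpa using ((hasDerivAt_id y).const_mul s).div_const 4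
  have := HasDerivAt.comp y (hasDerivAt_bes μ (s * y / 4)) h
  exact this.congr_deriv (mul_comm _ _)

theorem contDiff_bes_scaled (μ s : ℝ) : ContDiff ℝ (⊤ : ℕ∞) fun y => bes μ (s * y / 4) :=
  (contDiff_bes μ).comp ((contDiff_const.mul contDiff_id).div_const 4)

theorem smooth_radialSol (s : ℝ) (c : Euc d) : Smooth (radialSol s c) :=
  smooth_radial c (contDiff_bes_scaled _ s)

/-- In the variable `y = |x - c|²` the Laplacian is `2dF' + 4yF''`. For `F(y) = bes (d/2 - 1)
(sy/4)` the equation is `s` times the recurrence, whatever the sign of `s`. -/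
theorem lap_radialSol (s : ℝ) (c : Euc d) : lap (radialSol s c) = fun x => s * radialSol s c x := by
  have h1 := hasDerivAt_bes_scaled ((d : ℝ) / 2 - 1) s
  have h2 := fun y => (hasDerivAt_bes_scaled ((d : ℝ) / 2 - 1 + 1) s y).const_mul (s / 4)
  have e : radialSol s c = fun x => (fun y => bes ((d : ℝ) / 2 - 1) (s * y / 4)) (‖x - c‖ ^ 2) :=
    rfl
  rw [e, lap_radial c h1 h2]
  funext x
  have r := bes_recurrence ((d : ℝ) / 2 - 1) (s * ‖x - c‖ ^ 2 / 4)
  rw [show (d : ℝ) / 2 - 1 + 1 + 1 = (d : ℝ) / 2 - 1 + 2 by ring]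
  linear_combination s * r

end Calculus

/-! ### A Poincaré inequality for odd functions -/

section Odd

variable {d : ℕ} {φ : Euc d → ℝ}

theorem classicalPartial_sq (hφ : Smooth φ) (i : Fin d) :
    classicalPartial i (fun x => φ x ^ 2) = fun x => 2 * φ x * classicalPartial i φ x := by
  simp only [sq]
  rw [classicalPartial_mul hφ hφ]
  funext x
  ring

/-- The integrated form of `|∇φ - φF|² ≥ 0`. -/
theorem integral_sq_mul_le_integral_grad_sq (hφ : Smooth φ) (hc : HasCompactSupport φ)
    {F : Fin d → Euc d → ℝ} (hF : ∀ i, Smooth (F i)) :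
    ∫ x, φ x ^ 2 * (-∑ i, classicalPartial i (F i) x - ∑ i, F i x ^ 2) ≤
      ∫ x, ∑ i, classicalPartial i φ x ^ 2 := by
  have hφ2 : Smooth fun x => φ x ^ 2 := hφ.pow 2
  have hc2 : HasCompactSupport fun x => φ x ^ 2 := by
    simp only [sq]; exact hc.mul_right
  have key : ∀ i, ∫ x, (φ x ^ 2 * (-classicalPartial i (F i) x - F i x ^ 2)) ≤
      ∫ x, classicalPartial i φ x ^ 2 := by
    intro i
    have cF := (hF i).continuous
    have cdF := ((hF i).classicalPartial i).continuous
    have cφ := hφ.continuous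
    have cdφ := (hφ.classicalPartial i).continuous
    have hcd := hasCompactSupport_classicalPartial hc i
    have i1 : Integrable fun x => classicalPartial i φ x ^ 2 := by
      simp only [sq]; exact integrable_mul_of_hasCompactSupport cdφ cdφ hcd
    have i2 : Integrable fun x => φ x ^ 2 * classicalPartial i (F i) x :=
      integrable_mul_of_hasCompactSupport hφ2.continuous cdF hc2
    have i3 : Integrable fun x => φ x ^ 2 * F i x ^ 2 :=
      integrable_mul_of_hasCompactSupport hφ2.continuous (cF.pow 2) hc2
    have i4 : Integrable fun x => 2 * φ x * classicalPartial i φ x * F i x := by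
      have := (integrable_mul_of_hasCompactSupport cφ
        ((continuous_const (y := (2 : ℝ))).mul (cdφ.mul cF)) hc)
      refine this.congr (Eventually.of_forall fun x => ?_)
      simp only [Pi.mul_apply]
      ring
    -- The cross term of the square is `∂ᵢ(φ²) Fᵢ`; integration by parts turns it into the
    -- divergence of `F`.
    have ibp := integral_mul_classicalPartial hφ2 (hF i) hc2 i
    rw [classicalPartial_sq hφ] at ibp
    have hnn : 0 ≤ ∫ x, (classicalPartial i φ x - φ x * F i x) ^ 2 :=
      integral_nonneg fun x => sq_nonneg _
    have e1 : ∫ x, (classicalPartial i φ x - φ x * F i x) ^ 2 =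
        ∫ x, classicalPartial i φ x ^ 2 - (2 * φ x * classicalPartial i φ x * F i x) +
          φ x ^ 2 * F i x ^ 2 := by
      congr 1; funext x; ring
    have i14 : Integrable fun x => classicalPartial i φ x ^ 2 -
      (2 * φ x * classicalPartial i φ x * F i x) := i1.sub i4
    rw [e1, integral_add i14 i3, integral_sub i1 i4] at hnn
    have e2 : ∫ x, (φ x ^ 2 * (-classicalPartial i (F i) x - F i x ^ 2)) =
        ∫ x, -(φ x ^ 2 * classicalPartial i (F i) x) - φ x ^ 2 * F i x ^ 2 := by
      congr 1; funext x; ring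
    have i2n : Integrable fun x => -(φ x ^ 2 * classicalPartial i (F i) x) := i2.neg
    rw [e2, integral_sub i2n i3, integral_neg, ibp]
    linarith
  have j1 : ∀ i, Integrable fun x => classicalPartial i φ x ^ 2 := fun i => by
    simp only [sq]
    exact integrable_mul_of_hasCompactSupport (hφ.classicalPartial i).continuous
      (hφ.classicalPartial i).continuous (hasCompactSupport_classicalPartial hc i)
  have j2 : ∀ i, Integrable fun x => φ x ^ 2 * (-classicalPartial i (F i) x - F i x ^ 2) :=
    fun i => integrable_mul_of_hasCompactSupport hφ2.continuous
      (((hF i).classicalPartial i).continuous.neg.sub ((hF i).continuous.pow 2)) hc2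
  rw [integral_finsetSum _ fun i _ => j1 i]
  have e : ∀ x, φ x ^ 2 * (-∑ i, classicalPartial i (F i) x - ∑ i, F i x ^ 2) =
      ∑ i, φ x ^ 2 * (-classicalPartial i (F i) x - F i x ^ 2) := by
    intro x
    rw [← Finset.mul_sum, Finset.sum_sub_distrib, Finset.sum_neg_distrib]
  refine (integral_congr_ae (Eventually.of_forall e)).le.trans ?_
  rw [integral_finsetSum _ fun i _ => j2 i]
  exact Finset.sum_le_sum fun i _ => key i

/-- A regularisation of the logarithmic derivative of the linear form `⟪v, x⟫`. -/
theorem hasDerivAt_div_sq_add {ε : ℝ} (hε : 0 < ε) (t : ℝ) :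
    HasDerivAt (fun t : ℝ => t / (t ^ 2 + ε)) ((ε - t ^ 2) / (t ^ 2 + ε) ^ 2) t := by
  have h := (hasDerivAt_id t).div (((hasDerivAt_id t).pow 2).add_const ε)
    (show t ^ 2 + ε ≠ 0 by positivity)
  refine h.congr_deriv ?_
  norm_num
  ring

/-- The vector field `∇ψ/ψ`, `ψ = ⟪v, x⟫ h(|x|²)`, regularised. -/
def oddField (v : Euc d) (ε : ℝ) (q : ℝ → ℝ) (i : Fin d) (x : Euc d) : ℝ :=
  v i * (inner ℝ v x / (inner ℝ v x ^ 2 + ε)) + 2 * x i * q (‖x‖ ^ 2)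

theorem smooth_oddField (v : Euc d) {ε : ℝ} (hε : 0 < ε) {q : ℝ → ℝ}
    (hq : ContDiff ℝ (⊤ : ℕ∞) q) (i : Fin d) : Smooth (oddField v ε q i) := by
  have h1 : Smooth fun x : Euc d => inner ℝ v x := contDiff_const.inner ℝ contDiff_id
  have h2 : Smooth fun x : Euc d => x i := (EuclideanSpace.proj i : Euc d →L[ℝ] ℝ).contDiff
  have h3 : Smooth fun x : Euc d => q (‖x‖ ^ 2) := hq.comp (contDiff_id.norm_sq ℝ)
  exact (contDiff_const.mul (h1.div ((h1.pow 2).add contDiff_const)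
    (fun x => by positivity))).add ((contDiff_const.mul h2).mul h3)

theorem classicalPartial_oddField (v : Euc d) {ε : ℝ} (hε : 0 < ε) {q q' : ℝ → ℝ}
    (hq : ∀ y, HasDerivAt q (q' y) y) (i : Fin d) (x : Euc d) :
    classicalPartial i (oddField v ε q i) x =
      v i ^ 2 * ((ε - inner ℝ v x ^ 2) / (inner ℝ v x ^ 2 + ε) ^ 2) + 2 * q (‖x‖ ^ 2) +
        4 * x i ^ 2 * q' (‖x‖ ^ 2) := by
  have h1 : HasFDerivAt (fun x : Euc d => inner ℝ v x) (innerSL ℝ v) x :=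
    (innerSL ℝ v).hasFDerivAt
  have h2 := ((hasDerivAt_div_sq_add hε (inner ℝ v x)).comp_hasFDerivAt x h1).const_mul (v i)
  have h3 : HasFDerivAt (fun x : Euc d => x i) (EuclideanSpace.proj i : Euc d →L[ℝ] ℝ) x :=
    (EuclideanSpace.proj i : Euc d →L[ℝ] ℝ).hasFDerivAt
  have h4 := hasFDerivAt_radial (c := (0 : Euc d)) (x := x) (F := q) (hq _)
  simp only [sub_zero] at h4
  have h5 := (h2.add ((h3.const_mul 2).mul h4)).fderiv
  have e : classicalPartial i (oddField v ε q i) x =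
    fderiv ℝ (oddField v ε q i) x (EuclideanSpace.single i 1) := rfl
  have e' : fderiv ℝ (oddField v ε q i) x = _ := h5
  rw [e, e']
  simp [EuclideanSpace.inner_single_right]
  ring

/-- With `t = ⟪v, x⟫` and `ρ = t/(t² + ε)`, the linear factor contributes `-ρ' - ρ² = -ε/(t² + ε)²`.
Its cross term with the radial factor is `4q` up to an error in `ε`, which raises `2dq` to
`2(d+2)q`. Thus the radial factor obeys the equation of dimension `d + 2`, that is, of order `d/2`.
-/
theorem sum_oddField {v : Euc d} (hv : ‖v‖ = 1) {ε : ℝ} (hε : 0 < ε) {q q' : ℝ → ℝ}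
    (hq : ∀ y, HasDerivAt q (q' y) y) (x : Euc d) :
    -∑ i, classicalPartial i (oddField v ε q i) x - ∑ i, oddField v ε q i x ^ 2 =
      -(4 * ‖x‖ ^ 2 * (q' (‖x‖ ^ 2) + q (‖x‖ ^ 2) ^ 2) + 2 * (d + 2) * q (‖x‖ ^ 2))
      - ε / (inner ℝ v x ^ 2 + ε) ^ 2 + 4 * q (‖x‖ ^ 2) * (ε / (inner ℝ v x ^ 2 + ε)) := by
  have hx : ∑ i, x i ^ 2 = ‖x‖ ^ 2 := by simp [EuclideanSpace.norm_sq_eq]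
  have hvv : ∑ i, v i ^ 2 = 1 := by
    have : ∑ i, v i ^ 2 = ‖v‖ ^ 2 := by simp [EuclideanSpace.norm_sq_eq]
    rw [this, hv, one_pow]
  have hvx : ∑ i, v i * x i = inner ℝ v x := by
    simp [PiLp.inner_apply, mul_comm]
  set t : ℝ := inner ℝ v x with ht
  have hD : t ^ 2 + ε ≠ 0 := by positivity
  simp only [classicalPartial_oddField v hε hq, oddField, ← ht]
  set ρ : ℝ := t / (t ^ 2 + ε) with hρ
  set ρ' : ℝ := (ε - t ^ 2) / (t ^ 2 + ε) ^ 2 with hρ'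
  have e1 : ∑ i, (v i ^ 2 * ρ' + 2 * q (‖x‖ ^ 2) + 4 * x i ^ 2 * q' (‖x‖ ^ 2)) =
      (∑ i, v i ^ 2) * ρ' + 2 * d * q (‖x‖ ^ 2) + 4 * (∑ i, x i ^ 2) * q' (‖x‖ ^ 2) := by
    simp only [Finset.sum_add_distrib, Finset.sum_mul, Finset.mul_sum, Finset.sum_const,
      Finset.card_univ, Fintype.card_fin, nsmul_eq_mul]
    ring
  have e2 : ∑ i, (v i * ρ + 2 * x i * q (‖x‖ ^ 2)) ^ 2 =
      (∑ i, v i ^ 2) * ρ ^ 2 + 4 * ρ * q (‖x‖ ^ 2) * (∑ i, v i * x i) +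
        4 * (∑ i, x i ^ 2) * q (‖x‖ ^ 2) ^ 2 := by
    simp only [Finset.mul_sum, Finset.sum_mul, ← Finset.sum_add_distrib]
    exact Finset.sum_congr rfl fun i _ => by ring
  rw [e1, e2, hvv, hx, hvx, hρ, hρ']
  field_simp
  ring

/-- Oddness gives `φ(x) - φ(σx) = 2φ(x)`, while `x` and its mirror image are `2|⟪v, x⟫|` apart.
Linear vanishing on the mirror hyperplane is what tames the singular term of the regularised field.
-/
theorem abs_le_mul_abs_inner_of_odd {v : Euc d} (hv : ‖v‖ = 1) {L : NNReal}
    (hL : LipschitzWith L φ) (hodd : ∀ x, φ ((ℝ ∙ v)ᗮ.reflection x) = -φ x) (x : Euc d) :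
    |φ x| ≤ L * |inner ℝ v x| := by
  have h := hL.dist_le_mul x ((ℝ ∙ v)ᗮ.reflection x)
  have hr : x - (ℝ ∙ v)ᗮ.reflection x = (2 * inner ℝ v x) • v := by
    rw [Submodule.reflection_orthogonal_apply, Submodule.reflection_singleton_apply, hv]
    simp [two_smul, ← add_smul, two_mul]
  rw [dist_eq_norm, dist_eq_norm, hr, hodd, norm_smul, hv, Real.norm_eq_abs, Real.norm_eq_abs,
    sub_neg_eq_add, ← two_mul, abs_mul, abs_mul, abs_two] at h
  linarith

/-- If `h(|x|²)⟪v, x⟫` is a positive solution of `Δψ = -sψ` in the half ball, with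
`q = h'/h`, then the odd functions satisfy the corresponding Poincaré inequality. -/
theorem integral_sq_le_of_odd {R s : ℝ} (hφ : Smooth φ) (hc : HasCompactSupport φ)
    (hs : tsupport φ ⊆ Metric.ball 0 R) {v : Euc d} (hv : ‖v‖ = 1)
    (hodd : ∀ x, φ ((ℝ ∙ v)ᗮ.reflection x) = -φ x) {q q' : ℝ → ℝ}
    (hq : ContDiff ℝ (⊤ : ℕ∞) q) (hq' : ∀ y, HasDerivAt q (q' y) y)
    (hR : ∀ y, 0 ≤ y → y < R ^ 2 → 4 * y * (q' y + q y ^ 2) + 2 * (d + 2) * q y = -s) :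
    s * ∫ x, φ x ^ 2 ≤ ∫ x, ∑ i, classicalPartial i φ x ^ 2 := by
  obtain ⟨L, hL⟩ := ContDiff.lipschitzWith_of_hasCompactSupport hc hφ (by simp)
  have hb := abs_le_mul_abs_inner_of_odd hv hL hodd
  -- The integrand for `ε = 1/(n+1)` once the equation for `q` has been inserted. That equation
  -- holds only for `|x| < R`, which suffices because of the factor `φ²`.
  set G : ℕ → Euc d → ℝ := fun n x => φ x ^ 2 *
    (s - (1 / ((n : ℝ) + 1)) / (inner ℝ v x ^ 2 + 1 / ((n : ℝ) + 1)) ^ 2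
      + 4 * q (‖x‖ ^ 2) * ((1 / ((n : ℝ) + 1)) / (inner ℝ v x ^ 2 + 1 / ((n : ℝ) + 1)))) with hG
  have hle : ∀ n, ∫ x, G n x ≤ ∫ x, ∑ i, classicalPartial i φ x ^ 2 := by
    intro n
    have hε : (0 : ℝ) < 1 / ((n : ℝ) + 1) := by positivity
    refine le_trans (le_of_eq ?_) (integral_sq_mul_le_integral_grad_sq hφ hc
      (F := oddField v (1 / ((n : ℝ) + 1)) q) (fun i => smooth_oddField v hε hq i))
    congr 1
    funext x
    rw [sum_oddField hv hε hq']
    by_cases hx : x ∈ tsupport φ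
    · have hx' : ‖x‖ < R := by simpa using hs hx
      rw [hR (‖x‖ ^ 2) (by positivity) (by gcongr), neg_neg]
    · simp [hG, image_eq_zero_of_notMem_tsupport hx]
  obtain ⟨C, hC⟩ := (isCompact_Icc (a := (0 : ℝ)) (b := R ^ 2)).exists_bound_of_continuousOn
    hq.continuous.continuousOn
  have hqc : Continuous fun x : Euc d => q (‖x‖ ^ 2) := by
    have := hq.continuous
    fun_prop
  have hlim : Tendsto (fun n => ∫ x, G n x) atTop (𝓝 (∫ x, s * φ x ^ 2)) := by
    refine tendsto_integral_of_dominated_convergence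
      (fun x => |s| * φ x ^ 2 + (tsupport φ).indicator (fun _ => (L : ℝ) ^ 2) x
        + 4 * (φ x ^ 2 * |q (‖x‖ ^ 2)|)) (fun n => ?_) ?_ (fun n => ?_) ?_
    · have hε : (0 : ℝ) < 1 / ((n : ℝ) + 1) := by positivity
      have c1 : Continuous fun x : Euc d => inner ℝ v x := by fun_prop
      have c2 := hφ.continuous
      have hD : ∀ x : Euc d, (inner ℝ v x : ℝ) ^ 2 + 1 / ((n : ℝ) + 1) ≠ 0 := fun x => by
        positivity
      refine Continuous.aestronglyMeasurable ?_
      refine (c2.pow 2).mul ((continuous_const.sub (continuous_const.div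
        (((c1.pow 2).add continuous_const).pow 2) fun x => pow_ne_zero 2 (hD x))).add
        ((continuous_const.mul hqc).mul (continuous_const.div
        ((c1.pow 2).add continuous_const) hD)))
    · have c2 : HasCompactSupport fun x => φ x ^ 2 := by
        simp only [sq]; exact hc.mul_right
      have hm := (hφ.continuous.pow 2)
      refine ((integrable_mul_of_hasCompactSupport (φ := fun x => φ x ^ 2) (ψ := fun _ => |s|) hm
        continuous_const c2).congr (Eventually.of_forall fun x => mul_comm _ _)).add ?_ |>.add ?_
      · exact (integrable_indicator_iff (isClosed_tsupport _).measurableSet).2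
          (integrableOn_const (hs := hc.isCompact.measure_lt_top.ne))
      · exact (integrable_mul_of_hasCompactSupport hm hqc.abs c2).const_mul 4
    · refine Eventually.of_forall fun x => ?_
      by_cases hx : x ∈ tsupport φ
      · rw [Set.indicator_of_mem hx, hG]
        simp only
        set ε : ℝ := 1 / ((n : ℝ) + 1) with hεd
        have hε : 0 < ε := by positivity
        set t : ℝ := inner ℝ v x
        have hφt : φ x ^ 2 ≤ L ^ 2 * t ^ 2 := by
          rw [← mul_pow, ← sq_abs (φ x), ← sq_abs ((L : ℝ) * t), abs_mul, NNReal.abs_eq]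
          gcongr
          exact hb x
        -- The one term that is unbounded as `ε → 0` near the mirror; it is controlled by `φ² ≤
        -- L²t²` and `t²ε ≤ (t² + ε)²`, uniformly in `ε`.
        have b1 : φ x ^ 2 * (ε / (t ^ 2 + ε) ^ 2) ≤ L ^ 2 := by
          have : t ^ 2 * (ε / (t ^ 2 + ε) ^ 2) ≤ 1 := by
            rw [← mul_div_assoc, div_le_one (by positivity)]
            nlinarith [sq_nonneg (t ^ 2), sq_nonneg ε, mul_nonneg (sq_nonneg t) hε.le]
          calc φ x ^ 2 * (ε / (t ^ 2 + ε) ^ 2) ≤ L ^ 2 * t ^ 2 * (ε / (t ^ 2 + ε) ^ 2) := by gcongr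
            _ = L ^ 2 * (t ^ 2 * (ε / (t ^ 2 + ε) ^ 2)) := by ring
            _ ≤ L ^ 2 * 1 := by gcongr
            _ = L ^ 2 := mul_one _
        have b2 : ε / (t ^ 2 + ε) ≤ 1 := by
          rw [div_le_one (by positivity)]; nlinarith [sq_nonneg t]
        have b1' : 0 ≤ φ x ^ 2 * (ε / (t ^ 2 + ε) ^ 2) := by positivity
        have b2' : 0 ≤ ε / (t ^ 2 + ε) := by positivity
        rw [Real.norm_eq_abs, mul_add, mul_sub]
        refine (abs_add_le _ _).trans (add_le_add ((abs_sub _ _).trans (add_le_add ?_ ?_)) ?_)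
        · rw [abs_mul, abs_of_nonneg (sq_nonneg (φ x)), mul_comm]
        · rwa [abs_of_nonneg b1']
        · rw [abs_mul, abs_mul, abs_mul, abs_of_nonneg (sq_nonneg (φ x)), abs_of_nonneg b2',
            abs_of_nonneg (by norm_num : (0 : ℝ) ≤ 4)]
          calc φ x ^ 2 * (4 * |q (‖x‖ ^ 2)| * (ε / (t ^ 2 + ε)))
              ≤ φ x ^ 2 * (4 * |q (‖x‖ ^ 2)| * 1) := by gcongr
            _ = 4 * (φ x ^ 2 * |q (‖x‖ ^ 2)|) := by ring
      · simp [hG, image_eq_zero_of_notMem_tsupport hx, Set.indicator_of_notMem hx]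
    · refine Eventually.of_forall fun x => ?_
      -- On the mirror `φ` vanishes, and off it the `ε` terms tend to zero, so convergence holds at
      -- every point.
      rcases eq_or_ne (inner ℝ v x) 0 with ht | ht
      · have : φ x = 0 := by
          have := hb x
          rw [ht, abs_zero, mul_zero] at this
          exact abs_nonpos_iff.1 this
        simp [hG, this]
      · have hε : Tendsto (fun n : ℕ => 1 / ((n : ℝ) + 1)) atTop (𝓝 0) :=
          tendsto_one_div_add_atTop_nhds_zero_nat
        have hD : (inner ℝ v x : ℝ) ^ 2 + 0 ≠ 0 := by positivity
        have l1 := hε.div (((tendsto_const_nhds (x := (inner ℝ v x : ℝ) ^ 2)).add hε).pow 2)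
          (pow_ne_zero 2 hD)
        have l2 := hε.div ((tendsto_const_nhds (x := (inner ℝ v x : ℝ) ^ 2)).add hε) hD
        have l3 := (((tendsto_const_nhds (x := s)).sub l1).add
          (l2.const_mul (4 * q (‖x‖ ^ 2)))).const_mul (φ x ^ 2)
        have e : s * φ x ^ 2 = φ x ^ 2 * (s - 0 / ((inner ℝ v x : ℝ) ^ 2 + 0) ^ 2 +
          4 * q (‖x‖ ^ 2) * (0 / ((inner ℝ v x : ℝ) ^ 2 + 0))) := by simp [mul_comm]
        rw [e]
        exact l3
  rw [integral_const_mul] at hlim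
  exact le_of_tendsto' hlim hle

/-- The vector field must be smooth on the whole space, but `h` may vanish beyond `y1`. The quotient
`h1/h` is switched off between `y0` and `y1`, outside the region where its equation is used. -/
theorem exists_logDeriv {h h1 h2 : ℝ → ℝ} {y0 y1 : ℝ} (hy : y0 < y1)
    (c0 : ContDiff ℝ (⊤ : ℕ∞) h) (c1 : ContDiff ℝ (⊤ : ℕ∞) h1)
    (d0 : ∀ y, HasDerivAt h (h1 y) y) (d1 : ∀ y, HasDerivAt h1 (h2 y) y)
    (hpos : ∀ y, y ≤ y1 → 0 < h y) :
    ∃ q q' : ℝ → ℝ, ContDiff ℝ (⊤ : ℕ∞) q ∧ (∀ y, HasDerivAt q (q' y) y) ∧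
      ∀ y, y < y0 → q y = h1 y / h y ∧ q' y = h2 y / h y - (h1 y / h y) ^ 2 := by
  set q : ℝ → ℝ := fun y => Real.smoothTransition ((y1 - y) / (y1 - y0)) * (h1 y / h y) with hq
  have hy' : 0 < y1 - y0 := sub_pos.2 hy
  have hsm : ContDiff ℝ (⊤ : ℕ∞) q := by
    rw [contDiff_iff_contDiffAt]
    intro y
    have hχ : ContDiffAt ℝ (⊤ : ℕ∞) (fun y => Real.smoothTransition ((y1 - y) / (y1 - y0))) y :=
      (Real.smoothTransition.contDiff.comp ((contDiff_const.sub contDiff_id).div_const _)).contDiffAt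
    rcases le_or_gt y y1 with h | h
    · exact hχ.mul (c1.contDiffAt.div c0.contDiffAt (hpos y h).ne')
    · refine (contDiffAt_const (c := (0 : ℝ))).congr_of_eventuallyEq ?_
      filter_upwards [Ioi_mem_nhds h] with z hz
      have : (y1 - z) / (y1 - y0) ≤ 0 := div_nonpos_of_nonpos_of_nonneg
        (sub_nonpos.2 (le_of_lt hz)) hy'.le
      simp [hq, Real.smoothTransition.zero_of_nonpos this]
  refine ⟨q, deriv q, hsm, fun y => (hsm.differentiable (by simp) y).hasDerivAt, fun y hyy => ?_⟩
  have hev : q =ᶠ[𝓝 y] fun y => h1 y / h y := by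
    filter_upwards [Iio_mem_nhds hyy] with z hz
    have : 1 ≤ (y1 - z) / (y1 - y0) := by
      rw [one_le_div hy']; linarith [show z < y0 from hz]
    simp [hq, Real.smoothTransition.one_of_one_le this]
  have hne := (hpos y (hyy.trans hy).le).ne'
  refine ⟨hev.self_of_nhds, ?_⟩
  have hd' : deriv (fun y => h1 y / h y) y = _ := ((d1 y).div (d0 y) hne).deriv
  rw [hev.deriv_eq, hd']
  field_simp

/-- The clamped energy of odd functions. -/
theorem integral_lap_sq_ge_of_odd {R s y1 : ℝ} (hs0 : 0 < s) (hφ : Smooth φ)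
    (hc : HasCompactSupport φ)
    (hsupp : tsupport φ ⊆ Metric.ball 0 R) {v : Euc d} (hv : ‖v‖ = 1)
    (hodd : ∀ x, φ ((ℝ ∙ v)ᗮ.reflection x) = -φ x) (hy1 : R ^ 2 < y1)
    (hpos : ∀ t, 0 ≤ t → t ≤ s * y1 / 4 → 0 < bes ((d : ℝ) / 2) (-t)) :
    s ^ 2 * ∫ x, φ x ^ 2 ≤ ∫ x, lap φ x ^ 2 := by
  have hd0 : (0 : ℝ) ≤ d := d.cast_nonneg
  obtain ⟨q, q', hq, hq', hqeq⟩ := exists_logDeriv hy1 (contDiff_bes_scaled ((d : ℝ) / 2) (-s))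
    (h1 := fun y => -s / 4 * bes ((d : ℝ) / 2 + 1) (-s * y / 4))
    (contDiff_const.mul (contDiff_bes_scaled ((d : ℝ) / 2 + 1) (-s)))
    (hasDerivAt_bes_scaled _ _)
    (fun y => (hasDerivAt_bes_scaled ((d : ℝ) / 2 + 1) (-s) y).const_mul (-s / 4))
    (fun y hy => by
      rcases le_or_gt 0 y with h | h
      · have := hpos (s * y / 4) (by positivity) (by gcongr)
        rwa [show -s * y / 4 = -(s * y / 4) by ring]
      · exact bes_pos (by linarith) (by nlinarith))
  -- The equation required of `q = h'/h` with `h(y) = bes (d/2) (-sy/4)` is the recurrence at order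
  -- `d/2 = ν + 1`; the squares of `q` cancel.
  have hineq := integral_sq_le_of_odd (s := s) hφ hc hsupp hv hodd hq hq' (fun y hy0 hy => by
    obtain ⟨e1, e2⟩ := hqeq y hy
    have hyy : y ≤ y1 := (hy.trans hy1).le
    have hne : bes ((d : ℝ) / 2) (-s * y / 4) ≠ 0 := by
      have := hpos (s * y / 4) (by positivity) (by gcongr)
      rw [show -s * y / 4 = -(s * y / 4) by ring]
      exact this.ne'
    have r := bes_recurrence ((d : ℝ) / 2) (-s * y / 4)
    rw [e1, e2, show (d : ℝ) / 2 + 1 + 1 = d / 2 + 2 by ring]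
    generalize bes ((d : ℝ) / 2) (-s * y / 4) = B0 at *
    generalize bes ((d : ℝ) / 2 + 1) (-s * y / 4) = B1 at *
    generalize bes ((d : ℝ) / 2 + 2) (-s * y / 4) = B2 at *
    have e3 : 4 * y * (-s / 4 * (-s / 4 * B2) / B0 - (-s / 4 * B1 / B0) ^ 2 +
        (-s / 4 * B1 / B0) ^ 2) + 2 * (d + 2) * (-s / 4 * B1 / B0) =
        (s ^ 2 * y / 4 * B2 - (d + 2) * s / 2 * B1) / B0 := by ring
    rw [e3, div_eq_iff hne]
    linear_combination (-s) * r)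
  have hgrad := integral_sum_sq_classicalPartial hφ hc
  have cφ := hφ.continuous
  have cl := hφ.lap.continuous
  have i1 : Integrable fun x => lap φ x ^ 2 := by
    simp only [sq]; exact integrable_mul_of_hasCompactSupport cl cl (hasCompactSupport_lap hc)
  have i2 : Integrable fun x => φ x * lap φ x := integrable_mul_of_hasCompactSupport cφ cl hc
  have i3 : Integrable fun x => φ x ^ 2 := by
    simp only [sq]; exact integrable_mul_of_hasCompactSupport cφ cφ hc
  -- Expanding gives `∫(Δφ)² ≥ 2s∫|∇φ|² - s²∫φ²`, and the Poincaré inequality `∫|∇φ|² ≥ s∫φ²`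
  -- finishes.
  have hnn : 0 ≤ ∫ x, (lap φ x + s * φ x) ^ 2 := integral_nonneg fun x => sq_nonneg _
  have e : ∫ x, (lap φ x + s * φ x) ^ 2 =
      ∫ x, lap φ x ^ 2 + 2 * s * (φ x * lap φ x) + s ^ 2 * φ x ^ 2 := by
    congr 1; funext x; ring
  have i12 : Integrable fun x => lap φ x ^ 2 + 2 * s * (φ x * lap φ x) :=
    i1.add (i2.const_mul _)
  rw [e, integral_add i12 (i3.const_mul _), integral_add i1 (i2.const_mul _),
    integral_const_mul, integral_const_mul] at hnn
  nlinarith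

end Odd

/-! ### The closure of the Laplacian on test functions -/

theorem tendsto_integral_mul {α : Type*} [MeasurableSpace α] {μ : Measure α}
    {f h : ℕ → α → ℝ} {f' h' : α → ℝ} (hf : ∀ n, MemLp (f n) 2 μ) (hh : ∀ n, MemLp (h n) 2 μ)
    (hf' : MemLp f' 2 μ) (hh' : MemLp h' 2 μ)
    (tf : Tendsto (fun n => eLpNorm (f n - f') 2 μ) atTop (𝓝 0))
    (th : Tendsto (fun n => eLpNorm (h n - h') 2 μ) atTop (𝓝 0)) :
    Tendsto (fun n => ∫ x, f n x * h n x ∂μ) atTop (𝓝 (∫ x, f' x * h' x ∂μ)) := by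
  have F := (Lp.tendsto_Lp_iff_tendsto_eLpNorm'' f hf f' hf').2 tf
  have H := (Lp.tendsto_Lp_iff_tendsto_eLpNorm'' h hh h' hh').2 th
  have e : ∀ {a b : α → ℝ} (ha : MemLp a 2 μ) (hb : MemLp b 2 μ),
      inner ℝ (ha.toLp a) (hb.toLp b) = ∫ x, a x * b x ∂μ := by
    intro a b ha hb
    rw [L2.inner_def]
    refine integral_congr_ae ?_
    filter_upwards [ha.coeFn_toLp, hb.coeFn_toLp] with x h1 h2
    rw [h1, h2]
    simp [mul_comm]
  have := F.inner H (𝕜 := ℝ)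
  simpa only [e] using this

theorem tendsto_eLpNorm_sub_zero {α : Type*} [MeasurableSpace α] (μ : Measure α) (f : α → ℝ) :
    Tendsto (fun _ : ℕ => eLpNorm (f - f) 2 μ) atTop (𝓝 0) := by
  simp

/-- Lebesgue measure on the ball of radius `R` about the origin. -/
abbrev ballMeasure (d : ℕ) (R : ℝ) : Measure (Euc d) := volume.restrict (Metric.ball 0 R)

/-- Smooth functions with compact support in the ball of radius `R` about the origin. -/
structure IsTest {d : ℕ} (R : ℝ) (φ : Euc d → ℝ) : Prop where
  smooth : Smooth φ
  compact : HasCompactSupport φ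
  supp : tsupport φ ⊆ Metric.ball 0 R

section Pairs

variable {d : ℕ} {R : ℝ} {φ ψ u g u' g' : Euc d → ℝ}

/-! ### Test functions and `L²` on the centred ball -/

instance isFiniteMeasure_ballMeasure : IsFiniteMeasure (ballMeasure d R) :=
  ⟨by simpa using measure_ball_lt_top⟩

theorem memLp_ballMeasure_of_continuous (hφ : Continuous φ) : MemLp φ 2 (ballMeasure d R) := by
  obtain ⟨C, hC⟩ := (isCompact_closedBall (0 : Euc d) R).exists_bound_of_continuousOn
    hφ.continuousOn
  refine MemLp.of_bound hφ.aestronglyMeasurable C ?_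
  filter_upwards [ae_restrict_mem Metric.isOpen_ball.measurableSet] with x hx
  exact hC x (Metric.ball_subset_closedBall hx)

theorem Smooth.memLp (hφ : Smooth φ) : MemLp φ 2 (ballMeasure d R) :=
  memLp_ballMeasure_of_continuous hφ.continuous

theorem integrable_mul_ball (hu : MemLp u 2 (ballMeasure d R))
    (hg : MemLp g 2 (ballMeasure d R)) :
    Integrable (fun x => u x * g x) (ballMeasure d R) :=
  MemLp.integrable_mul hu hg

theorem IsTest.eq_zero (h : IsTest R φ) {x : Euc d} (hx : x ∉ Metric.ball 0 R) : φ x = 0 :=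
  image_eq_zero_of_notMem_tsupport fun h' => hx (h.supp h')

theorem IsTest.lap_eq_zero (h : IsTest R φ) {x : Euc d} (hx : x ∉ Metric.ball 0 R) :
    lap φ x = 0 :=
  image_eq_zero_of_notMem_tsupport fun h' => hx (h.supp (tsupport_lap_subset φ h'))

theorem IsTest.integral_mul (h : IsTest R φ) (ψ : Euc d → ℝ) :
    ∫ x, φ x * ψ x ∂(ballMeasure d R) = ∫ x, φ x * ψ x :=
  setIntegral_eq_integral_of_forall_compl_eq_zero fun x hx => by rw [h.eq_zero hx, zero_mul]

theorem IsTest.integral_lap_mul (h : IsTest R φ) (ψ : Euc d → ℝ) :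
    ∫ x, lap φ x * ψ x ∂(ballMeasure d R) = ∫ x, lap φ x * ψ x :=
  setIntegral_eq_integral_of_forall_compl_eq_zero fun x hx => by rw [h.lap_eq_zero hx, zero_mul]

theorem IsTest.const_mul (h : IsTest R φ) (a : ℝ) : IsTest R fun x => a * φ x :=
  ⟨contDiff_const.mul h.smooth, h.compact.mul_left,
    (closure_mono fun _ hx => right_ne_zero_of_mul hx).trans h.supp⟩

theorem IsTest.add (h : IsTest R φ) (h' : IsTest R ψ) : IsTest R fun x => φ x + ψ x :=
  ⟨h.smooth.add h'.smooth, h.compact.add h'.compact,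
    (tsupport_add φ ψ).trans (union_subset h.supp h'.supp)⟩

theorem ball_preimage (g : Euc d ≃ₗᵢ[ℝ] Euc d) :
    g ⁻¹' Metric.ball 0 R = Metric.ball 0 R := by
  ext x; simp

theorem IsTest.comp (h : IsTest R φ) (g : Euc d ≃ₗᵢ[ℝ] Euc d) : IsTest R fun x => φ (g x) := by
  refine ⟨h.smooth.comp_linearIsometryEquiv g, h.compact.comp_homeomorph g.toHomeomorph, ?_⟩
  have : tsupport (fun x => φ (g x)) ⊆ g ⁻¹' tsupport φ :=
    closure_minimal (fun x hx => subset_tsupport φ hx)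
      ((isClosed_tsupport φ).preimage g.continuous)
  exact this.trans ((preimage_mono h.supp).trans (ball_preimage g).subset)

theorem measurePreserving_ballMeasure (g : Euc d ≃ₗᵢ[ℝ] Euc d) :
    MeasurePreserving g (ballMeasure d R) (ballMeasure d R) := by
  have := g.measurePreserving.restrict_preimage (s := Metric.ball 0 R)
    Metric.isOpen_ball.measurableSet
  rwa [ball_preimage] at this

/-- `u` is in the closure of the test functions with respect to the graph norm of the
Laplacian, and `g` is its Laplacian. -/
structure ClampedPair (R : ℝ) (u g : Euc d → ℝ) : Prop where
  memLp_left : MemLp u 2 (ballMeasure d R)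
  memLp_right : MemLp g 2 (ballMeasure d R)
  approx : ∃ φ : ℕ → Euc d → ℝ, (∀ n, IsTest R (φ n)) ∧
    Tendsto (fun n => eLpNorm (φ n - u) 2 (ballMeasure d R)) atTop (𝓝 0) ∧
    Tendsto (fun n => eLpNorm (lap (φ n) - g) 2 (ballMeasure d R)) atTop (𝓝 0)

theorem ClampedPair.comp (h : ClampedPair R u g) (σ : Euc d ≃ₗᵢ[ℝ] Euc d) :
    ClampedPair R (fun x => u (σ x)) (fun x => g (σ x)) := by
  obtain ⟨φ, hφ, l1, l2⟩ := h.approx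
  have hσ := measurePreserving_ballMeasure (R := R) σ
  refine ⟨h.memLp_left.comp_measurePreserving hσ, h.memLp_right.comp_measurePreserving hσ,
    fun n x => φ n (σ x), fun n => (hφ n).comp σ, ?_, ?_⟩
  · refine l1.congr fun n => ?_
    exact (eLpNorm_comp_measurePreserving (f := σ)
      (((hφ n).smooth.memLp).sub h.memLp_left).aestronglyMeasurable hσ).symm
  · refine l2.congr fun n => ?_
    rw [lap_comp_linearIsometryEquiv (hφ n).smooth]
    exact (eLpNorm_comp_measurePreserving (f := σ)
      (((hφ n).smooth.lap.memLp).sub h.memLp_right).aestronglyMeasurable hσ).symm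

theorem ClampedPair.add_mul (h : ClampedPair R u g) (h' : ClampedPair R u' g') (a : ℝ) :
    ClampedPair R (fun x => u x + a * u' x) (fun x => g x + a * g' x) := by
  obtain ⟨φ, hφ, l1, l2⟩ := h.approx
  obtain ⟨ψ, hψ, m1, m2⟩ := h'.approx
  have key : ∀ {f f' : Euc d → ℝ} {F F' : ℕ → Euc d → ℝ},
      MemLp f 2 (ballMeasure d R) → MemLp f' 2 (ballMeasure d R) →
      (∀ n, MemLp (F n) 2 (ballMeasure d R)) → (∀ n, MemLp (F' n) 2 (ballMeasure d R)) →
      Tendsto (fun n => eLpNorm (F n - f) 2 (ballMeasure d R)) atTop (𝓝 0) →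
      Tendsto (fun n => eLpNorm (F' n - f') 2 (ballMeasure d R)) atTop (𝓝 0) →
      Tendsto (fun n => eLpNorm ((fun x => F n x + a * F' n x) - fun x => f x + a * f' x) 2
        (ballMeasure d R)) atTop (𝓝 0) := by
    intro f f' F F' hf hf' hF hF' t t'
    have lim : Tendsto (fun n => eLpNorm (F n - f) 2 (ballMeasure d R) +
        ‖a‖ₑ * eLpNorm (F' n - f') 2 (ballMeasure d R)) atTop (𝓝 0) := by
      have := t.add (ENNReal.Tendsto.const_mul t' (Or.inr (by simp : ‖a‖ₑ ≠ ∞)))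
      simpa using this
    refine tendsto_of_tendsto_of_tendsto_of_le_of_le tendsto_const_nhds lim
      (fun _ => zero_le) fun n => ?_
    have e : ((fun x => F n x + a * F' n x) - fun x => f x + a * f' x) =
        (F n - f) + a • (F' n - f') := by
      funext x
      simp only [Pi.sub_apply, Pi.add_apply, Pi.smul_apply, smul_eq_mul]
      ring
    simp only [e]
    refine (eLpNorm_add_le ((hF n).sub hf).aestronglyMeasurable
      (((hF' n).sub hf').const_smul a).aestronglyMeasurable (by norm_num)).trans ?_
    rw [eLpNorm_const_smul]
  refine ⟨h.memLp_left.add (h'.memLp_left.const_mul a), h.memLp_right.add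
    (h'.memLp_right.const_mul a), fun n x => φ n x + a * ψ n x,
    fun n => (hφ n).add ((hψ n).const_mul a), ?_, ?_⟩
  · exact key h.memLp_left h'.memLp_left (fun n => (hφ n).smooth.memLp)
      (fun n => (hψ n).smooth.memLp) l1 m1
  · have e : ∀ n, lap (fun x => φ n x + a * ψ n x) = fun x => lap (φ n) x + a * lap (ψ n) x :=
      fun n => by rw [lap_add (hφ n).smooth ((hψ n).const_mul a).smooth,
        lap_const_mul (hψ n).smooth]
    simp only [e]
    exact key h.memLp_right h'.memLp_right (fun n => (hφ n).smooth.lap.memLp)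
      (fun n => (hψ n).smooth.lap.memLp) l2 m2

/-- The clamped conditions enter here: `ψ` is unrestricted at the boundary, yet no boundary term
appears, since Green's formula is applied to compactly supported approximants. -/
theorem ClampedPair.integral_mul_smooth (h : ClampedPair R u g) (hψ : Smooth ψ) :
    ∫ x, g x * ψ x ∂(ballMeasure d R) = ∫ x, u x * lap ψ x ∂(ballMeasure d R) := by
  obtain ⟨φ, hφ, l1, l2⟩ := h.approx
  have t1 := tendsto_integral_mul (fun n => (hφ n).smooth.lap.memLp) (fun _ => hψ.memLp)
    h.memLp_right hψ.memLp l2 (tendsto_eLpNorm_sub_zero _ ψ)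
  have t2 := tendsto_integral_mul (fun n => (hφ n).smooth.memLp) (fun _ => hψ.lap.memLp)
    h.memLp_left hψ.lap.memLp l1 (tendsto_eLpNorm_sub_zero _ (lap ψ))
  refine tendsto_nhds_unique t1 (t2.congr fun n => ?_)
  rw [(hφ n).integral_mul, (hφ n).integral_lap_mul,
    ClampedPlate.integral_lap_mul (hφ n).smooth hψ (hφ n).compact]

/-- The weak eigenvalue equation for the bilaplacian. -/
structure EigenPair (R Λ : ℝ) (u g : Euc d → ℝ) : Prop where
  pair : ClampedPair R u g
  weak : ∀ φ, IsTest R φ →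
    ∫ x, g x * lap φ x ∂(ballMeasure d R) = Λ * ∫ x, u x * φ x ∂(ballMeasure d R)

variable {Λ : ℝ}

theorem EigenPair.weak_pair (h : EigenPair R Λ u g) (h' : ClampedPair R u' g') :
    ∫ x, g x * g' x ∂(ballMeasure d R) = Λ * ∫ x, u x * u' x ∂(ballMeasure d R) := by
  obtain ⟨φ, hφ, l1, l2⟩ := h'.approx
  have t1 := tendsto_integral_mul (fun _ => h.pair.memLp_right)
    (fun n => (hφ n).smooth.lap.memLp) h.pair.memLp_right h'.memLp_right
    (tendsto_eLpNorm_sub_zero _ g) l2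
  have t2 := (tendsto_integral_mul (fun _ => h.pair.memLp_left) (fun n => (hφ n).smooth.memLp)
    h.pair.memLp_left h'.memLp_left (tendsto_eLpNorm_sub_zero _ u) l1).const_mul Λ
  exact tendsto_nhds_unique t1 (t2.congr fun n => (h.weak _ (hφ n)).symm)

theorem EigenPair.add_mul (h : EigenPair R Λ u g) (h' : EigenPair R Λ u' g') (a : ℝ) :
    EigenPair R Λ (fun x => u x + a * u' x) (fun x => g x + a * g' x) := by
  refine ⟨h.pair.add_mul h'.pair a, fun φ hφ => ?_⟩
  have m := hφ.smooth.memLp (R := R)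
  have ml := hφ.smooth.lap.memLp (R := R)
  have e1 : ∀ x, (g x + a * g' x) * lap φ x = g x * lap φ x + a * (g' x * lap φ x) :=
    fun x => by ring
  have e2 : ∀ x, (u x + a * u' x) * φ x = u x * φ x + a * (u' x * φ x) := fun x => by ring
  simp only [e1, e2]
  rw [integral_add (integrable_mul_ball h.pair.memLp_right ml)
    ((integrable_mul_ball h'.pair.memLp_right ml).const_mul a),
    integral_add (integrable_mul_ball h.pair.memLp_left m)
    ((integrable_mul_ball h'.pair.memLp_left m).const_mul a), integral_const_mul,
    integral_const_mul, h.weak φ hφ, h'.weak φ hφ]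
  ring

theorem EigenPair.comp (h : EigenPair R Λ u g) (σ : Euc d ≃ₗᵢ[ℝ] Euc d) :
    EigenPair R Λ (fun x => u (σ x)) (fun x => g (σ x)) := by
  refine ⟨h.pair.comp σ, fun φ hφ => ?_⟩
  have hσ := measurePreserving_ballMeasure (R := R) σ
  have hE := σ.toHomeomorph.measurableEmbedding
  have := h.weak _ (hφ.comp σ.symm)
  rw [lap_comp_linearIsometryEquiv hφ.smooth,
    ← hσ.integral_comp hE (fun x => g x * lap φ (σ.symm x)),
    ← hσ.integral_comp hE (fun x => u x * φ (σ.symm x))] at this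
  simpa using this

/-! ### Reflection symmetry of the low eigenfunctions -/

/-- Approximants of an odd function need not be odd, but their odd parts are test functions with the
same limit. The inequality for odd test functions then passes to the limit. -/
theorem ClampedPair.integral_sq_ge_of_sub_reflection {s y1 : ℝ} (h : ClampedPair R u g)
    (hs : 0 < s) (hy1 : R ^ 2 < y1)
    (hpos : ∀ t, 0 ≤ t → t ≤ s * y1 / 4 → 0 < bes ((d : ℝ) / 2) (-t)) {v : Euc d}
    (hv : ‖v‖ = 1) :
    s ^ 2 * ∫ x, (u x + (-1) * u ((ℝ ∙ v)ᗮ.reflection x)) *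
        (u x + (-1) * u ((ℝ ∙ v)ᗮ.reflection x)) ∂(ballMeasure d R) ≤
      ∫ x, (g x + (-1) * g ((ℝ ∙ v)ᗮ.reflection x)) *
        (g x + (-1) * g ((ℝ ∙ v)ᗮ.reflection x)) ∂(ballMeasure d R) := by
  set σ := (ℝ ∙ v)ᗮ.reflection with hσ
  have hpair := h.add_mul (h.comp σ) (-1)
  obtain ⟨φ, hφ, l1, l2⟩ := hpair.approx
  set χ : ℕ → Euc d → ℝ := fun n x => φ n x + (-1) * φ n (σ x) with hχ
  have hχt : ∀ n, IsTest R (χ n) := fun n => (hφ n).add (((hφ n).comp σ).const_mul (-1))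
  have hpair2 := hpair.add_mul (hpair.comp σ) (-1)
  have mp := measurePreserving_ballMeasure (R := R) σ
  -- Taking the odd part is an `L²` contraction, because the reflection preserves the measure, and
  -- it fixes the odd limit.
  have lim : ∀ {f : Euc d → ℝ} {F : ℕ → Euc d → ℝ}, MemLp f 2 (ballMeasure d R) →
      (∀ n, MemLp (F n) 2 (ballMeasure d R)) →
      Tendsto (fun n => eLpNorm (F n - fun x => f x + (-1) * f (σ x)) 2 (ballMeasure d R))
        atTop (𝓝 0) →
      Tendsto (fun n => eLpNorm ((fun x => 1 / 2 * (F n x + (-1) * F n (σ x))) -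
        fun x => f x + (-1) * f (σ x)) 2 (ballMeasure d R)) atTop (𝓝 0) := by
    intro f F hf hF t
    have hfσ := hf.comp_measurePreserving mp
    have hm : ∀ n, MemLp (F n - fun x => f x + (-1) * f (σ x)) 2 (ballMeasure d R) :=
      fun n => (hF n).sub (hf.add (hfσ.const_mul (-1)))
    refine tendsto_of_tendsto_of_tendsto_of_le_of_le tendsto_const_nhds t
      (fun _ => zero_le) fun n => ?_
    have e : ((fun x => 1 / 2 * (F n x + (-1) * F n (σ x))) - fun x => f x + (-1) * f (σ x)) =
        (1 / 2 : ℝ) • ((F n - fun x => f x + (-1) * f (σ x)) +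
        (-1 : ℝ) • ((F n - fun x => f x + (-1) * f (σ x)) ∘ σ)) := by
      funext x
      have : σ (σ x) = x := by simp [hσ]
      simp only [Pi.sub_apply, Pi.add_apply, Pi.smul_apply, smul_eq_mul, Function.comp, this]
      ring
    have hc : eLpNorm ((F n - fun x => f x + (-1) * f (σ x)) ∘ σ) 2 (ballMeasure d R) =
        eLpNorm (F n - fun x => f x + (-1) * f (σ x)) 2 (ballMeasure d R) :=
      eLpNorm_comp_measurePreserving (hm n).aestronglyMeasurable mp
    simp only [e]
    rw [eLpNorm_const_smul]
    have := eLpNorm_add_le (p := 2) (hm n).aestronglyMeasurable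
      (((hm n).comp_measurePreserving mp).const_smul (-1 : ℝ)).aestronglyMeasurable (by norm_num)
    rw [eLpNorm_const_smul, hc] at this
    refine (mul_le_mul_right this _).trans (le_of_eq ?_)
    have h1 : ‖(-1 : ℝ)‖ₑ = 1 := by simp
    have h2 : ‖(1 / 2 : ℝ)‖ₑ = 2⁻¹ := by
      rw [Real.enorm_eq_ofReal (by norm_num), one_div, ENNReal.ofReal_inv_of_pos two_pos]
      simp
    rw [h1, h2, one_mul, ← two_mul, ← mul_assoc,
      ENNReal.inv_mul_cancel two_ne_zero ENNReal.ofNat_ne_top, one_mul]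
  have hl : ∀ n, lap (fun x => 1 / 2 * χ n x) =
      fun x => 1 / 2 * (lap (φ n) x + (-1) * lap (φ n) (σ x)) := by
    intro n
    rw [lap_const_mul (hχt n).smooth, hχ]
    simp only
    rw [lap_add (hφ n).smooth (((hφ n).comp σ).const_mul (-1)).smooth,
      lap_const_mul ((hφ n).comp σ).smooth, lap_comp_linearIsometryEquiv (hφ n).smooth]
  have T : ∀ n, IsTest R (fun x => 1 / 2 * χ n x) := fun n => (hχt n).const_mul _
  have t1 := lim h.memLp_left (fun n => (hφ n).smooth.memLp) l1
  have t2 := lim h.memLp_right (fun n => (hφ n).smooth.lap.memLp) l2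
  have m1 := (tendsto_integral_mul (fun n => (T n).smooth.memLp) (fun n => (T n).smooth.memLp)
    hpair.memLp_left hpair.memLp_left t1 t1).const_mul (s ^ 2)
  have t2' : Tendsto (fun n => eLpNorm (lap (fun x => 1 / 2 * χ n x) -
      fun x => g x + (-1) * g (σ x)) 2 (ballMeasure d R)) atTop (𝓝 0) :=
    t2.congr fun n => by rw [hl]
  have m2 := tendsto_integral_mul (fun n => (T n).smooth.lap.memLp)
    (fun n => (T n).smooth.lap.memLp) hpair.memLp_right hpair.memLp_right t2' t2'
  refine le_of_tendsto_of_tendsto' m1 m2 fun n => ?_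
  have key := integral_lap_sq_ge_of_odd hs (T n).smooth (T n).compact (T n).supp hv (fun x => by
    have : σ (σ x) = x := by simp [hσ]
    simp only [hχ, ← hσ, this]
    ring) hy1 hpos
  rw [(T n).integral_mul, (T n).integral_lap_mul]
  simpa only [sq] using key

/-- The difference `w = u - u ∘ σ` solves the same eigenvalue equation, so its energy is `Λ‖w‖²`; as
an odd function it has energy at least `s²‖w‖²`, and `Λ < s²`. -/
theorem EigenPair.comp_reflection_ae_eq {s y1 : ℝ} (h : EigenPair R Λ u g) (hs : 0 < s)
    (hΛ : Λ < s ^ 2) (hy1 : R ^ 2 < y1)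
    (hpos : ∀ t, 0 ≤ t → t ≤ s * y1 / 4 → 0 < bes ((d : ℝ) / 2) (-t)) (v : Euc d) :
    (fun x => u ((ℝ ∙ v)ᗮ.reflection x)) =ᵐ[ballMeasure d R] u := by
  -- For `v = 0` the mirror is the whole space and the reflection is the identity; otherwise `v` is
  -- normalised without changing its span.
  rcases eq_or_ne v 0 with rfl | hv
  · refine Eventually.of_forall fun x => ?_
    simp only [Submodule.reflection_orthogonal_apply]
    simp
  have hv1 : ‖(‖v‖⁻¹ : ℝ) • v‖ = 1 := by
    rw [norm_smul, norm_inv, norm_norm, inv_mul_cancel₀ (norm_ne_zero_iff.2 hv)]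
  have hspan : (ℝ ∙ ((‖v‖⁻¹ : ℝ) • v)) = ℝ ∙ v :=
    Submodule.span_singleton_smul_eq (IsUnit.mk0 _ (inv_ne_zero (norm_ne_zero_iff.2 hv))) v
  have h1 := h.pair.integral_sq_ge_of_sub_reflection hs hy1 hpos hv1
  have hcongr : ∀ (K L : Submodule ℝ (Euc d)) [K.HasOrthogonalProjection]
      [L.HasOrthogonalProjection], K = L → ∀ x, K.reflection x = L.reflection x := by
    rintro K _ _ _ rfl x
    rfl
  simp only [hcongr (ℝ ∙ ((‖v‖⁻¹ : ℝ) • v))ᗮ (ℝ ∙ v)ᗮ (by rw [hspan])] at h1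
  set σ := (ℝ ∙ v)ᗮ.reflection
  have hE := h.add_mul (h.comp σ) (-1)
  rw [hE.weak_pair hE.pair] at h1
  set w : Euc d → ℝ := fun x => u x + (-1) * u (σ x) with hw
  have hm : MemLp w 2 (ballMeasure d R) := hE.pair.memLp_left
  have hint : Integrable (fun x => w x * w x) (ballMeasure d R) := integrable_mul_ball hm hm
  have hnn : 0 ≤ ∫ x, w x * w x ∂(ballMeasure d R) :=
    integral_nonneg fun x => mul_self_nonneg _
  have h0 : ∫ x, w x * w x ∂(ballMeasure d R) = 0 := by
    have : (s ^ 2 - Λ) * ∫ x, w x * w x ∂(ballMeasure d R) ≤ 0 := by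
      rw [sub_mul]; linarith
    nlinarith
  have := (integral_eq_zero_iff_of_nonneg (fun x => mul_self_nonneg (w x)) hint).1 h0
  filter_upwards [this] with x hx
  have : w x = 0 := mul_self_eq_zero.1 hx
  simp only [hw] at this
  linarith

/-- Reflections generate the orthogonal group, and almost everywhere identities can be composed with
isometries because these preserve null sets. -/
theorem EigenPair.comp_ae_eq {s y1 : ℝ} (h : EigenPair R Λ u g) (hs : 0 < s)
    (hΛ : Λ < s ^ 2) (hy1 : R ^ 2 < y1)
    (hpos : ∀ t, 0 ≤ t → t ≤ s * y1 / 4 → 0 < bes ((d : ℝ) / 2) (-t))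
    (σ : Euc d ≃ₗᵢ[ℝ] Euc d) :
    (fun x => u (σ x)) =ᵐ[ballMeasure d R] u := by
  have hmem : σ ∈ Subgroup.closure (Set.range fun v : Euc d => (ℝ ∙ v)ᗮ.reflection) := by
    rw [LinearIsometryEquiv.reflections_generate]; trivial
  induction hmem using Subgroup.closure_induction with
  | mem x hx =>
    obtain ⟨v, rfl⟩ := hx
    exact h.comp_reflection_ae_eq hs hΛ hy1 hpos v
  | one => exact Eventually.of_forall fun x => rfl
  | mul a b _ _ ha hb =>
    have := (measurePreserving_ballMeasure (R := R) b).quasiMeasurePreserving.ae_eq_comp ha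
    exact this.trans hb
  | inv a _ ha =>
    have := (measurePreserving_ballMeasure (R := R) a⁻¹).quasiMeasurePreserving.ae_eq_comp ha
    refine EventuallyEq.trans this.symm (Eventually.of_forall fun x => ?_)
    exact congrArg u (a.apply_symm_apply x)

/-! ### The clamped Helmholtz equation has no solution -/

theorem lap_comp_inner {F F' F'' : ℝ → ℝ} (ξ : Euc d) (hF : ∀ y, HasDerivAt F (F' y) y)
    (hF' : ∀ y, HasDerivAt F' (F'' y) y) :
    lap (fun x => F (inner ℝ ξ x)) = fun x => ‖ξ‖ ^ 2 * F'' (inner ℝ ξ x) := by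
  have key : ∀ {G G' : ℝ → ℝ} (a : ℝ), (∀ y, HasDerivAt G (G' y) y) → ∀ i,
      classicalPartial i (fun x : Euc d => a * G (inner ℝ ξ x)) =
        fun x => (a * ξ i) * G' (inner ℝ ξ x) := by
    intro G G' a hG i
    funext x
    have h := (((hG (inner ℝ ξ x)).comp_hasFDerivAt x
      (innerSL ℝ ξ).hasFDerivAt).const_mul a).fderiv
    have e : fderiv ℝ (fun x : Euc d => a * G (inner ℝ ξ x)) x = _ := h
    rw [classicalPartial, e]
    simp [EuclideanSpace.inner_single_right]
    ring
  funext x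
  have k1 := fun i => key (G := F) 1 hF i
  simp only [one_mul] at k1
  simp only [lap, k1, key (G := F') _ hF', EuclideanSpace.norm_sq_eq, Finset.sum_mul]
  exact Finset.sum_congr rfl fun i _ => by rw [Real.norm_eq_abs, sq_abs]; ring

/-- Testing with plane waves shows that the Fourier transform of `u`, extended by zero, vanishes off
`|ξ|² = κ`. It is continuous and this set is null, so it vanishes identically. The sign of `κ` is
irrelevant; a positive dimension is needed for the sphere, possibly a point, to be null. -/
theorem ClampedPair.ae_eq_zero_of_helmholtz [Nontrivial (Euc d)] {κ : ℝ} (h : ClampedPair R u g)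
    (hg : g =ᵐ[ballMeasure d R] fun x => -κ * u x) : u =ᵐ[ballMeasure d R] fun _ => 0 := by
  have hu : Integrable u (ballMeasure d R) := h.memLp_left.integrable (by norm_num)
  have trig : ∀ {F F' F'' : ℝ → ℝ}, ContDiff ℝ (⊤ : ℕ∞) F → (∀ y, HasDerivAt F (F' y) y) →
      (∀ y, HasDerivAt F' (F'' y) y) → (∀ y, F'' y = -F y) → ∀ ξ : Euc d, ‖ξ‖ ^ 2 ≠ κ →
      ∫ x, u x * F (inner ℝ ξ x) ∂(ballMeasure d R) = 0 := by
    intro F F' F'' cF hF hF' hFF ξ hξ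
    have hs : Smooth fun x : Euc d => F (inner ℝ ξ x) :=
      cF.comp (contDiff_const.inner ℝ contDiff_id)
    have e := h.integral_mul_smooth hs
    rw [lap_comp_inner ξ hF hF'] at e
    have e1 : ∫ x, g x * F (inner ℝ ξ x) ∂(ballMeasure d R) =
        -κ * ∫ x, u x * F (inner ℝ ξ x) ∂(ballMeasure d R) := by
      rw [← integral_const_mul]
      refine integral_congr_ae ?_
      filter_upwards [hg] with x hx
      rw [hx]; ring
    have e2 : ∫ x, u x * (‖ξ‖ ^ 2 * F'' (inner ℝ ξ x)) ∂(ballMeasure d R) =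
        -‖ξ‖ ^ 2 * ∫ x, u x * F (inner ℝ ξ x) ∂(ballMeasure d R) := by
      rw [← integral_const_mul]
      congr 1
      funext x
      rw [hFF]; ring
    rw [e1, e2] at e
    have : (‖ξ‖ ^ 2 - κ) * ∫ x, u x * F (inner ℝ ξ x) ∂(ballMeasure d R) = 0 := by linarith
    exact (mul_eq_zero.1 this).resolve_left (sub_ne_zero.2 hξ)
  have hcos := trig Real.contDiff_cos Real.hasDerivAt_cos
    (fun y => (Real.hasDerivAt_sin y).neg) (fun y => rfl)
  have hsin := trig Real.contDiff_sin Real.hasDerivAt_sin Real.hasDerivAt_cos (fun y => rfl)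
  -- Uniqueness of the Fourier transform is taken from characteristic functions of finite measures,
  -- applied to the densities of the positive and negative parts of `u`.
  set p : Euc d → NNReal := fun x => (u x).toNNReal with hp
  set m : Euc d → NNReal := fun x => (-u x).toNNReal with hm
  have ap : AEMeasurable p (ballMeasure d R) := hu.aemeasurable.real_toNNReal
  have am : AEMeasurable m (ballMeasure d R) := hu.neg.aemeasurable.real_toNNReal
  set P := (ballMeasure d R).withDensity (fun x => (p x : ℝ≥0∞)) with hP
  set N := (ballMeasure d R).withDensity (fun x => (m x : ℝ≥0∞)) with hN
  have : IsFiniteMeasure P := isFiniteMeasure_withDensity hu.lintegral_lt_top.ne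
  have : IsFiniteMeasure N := isFiniteMeasure_withDensity hu.neg.lintegral_lt_top.ne
  have hchar : ∀ ξ : Euc d, ‖ξ‖ ^ 2 ≠ κ → charFun P ξ = charFun N ξ := by
    intro ξ hξ
    rw [charFun_apply, charFun_apply, hP, hN, integral_withDensity_eq_integral_smul₀ ap,
      integral_withDensity_eq_integral_smul₀ am, ← sub_eq_zero]
    have hb : ∀ f : Euc d → NNReal, Integrable (fun x => (f x : ℝ)) (ballMeasure d R) →
        Integrable (fun x => f x • Complex.exp ((inner ℝ x ξ : ℝ) * Complex.I))
          (ballMeasure d R) := by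
      intro f hf
      refine (hf.norm).mono (hf.aestronglyMeasurable.smul (Continuous.aestronglyMeasurable
        (by fun_prop))) (Eventually.of_forall fun x => ?_)
      rw [NNReal.smul_def, norm_smul, Complex.norm_exp_ofReal_mul_I, mul_one, norm_norm]
    rw [← integral_sub (hb p hu.real_toNNReal) (hb m hu.neg.real_toNNReal)]
    have hpt : ∀ x, p x • Complex.exp ((inner ℝ x ξ : ℝ) * Complex.I) -
        m x • Complex.exp ((inner ℝ x ξ : ℝ) * Complex.I) =
        ((u x * Real.cos (inner ℝ ξ x) : ℝ) : ℂ) +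
          ((u x * Real.sin (inner ℝ ξ x) : ℝ) : ℂ) * Complex.I := by
      intro x
      have hux : (p x : ℝ) - m x = u x := by
        simp only [hp, hm, Real.coe_toNNReal']
        rcases le_total 0 (u x) with h | h
        · rw [max_eq_left h, max_eq_right (neg_nonpos.2 h), sub_zero]
        · rw [max_eq_right h, max_eq_left (neg_nonneg.2 h)]; ring
      rw [NNReal.smul_def, NNReal.smul_def, ← sub_smul, hux, real_inner_comm, Complex.exp_mul_I,
        Complex.real_smul]
      push_cast
      ring
    have hint : ∀ F : ℝ → ℝ, Continuous F →
        Integrable (fun x => u x * F (inner ℝ ξ x)) (ballMeasure d R) := fun F hF =>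
      integrable_mul_ball h.memLp_left (memLp_ballMeasure_of_continuous (by fun_prop))
    simp only [hpt]
    rw [integral_add (hint _ Real.continuous_cos).ofReal
      ((hint _ Real.continuous_sin).ofReal.mul_const _), integral_mul_const, integral_complex_ofReal,
      integral_complex_ofReal, hcos ξ hξ, hsin ξ hξ]
    simp
  have hdense : Dense {ξ : Euc d | ‖ξ‖ ^ 2 ≠ κ} := by
    refine Measure.dense_of_ae (μ := volume) ?_
    rw [ae_iff]
    refine measure_mono_null (fun ξ hξ => ?_) (Measure.addHaar_sphere volume (0 : Euc d) (√κ))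
    have : ‖ξ‖ ^ 2 = κ := not_not.1 hξ
    simp [← this]
  have hPN : P = N := Measure.ext_of_charFun
    (Continuous.ext_on hdense continuous_charFun continuous_charFun hchar)
  have := (withDensity_eq_iff ap.coe_nnreal_ennreal am.coe_nnreal_ennreal
    hu.lintegral_lt_top.ne).1 hPN
  filter_upwards [this] with x hx
  have hx' : p x = m x := by exact_mod_cast hx
  have h2 : (p x : ℝ) = m x := by rw [hx']
  simp only [hp, hm, Real.coe_toNNReal'] at h2
  rcases le_total 0 (u x) with h | h
  · rw [max_eq_left h, max_eq_right (neg_nonpos.2 h)] at h2; exact h2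
  · rw [max_eq_right h, max_eq_left (neg_nonneg.2 h)] at h2; linarith

end Pairs

/-! ### Radial representatives -/

section Radial

variable {d : ℕ} {R : ℝ} {u g b : Euc d → ℝ}

/-- The orthogonal group, as a topological group. -/
abbrev OrthGroup (d : ℕ) : Type := unitary (Euc d →L[ℝ] Euc d)

instance continuousStar_clm : ContinuousStar (Euc d →L[ℝ] Euc d) :=
  ⟨(ContinuousLinearMap.adjoint (𝕜 := ℝ) (E := Euc d) (F := Euc d)).continuous⟩

instance isTopologicalGroup_orthGroup : IsTopologicalGroup (OrthGroup d) :=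
  inferInstanceAs (IsTopologicalGroup (unitary (Euc d →L[ℝ] Euc d)))

instance compactSpace_orthGroup : CompactSpace (OrthGroup d) := by
  refine isCompact_iff_compactSpace.1 ?_
  refine Metric.isCompact_of_isClosed_isBounded isClosed_unitary ?_
  refine (Metric.isBounded_closedBall (x := (0 : Euc d →L[ℝ] Euc d)) (r := 1)).subset ?_
  intro g hg
  rw [mem_closedBall_zero_iff]
  refine ContinuousLinearMap.opNorm_le_bound _ zero_le_one fun x => ?_
  rw [one_mul]
  exact (ContinuousLinearMap.norm_map_of_mem_unitary hg x).le

instance measurableSpace_orthGroup : MeasurableSpace (OrthGroup d) := borel _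

instance borelSpace_orthGroup : BorelSpace (OrthGroup d) := ⟨rfl⟩

instance secondCountable_orthGroup : SecondCountableTopology (OrthGroup d) := by
  have : ProperSpace (Euc d →L[ℝ] Euc d) := FiniteDimensional.proper ℝ _
  infer_instance

/-- The invariant probability measure on the orthogonal group. -/
def orthMeasure (d : ℕ) : Measure (OrthGroup d) := Measure.haarMeasure ⊤

instance isMulLeftInvariant_orthMeasure : (orthMeasure d).IsMulLeftInvariant := by
  unfold orthMeasure; infer_instance

instance isProbabilityMeasure_orthMeasure : IsProbabilityMeasure (orthMeasure d) :=
  ⟨Measure.haarMeasure_self (K₀ := (⊤ : PositiveCompacts (OrthGroup d)))⟩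

theorem continuous_orthGroup_action :
    Continuous fun p : OrthGroup d × Euc d => (p.1 : Euc d →L[ℝ] Euc d) p.2 :=
  (continuous_subtype_val.comp continuous_fst).clm_apply continuous_snd

/-- A function that is almost everywhere invariant under each rotation is radial. -/
theorem exists_radial_of_invariant [Nontrivial (Euc d)]
    (hu : AEStronglyMeasurable u (ballMeasure d R))
    (hinv : ∀ σ : Euc d ≃ₗᵢ[ℝ] Euc d, (fun x => u (σ x)) =ᵐ[ballMeasure d R] u) :
    ∃ f : ℝ → ℝ, u =ᵐ[ballMeasure d R] fun x => f ‖x‖ := by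
  set u' := hu.mk u with hu'
  have hm : Measurable u' := hu.stronglyMeasurable_mk.measurable
  have huu : u =ᵐ[ballMeasure d R] u' := hu.ae_eq_mk
  have hinv' : ∀ σ : Euc d ≃ₗᵢ[ℝ] Euc d, ∀ᵐ x ∂(ballMeasure d R), u' (σ x) = u' x := by
    intro σ
    have := (measurePreserving_ballMeasure (R := R) σ).quasiMeasurePreserving.ae_eq_comp huu
    filter_upwards [this, hinv σ, huu] with x h1 h2 h3
    rw [← h3, ← h2]
    exact h1.symm
  -- The exceptional null set of the invariance depends on the rotation. Averaging over the group
  -- gives an exactly invariant function, equal to `u'` almost everywhere by Fubini. The inverse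
  -- makes left invariance of the Haar measure the one that applies.
  set U : Euc d → ℝ := fun x =>
    ∫ g : OrthGroup d, u' (((g⁻¹ : OrthGroup d) : Euc d →L[ℝ] Euc d) x) ∂(orthMeasure d) with hU
  have hUinv : ∀ (h : OrthGroup d) (x : Euc d), U ((h : Euc d →L[ℝ] Euc d) x) = U x := by
    intro h x
    have := integral_mul_left_eq_self (μ := orthMeasure d)
      (fun g : OrthGroup d => u' (((g⁻¹ : OrthGroup d) : Euc d →L[ℝ] Euc d) x)) h⁻¹
    simp only [hU]
    rw [← this]
    congr 1
    funext g
    rw [mul_inv_rev, inv_inv]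
    rfl
  have hae : ∀ᵐ x ∂(ballMeasure d R), u' x = U x := by
    have hmeas : MeasurableSet {p : OrthGroup d × Euc d |
        u' (((p.1⁻¹ : OrthGroup d) : Euc d →L[ℝ] Euc d) p.2) = u' p.2} := by
      refine measurableSet_eq_fun (hm.comp ?_) (hm.comp measurable_snd)
      exact (continuous_orthGroup_action.comp
        ((continuous_fst.inv).prodMk continuous_snd)).measurable
    have h1 : ∀ᵐ g ∂(orthMeasure d), ∀ᵐ x ∂(ballMeasure d R),
        u' (((g⁻¹ : OrthGroup d) : Euc d →L[ℝ] Euc d) x) = u' x :=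
      Eventually.of_forall fun g => hinv' (Unitary.linearIsometryEquiv g⁻¹)
    filter_upwards [(Measure.ae_ae_comm hmeas).1 h1] with x hx
    simp only [hU]
    rw [integral_congr_ae hx]
    simp
  obtain ⟨e, he⟩ := exists_norm_eq (Euc d) zero_le_one
  refine ⟨fun r => U (r • e), ?_⟩
  filter_upwards [huu, hae] with x h1 h2
  rw [h1, h2]
  -- Points of equal norm are exchanged by the reflection in their bisecting hyperplane, so the
  -- value of `U` on the ray through `e` determines it.
  have hn : ‖x‖ = ‖‖x‖ • e‖ := by rw [norm_smul, he, norm_norm, mul_one]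
  have hr := Submodule.reflection_sub hn
  have := hUinv (Unitary.linearIsometryEquiv.symm (ℝ ∙ (x - ‖x‖ • e))ᗮ.reflection) x
  rw [Unitary.coe_symm_linearIsometryEquiv_apply] at this
  rw [← this]
  exact congrArg U hr

/-! ### Polar coordinates -/

theorem one_le_dim [Nontrivial (Euc d)] : 1 ≤ d := by
  have := Module.finrank_pos (R := ℝ) (M := Euc d)
  rw [finrank_euclideanSpace_fin] at this
  exact this

/-- The area of the unit sphere. -/
def sphereArea (d : ℕ) : ℝ := d * (volume : Measure (Euc d)).real (Metric.ball 0 1)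

theorem sphereArea_pos [Nontrivial (Euc d)] : 0 < sphereArea d := by
  have hd : 0 < d := one_le_dim
  have h := ENNReal.toReal_pos (Metric.measure_ball_pos (volume : Measure (Euc d)) 0 one_pos).ne'
    measure_ball_lt_top.ne
  exact mul_pos (by exact_mod_cast hd) h

theorem integral_ballMeasure_radial [Nontrivial (Euc d)] (f : ℝ → ℝ) :
    ∫ x, f ‖x‖ ∂(ballMeasure d R) =
      sphereArea d * ∫ r in Ioo 0 R, r ^ (d - 1) * f r := by
  have e : ∫ x, f ‖x‖ ∂(ballMeasure d R) = ∫ x : Euc d, (Iio R).indicator f ‖x‖ := by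
    rw [← integral_indicator Metric.isOpen_ball.measurableSet]
    congr 1
    funext x
    simp [indicator]
  rw [e, integral_fun_norm_addHaar, finrank_euclideanSpace_fin, nsmul_eq_mul, smul_eq_mul,
    ← mul_assoc]
  congr 1
  rw [← Ioi_inter_Iio, ← setIntegral_indicator measurableSet_Iio]
  congr 1
  funext r
  by_cases h : r ∈ Iio R <;> simp [h]

theorem integrableOn_of_radial [Nontrivial (Euc d)] {f : ℝ → ℝ}
    (h : Integrable (fun x => f ‖x‖) (ballMeasure d R)) :
    IntegrableOn (fun r => r ^ (d - 1) * f r) (Ioo 0 R) := by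
  have := (integrableOn_fun_norm_addHaar (volume : Measure (Euc d)) (f := f) (r := R)).1 h
  simpa [finrank_euclideanSpace_fin] using this

/-! ### The lemma of du Bois-Reymond -/

theorem exists_Icc_of_isCompact {K : Set ℝ} (hK : IsCompact K) {R : ℝ} (hR : 0 < R)
    (h : K ⊆ Ioo 0 R) : ∃ a b, 0 < a ∧ a ≤ b ∧ b < R ∧ K ⊆ Icc a b := by
  rcases K.eq_empty_or_nonempty with rfl | hne
  · exact ⟨R / 2, R / 2, by linarith, le_rfl, by linarith, empty_subset _⟩
  · have h1 := hK.sInf_mem hne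
    have h2 := hK.sSup_mem hne
    exact ⟨sInf K, sSup K, (h h1).1, csInf_le hK.bddBelow h2, (h h2).2,
      fun x hx => ⟨csInf_le hK.bddBelow hx, le_csSup hK.bddAbove hx⟩⟩

theorem contDiff_of_hasDerivAt {f f' : ℝ → ℝ} (h : ∀ x, HasDerivAt f (f' x) x)
    (hf' : ContDiff ℝ (⊤ : ℕ∞) f') : ContDiff ℝ (⊤ : ℕ∞) f := by
  have e : deriv f = f' := funext fun x => (h x).deriv
  rw [contDiff_infty_iff_deriv]
  exact ⟨fun x => (h x).differentiableAt, by rwa [e]⟩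

theorem integrable_mul_test {R : ℝ} {f η : ℝ → ℝ} (hf : LocallyIntegrableOn f (Ioo 0 R))
    (hη : Continuous η) (hc : HasCompactSupport η) (hs : tsupport η ⊆ Ioo 0 R) :
    Integrable fun r => f r * η r := by
  have h1 : IntegrableOn f (tsupport η) := hf.integrableOn_compact_subset hs hc
  have h2 := h1.mul_continuousOn hη.continuousOn hc
  refine (integrableOn_iff_integrable_of_support_subset ?_).1 h2
  exact fun x hx => subset_tsupport η (right_ne_zero_of_mul hx)

theorem setIntegral_mul_test {R : ℝ} {f η : ℝ → ℝ} (hs : tsupport η ⊆ Ioo 0 R) :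
    ∫ r in Ioo 0 R, f r * η r = ∫ r, f r * η r :=
  setIntegral_eq_integral_of_forall_compl_eq_zero fun x hx => by
    rw [image_eq_zero_of_notMem_tsupport fun h => hx (hs h), mul_zero]

/-- A test function of integral zero is the derivative of a test function. Subtracting from `η` the
multiple of a fixed bump `η₀` with the same integral shows that `f - β` is orthogonal to all `η`,
where `β` is the mean of `f` against `η₀`. -/
theorem ae_eq_const_of_integral_deriv_eq_zero {R : ℝ} (hR : 0 < R) {f : ℝ → ℝ}
    (hf : LocallyIntegrableOn f (Ioo 0 R))
    (h : ∀ τ : ℝ → ℝ, ContDiff ℝ (⊤ : ℕ∞) τ → HasCompactSupport τ → tsupport τ ⊆ Ioo 0 R →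
      ∫ r in Ioo 0 R, f r * deriv τ r = 0) :
    ∃ β, ∀ᵐ r ∂(volume : Measure ℝ), r ∈ Ioo 0 R → f r = β := by
  obtain ⟨η₀, hη₀s, hη₀c, hη₀, hη₀r, hη₀p⟩ :
      ∃ η : ℝ → ℝ, tsupport η ⊆ Ioo 0 R ∧ HasCompactSupport η ∧ ContDiff ℝ (⊤ : ℕ∞) η ∧
        range η ⊆ Icc 0 1 ∧ η (R / 2) = 1 :=
    exists_contDiff_tsupport_subset (n := ⊤) (Ioo_mem_nhds (by linarith) (by linarith))
  have hm : 0 < ∫ r, η₀ r := by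
    refine hη₀.continuous.integral_pos_of_hasCompactSupport_nonneg_nonzero hη₀c
      (fun r => (hη₀r ⟨r, rfl⟩).1) (x := R / 2) (by rw [hη₀p]; exact one_ne_zero)
  set m := ∫ r, η₀ r with hmdef
  set β := m⁻¹ * ∫ r, f r * η₀ r with hβ
  have hconst : LocallyIntegrableOn (fun _ : ℝ => β) (Ioo 0 R) :=
    (locallyIntegrable_const β).locallyIntegrableOn _
  refine ⟨β, ?_⟩
  have key := isOpen_Ioo.ae_eq_zero_of_integral_contDiff_smul_eq_zero (hf.sub hconst) ?_
  · filter_upwards [key] with r hr hrm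
    have := hr hrm
    simp only [Pi.sub_apply] at this
    linarith
  intro η hη hηc hηs
  set ζ : ℝ → ℝ := fun r => η r - (m⁻¹ * ∫ t, η t) * η₀ r with hζ
  have hζd : ContDiff ℝ (⊤ : ℕ∞) ζ := hη.sub (contDiff_const.mul hη₀)
  have iη : Integrable η := hη.continuous.integrable_of_hasCompactSupport hηc
  have iη₀ : Integrable η₀ := hη₀.continuous.integrable_of_hasCompactSupport hη₀c
  have hζint : ∫ r, ζ r = 0 := by
    simp only [hζ]
    rw [integral_sub iη (iη₀.const_mul _), integral_const_mul, ← hmdef]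
    field_simp
    ring
  obtain ⟨a, b, ha, hab, hb, hK⟩ := exists_Icc_of_isCompact (hηc.isCompact.union hη₀c.isCompact) hR
    (union_subset hηs hη₀s)
  have hζ0 : ∀ r, r ∉ Icc a b → ζ r = 0 := by
    intro r hr
    have h1 : η r = 0 := image_eq_zero_of_notMem_tsupport fun h => hr (hK (Or.inl h))
    have h2 : η₀ r = 0 := image_eq_zero_of_notMem_tsupport fun h => hr (hK (Or.inr h))
    simp [hζ, h1, h2]
  set τ : ℝ → ℝ := fun r => ∫ t in a..r, ζ t with hτ
  have hτd : ∀ r, HasDerivAt τ (ζ r) r := fun r =>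
    intervalIntegral.integral_hasDerivAt_right (hζd.continuous.intervalIntegrable _ _)
      hζd.continuous.stronglyMeasurable.stronglyMeasurableAtFilter hζd.continuous.continuousAt
  -- To the left of `a` the primitive has nothing to integrate; to the right of `b` it equals the
  -- full integral of `ζ`, which is zero.
  have hτ0 : ∀ r, r ∉ Icc a b → τ r = 0 := by
    intro r hr
    rcases lt_or_ge r a with h | h
    · simp only [hτ]
      refine intervalIntegral.integral_zero_ae ?_
      have hne : ∀ᵐ t : ℝ, t ≠ a := by simp [ae_iff]
      filter_upwards [hne] with t hta ht
      rw [uIoc_of_ge h.le] at ht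
      exact hζ0 t fun h' => hta (le_antisymm ht.2 h'.1)
    · have hr' : b < r := by
        by_contra! h'
        exact hr ⟨h, h'⟩
      simp only [hτ]
      rw [intervalIntegral.integral_of_le h, ← hζint, integral_Ioc_eq_integral_Ioo,
        ← integral_Icc_eq_integral_Ioo]
      refine setIntegral_eq_integral_of_forall_compl_eq_zero fun x hx => hζ0 x fun hx' => hx ?_
      exact ⟨hx'.1, hx'.2.trans hr'.le⟩
  have hτsupp : tsupport τ ⊆ Icc a b :=
    closure_minimal (fun r hr => by_contra fun h => hr (hτ0 r h)) isClosed_Icc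
  have hz := h τ (contDiff_of_hasDerivAt hτd hζd)
    (isCompact_Icc.of_isClosed_subset (isClosed_tsupport _) hτsupp)
    (hτsupp.trans (Icc_subset_Ioo ha hb))
  have hderiv : deriv τ = ζ := funext fun r => (hτd r).deriv
  have hζK : tsupport ζ ⊆ Icc a b :=
    closure_minimal (fun r hr => by_contra fun h => hr (hζ0 r h)) isClosed_Icc
  have hζs : tsupport ζ ⊆ Ioo 0 R := hζK.trans (Icc_subset_Ioo ha hb)
  rw [hderiv, setIntegral_mul_test hζs] at hz
  have i1 := integrable_mul_test hf hη.continuous hηc hηs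
  have i2 := integrable_mul_test hf hη₀.continuous hη₀c hη₀s
  have e1 : ∀ r, f r * ζ r = f r * η r - (m⁻¹ * ∫ t, η t) * (f r * η₀ r) := fun r => by
    simp only [hζ]; ring
  simp only [e1] at hz
  rw [integral_sub i1 (i2.const_mul _), integral_const_mul] at hz
  have e2 : ∀ r, η r • (f - fun _ => β : ℝ → ℝ) r = f r * η r - β * η r := fun r => by
    simp only [Pi.sub_apply, smul_eq_mul]; ring
  simp only [e2]
  rw [integral_sub i1 (iη.const_mul _), integral_const_mul, hβ]
  linarith

/-! ### Radial solutions of the modified Helmholtz equation -/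

/-- A radial test function on which `Δ - s` takes prescribed values in divergence form. -/
theorem exists_profile {s : ℝ} (hs : 0 < s) (hR : 0 < R) (hd : 1 ≤ d) {τ : ℝ → ℝ}
    (hτ : ContDiff ℝ (⊤ : ℕ∞) τ) (hc : HasCompactSupport τ) (hsupp : tsupport τ ⊆ Ioo 0 R) :
    ∃ F : ℝ → ℝ, ContDiff ℝ (⊤ : ℕ∞) F ∧ (∃ R' < R, ∀ r, R' ≤ r → F (r ^ 2) = 0) ∧
      ∃ F' F'' : ℝ → ℝ, (∀ y, HasDerivAt F (F' y) y) ∧ (∀ y, HasDerivAt F' (F'' y) y) ∧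
      ∀ r, 0 < r → r ^ (d - 1) * (2 * d * F' (r ^ 2) + 4 * r ^ 2 * F'' (r ^ 2) - s * F (r ^ 2)) =
        2 * deriv τ r / bes ((d : ℝ) / 2 - 1) (s * r ^ 2 / 4) := by
  have hd' : (1 : ℝ) ≤ d := by exact_mod_cast hd
  obtain ⟨a, b, ha, hab, hb, hK⟩ := exists_Icc_of_isCompact hc.isCompact hR hsupp
  have hτ0 : ∀ r, r ∉ Icc a b → τ r = 0 := fun r hr =>
    image_eq_zero_of_notMem_tsupport fun h => hr (hK h)
  set ν : ℝ := (d : ℝ) / 2 - 1 with hν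
  set ι : ℝ → ℝ := fun y => bes ν (s * y / 4) with hι
  set ι1 : ℝ → ℝ := fun y => s / 4 * bes (ν + 1) (s * y / 4) with hι1
  set ι2 : ℝ → ℝ := fun y => s / 4 * (s / 4 * bes (ν + 1 + 1) (s * y / 4)) with hι2
  have dι : ∀ y, HasDerivAt ι (ι1 y) y := hasDerivAt_bes_scaled ν s
  have dι1 : ∀ y, HasDerivAt ι1 (ι2 y) y := fun y =>
    (hasDerivAt_bes_scaled (ν + 1) s y).const_mul (s / 4)
  have cι : ContDiff ℝ (⊤ : ℕ∞) ι := contDiff_bes_scaled ν s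
  have hιpos : ∀ y, 0 ≤ y → 0 < ι y := fun y hy =>
    bes_pos (by rw [hν]; linarith) (by positivity)
  have hode : ∀ y, 2 * d * ι1 y + 4 * y * ι2 y = s * ι y := by
    intro y
    have r := bes_recurrence ν (s * y / 4)
    simp only [hι, hι1, hι2]
    rw [show ν + 1 + 1 = ν + 2 by ring]
    rw [hν] at r ⊢
    linear_combination s * r
  -- Reduction of order: for `F = ιS` one has `rᵈ⁻¹ ι (Δ - s)F = (rᵈ⁻¹ ι² dS/dr)'`. As `dS/dr = 2r
  -- S'(r²)`, the choice `S' = σ` makes the bracket `2τ`.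
  set σ : ℝ → ℝ := fun y => τ (√y) / (ι y ^ 2 * √y ^ d) with hσ
  have hσ0 : ∀ y, √y ∉ Icc a b → σ y = 0 := fun y hy => by simp [hσ, hτ0 _ hy]
  have cσ : ContDiff ℝ (⊤ : ℕ∞) σ := by
    rw [contDiff_iff_contDiffAt]
    intro y
    rcases lt_or_ge y (a ^ 2) with h | h
    · refine (contDiffAt_const (c := (0 : ℝ))).congr_of_eventuallyEq ?_
      filter_upwards [Iio_mem_nhds h] with z hz
      refine hσ0 z fun hz' => ?_
      have : √z < a := by rw [Real.sqrt_lt' ha]; exact hz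
      exact absurd hz'.1 (not_le.2 this)
    · have hy : 0 < y := lt_of_lt_of_le (by positivity) h
      have hsq : ContDiffAt ℝ (⊤ : ℕ∞) (fun y => √y) y := Real.contDiffAt_sqrt hy.ne'
      refine (hτ.contDiffAt.comp y hsq).div ((cι.contDiffAt.pow 2).mul (hsq.pow d)) ?_
      have := hιpos y hy.le
      positivity
  -- Integrating from `R²` makes `S` vanish near the boundary. Near the centre `S` is constant and
  -- `F` a multiple of `ι`, so `F` is smooth but need not vanish there.
  set S : ℝ → ℝ := fun y => ∫ t in (R ^ 2)..y, σ t with hS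
  have dS : ∀ y, HasDerivAt S (σ y) y := fun y =>
    intervalIntegral.integral_hasDerivAt_right (cσ.continuous.intervalIntegrable _ _)
      cσ.continuous.stronglyMeasurable.stronglyMeasurableAtFilter cσ.continuous.continuousAt
  have cS := contDiff_of_hasDerivAt dS cσ
  have dσ : ∀ y, HasDerivAt σ (deriv σ y) y := fun y =>
    (cσ.differentiable (by simp) y).hasDerivAt
  refine ⟨fun y => ι y * S y, cι.mul cS, ⟨(b + R) / 2, by linarith, fun r hr => ?_⟩,
    fun y => ι1 y * S y + ι y * σ y,
    fun y => (ι2 y * S y + ι1 y * σ y) + (ι1 y * σ y + ι y * deriv σ y),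
    fun y => (dι y).mul (dS y), fun y => ((dι1 y).mul (dS y)).add ((dι y).mul (dσ y)),
    fun r hr => ?_⟩
  · have hr0 : b < r := by linarith
    have hb0 : 0 ≤ b := ha.le.trans hab
    have : S (r ^ 2) = 0 := by
      simp only [hS]
      refine intervalIntegral.integral_zero_ae (Eventually.of_forall fun t ht => hσ0 t fun ht' => ?_)
      have hbt : b ^ 2 < t := by
        rcases le_total (R ^ 2) (r ^ 2) with h | h
        · rw [uIoc_of_le h] at ht
          exact lt_trans (by gcongr) ht.1
        · rw [uIoc_of_ge h] at ht
          exact lt_trans (by gcongr) ht.1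
      have : b < √t := Real.lt_sqrt_of_sq_lt hbt
      exact absurd ht'.2 (not_le.2 this)
    simp [this]
  · have hip := hιpos (r ^ 2) (by positivity)
    have hcomp : ∀ t, 0 < t → ι (t ^ 2) ^ 2 * t ^ d * σ (t ^ 2) = τ t := by
      intro t ht
      have := hιpos (t ^ 2) (by positivity)
      simp only [hσ, Real.sqrt_sq ht.le]
      field_simp
    have hsq : HasDerivAt (fun t : ℝ => t ^ 2) (2 * r) r := by simpa using hasDerivAt_pow 2 r
    have d1 := HasDerivAt.comp r (dι (r ^ 2)) hsq
    have d2 := HasDerivAt.comp r (dσ (r ^ 2)) hsq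
    have d3 := ((d1.pow 2).mul (hasDerivAt_pow d r)).mul d2
    have d4 : HasDerivAt (fun t => ι (t ^ 2) ^ 2 * t ^ d * σ (t ^ 2)) (deriv τ r) r := by
      refine ((hτ.differentiable (by simp) r).hasDerivAt).congr_of_eventuallyEq ?_
      filter_upwards [Ioi_mem_nhds hr] with t ht
      exact hcomp t ht
    have e := d3.unique d4
    simp only [Function.comp] at e
    have hrd : r ^ d = r ^ (d - 1) * r := by rw [← pow_succ]; congr 1; omega
    simp only [Pi.pow_apply, Function.comp, Pi.mul_apply] at e
    rw [hrd] at e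
    have hode' := hode (r ^ 2)
    change _ = 2 * deriv τ r / ι (r ^ 2)
    rw [eq_div_iff hip.ne', ← e]
    push_cast
    norm_num
    linear_combination (r ^ (d - 1) * S (r ^ 2) * ι (r ^ 2)) * hode'

theorem isTest_radial {F : ℝ → ℝ} (hF : ContDiff ℝ (⊤ : ℕ∞) F) {R' : ℝ} (hR' : R' < R)
    (h : ∀ r, R' ≤ r → F (r ^ 2) = 0) : IsTest R fun x : Euc d => F (‖x - 0‖ ^ 2) := by
  have hsub : tsupport (fun x : Euc d => F (‖x - 0‖ ^ 2)) ⊆ Metric.closedBall 0 R' := by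
    refine closure_minimal (fun x hx => ?_) Metric.isClosed_closedBall
    by_contra hx'
    rw [mem_closedBall_zero_iff, not_le] at hx'
    exact hx (by simpa using h _ hx'.le)
  exact ⟨smooth_radial 0 hF, (isCompact_closedBall _ _).of_isClosed_subset (isClosed_tsupport _)
    hsub, hsub.trans (Metric.closedBall_subset_ball hR')⟩

/-- Tested on the profiles of `exists_profile`, the equation says that `f/ι` is orthogonal to every
`τ'`, hence constant. Because these profiles need not vanish at the centre, the singular solution is
excluded without any discussion of the behaviour there. -/
theorem ae_eq_radialSol_of_weak [Nontrivial (Euc d)] {s : ℝ} (hs : 0 < s) (hR : 0 < R)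
    (hb : MemLp b 2 (ballMeasure d R)) {f : ℝ → ℝ} (hf : b =ᵐ[ballMeasure d R] fun x => f ‖x‖)
    (hweak : ∀ φ, IsTest R φ → ∫ x, b x * (lap φ x - s * φ x) ∂(ballMeasure d R) = 0) :
    ∃ β, b =ᵐ[ballMeasure d R] fun x => β * radialSol s 0 x := by
  have hd : 1 ≤ d := one_le_dim
  have hd' : (1 : ℝ) ≤ d := by exact_mod_cast hd
  set ν : ℝ := (d : ℝ) / 2 - 1 with hν
  have hpos : ∀ r : ℝ, 0 < bes ν (s * r ^ 2 / 4) := fun r =>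
    bes_pos (by rw [hν]; linarith) (by positivity)
  have hcont : Continuous fun r : ℝ => bes ν (s * r ^ 2 / 4) := by
    have := continuous_bes ν
    fun_prop
  have hfL : Integrable (fun x : Euc d => f ‖x‖) (ballMeasure d R) :=
    (hb.integrable (by norm_num)).congr hf
  have hfI := integrableOn_of_radial hfL
  have hloc : LocallyIntegrableOn (fun r => f r / bes ν (s * r ^ 2 / 4)) (Ioo 0 R) := by
    have hgc : ContinuousOn (fun r : ℝ => (r ^ (d - 1) * bes ν (s * r ^ 2 / 4))⁻¹) (Ioo 0 R) :=
      ContinuousOn.inv₀ ((continuous_pow _).mul hcont).continuousOn fun r hr =>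
        (mul_pos (pow_pos hr.1 _) (hpos r)).ne'
    have h1 := hfI.locallyIntegrableOn.mul_continuousOn hgc isOpen_Ioo.isLocallyClosed
    refine h1.congr ?_
    filter_upwards [ae_restrict_mem measurableSet_Ioo] with r hr
    have := pow_pos hr.1 (d - 1)
    have := hpos r
    field_simp
  obtain ⟨β, hβ⟩ := ae_eq_const_of_integral_deriv_eq_zero hR hloc (fun τ hτ hc hsupp => by
    obtain ⟨F, hF, ⟨R', hR', hF0⟩, F', F'', dF, dF', heq⟩ := exists_profile hs hR hd hτ hc hsupp
    have hw := hweak _ (isTest_radial (d := d) hF hR' hF0)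
    rw [lap_radial 0 dF dF'] at hw
    have e1 : ∫ x, b x * (2 * d * F' (‖x - 0‖ ^ 2) + 4 * ‖x - 0‖ ^ 2 * F'' (‖x - 0‖ ^ 2) -
        s * F (‖x - 0‖ ^ 2)) ∂(ballMeasure d R) =
        ∫ x, (fun r => f r * (2 * d * F' (r ^ 2) + 4 * r ^ 2 * F'' (r ^ 2) -
        s * F (r ^ 2))) ‖x‖ ∂(ballMeasure d R) := by
      refine integral_congr_ae ?_
      filter_upwards [hf] with x hx
      rw [hx, sub_zero]
    rw [e1, integral_ballMeasure_radial (fun r => f r * (2 * d * F' (r ^ 2) +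
      4 * r ^ 2 * F'' (r ^ 2) - s * F (r ^ 2)))] at hw
    have hz := (mul_eq_zero.1 hw).resolve_left sphereArea_pos.ne'
    have e2 : ∫ r in Ioo 0 R, r ^ (d - 1) * (f r * (2 * d * F' (r ^ 2) + 4 * r ^ 2 * F'' (r ^ 2) -
        s * F (r ^ 2))) = ∫ r in Ioo 0 R, 2 * (f r / bes ν (s * r ^ 2 / 4) * deriv τ r) := by
      refine setIntegral_congr_fun measurableSet_Ioo fun r hr => ?_
      have := heq r hr.1
      rw [mul_left_comm, this]
      ring
    rw [e2, integral_const_mul] at hz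
    linarith)
  refine ⟨β, ?_⟩
  have hrs : MemLp (radialSol s 0) 2 (ballMeasure d R) := (smooth_radialSol s 0).memLp
  have hdiff : MemLp (fun x => b x - β * radialSol s 0 x) 2 (ballMeasure d R) :=
    hb.sub (hrs.const_mul β)
  have hint := integrable_mul_ball hdiff hdiff
  have h0 : ∫ x, (b x - β * radialSol s 0 x) * (b x - β * radialSol s 0 x) ∂(ballMeasure d R) =
      0 := by
    have e : ∫ x, (b x - β * radialSol s 0 x) * (b x - β * radialSol s 0 x) ∂(ballMeasure d R) =
        ∫ x, (fun r => (f r - β * bes ν (s * r ^ 2 / 4)) * (f r - β * bes ν (s * r ^ 2 / 4))) ‖x‖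
          ∂(ballMeasure d R) := by
      refine integral_congr_ae ?_
      filter_upwards [hf] with x hx
      simp only [hx, radialSol, sub_zero, ← hν]
    rw [e, integral_ballMeasure_radial (fun r => (f r - β * bes ν (s * r ^ 2 / 4)) *
      (f r - β * bes ν (s * r ^ 2 / 4)))]
    refine mul_eq_zero_of_right _ ?_
    refine integral_eq_zero_of_ae ?_
    rw [Filter.EventuallyEq, ae_restrict_iff' measurableSet_Ioo]
    filter_upwards [hβ] with r hr hrm
    have := hr hrm
    rw [div_eq_iff (hpos r).ne'] at this
    simp [this]
  have := (integral_eq_zero_iff_of_nonneg (fun x => mul_self_nonneg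
    (b x - β * radialSol s 0 x)) hint).1 h0
  filter_upwards [this] with x hx
  have : b x - β * radialSol s 0 x = 0 := mul_self_eq_zero.1 hx
  linarith

end Radial

/-! ### Weak derivatives -/

section Weak

variable {d : ℕ} {Ω : Opens (Euc d)} {i j : Fin d} {u u' g g' f : Euc d → ℝ}

theorem integrable_mul_testFunction (hg : LocallyIntegrableOn g (Ω : Set (Euc d))) (φ : 𝓓(Ω, ℝ)) :
    Integrable fun x => φ x * g x := by
  have hc : IsCompact (tsupport φ) := φ.hasCompactSupport
  have h1 : IntegrableOn g (tsupport φ) := hg.integrableOn_compact_subset φ.tsupport_subset hc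
  refine (integrableOn_iff_integrable_of_support_subset ?_).1
    (h1.continuousOn_mul φ.continuous.continuousOn hc)
  exact fun x hx => subset_tsupport φ (left_ne_zero_of_mul hx)

theorem setIntegral_mul_testFunction (g : Euc d → ℝ) (φ : 𝓓(Ω, ℝ)) :
    ∫ x in Ω, g x * φ x = ∫ x, φ x * g x := by
  simp only [mul_comm (g _)]
  refine setIntegral_eq_integral_of_forall_compl_eq_zero fun x hx => ?_
  rw [image_eq_zero_of_notMem_tsupport fun h => hx (φ.tsupport_subset h), zero_mul]

/-- By the fundamental lemma of the calculus of variations. Since `weakPartial` is an arbitrary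
choice, this is what gives its values meaning. -/
theorem HasWeakPartial.ae_eq (h : HasWeakPartial Ω i u g) (h' : HasWeakPartial Ω i u g') :
    g =ᵐ[volume.restrict (Ω : Set (Euc d))] g' := by
  have key := Ω.isOpen.ae_eq_zero_of_integral_contDiff_smul_eq_zero (h.2.1.sub h'.2.1)
    (fun φ hφ hc hs => by
      set Φ : 𝓓(Ω, ℝ) := ⟨φ, hφ, hc, hs⟩
      have e1 := h.2.2 Φ
      have e2 := h'.2.2 Φ
      rw [setIntegral_mul_testFunction] at e1 e2
      have i1 := integrable_mul_testFunction h.2.1 Φ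
      have i2 := integrable_mul_testFunction h'.2.1 Φ
      have e3 : ∀ x, φ x • (g - g') x = Φ x * g x - Φ x * g' x := fun x => by
        simp only [Pi.sub_apply, smul_eq_mul, mul_sub]
        rfl
      simp only [e3]
      rw [integral_sub i1 i2]
      linarith)
  rw [EventuallyEq, ae_restrict_iff' Ω.isOpen.measurableSet]
  filter_upwards [key] with x hx hxm
  have := hx hxm
  simp only [Pi.sub_apply] at this
  linarith

theorem HasWeakPartial.congr (h : HasWeakPartial Ω i u g)
    (hu : u =ᵐ[volume.restrict (Ω : Set (Euc d))] u')
    (hg : g =ᵐ[volume.restrict (Ω : Set (Euc d))] g') : HasWeakPartial Ω i u' g' := by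
  refine ⟨h.1.congr hu, h.2.1.congr hg, fun φ => ?_⟩
  have e1 : ∫ x in Ω, u' x * classicalPartial i φ x = ∫ x in Ω, u x * classicalPartial i φ x :=
    integral_congr_ae (by filter_upwards [hu] with x hx; rw [hx])
  have e2 : ∫ x in Ω, g' x * φ x = ∫ x in Ω, g x * φ x :=
    integral_congr_ae (by filter_upwards [hg] with x hx; rw [hx])
  rw [e1, e2, h.2.2 φ]

theorem hasWeakPartial_weakPartial (h : HasWeakPartial Ω i u g) :
    HasWeakPartial Ω i u (weakPartial Ω i u) := by
  have hex : ∃ g, HasWeakPartial Ω i u g := ⟨g, h⟩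
  unfold weakPartial
  rw [dif_pos hex]
  exact hex.choose_spec

theorem HasWeakPartial.weakPartial_ae_eq (h : HasWeakPartial Ω i u g) :
    weakPartial Ω i u =ᵐ[volume.restrict (Ω : Set (Euc d))] g :=
  (hasWeakPartial_weakPartial h).ae_eq h

theorem Smooth.hasWeakPartial (hf : Smooth f) (Ω : Opens (Euc d)) (i : Fin d) :
    HasWeakPartial Ω i f (ClampedPlate.classicalPartial i f) := by
  refine ⟨hf.continuous.locallyIntegrable.locallyIntegrableOn _,
    (hf.classicalPartial i).continuous.locallyIntegrable.locallyIntegrableOn _, fun φ => ?_⟩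
  have hφ : Smooth φ := φ.contDiff
  rw [setIntegral_mul_testFunction]
  have e1 : ∫ x in Ω, f x * ClampedPlate.classicalPartial i φ x =
      ∫ x, ClampedPlate.classicalPartial i φ x * f x := by
    simp only [mul_comm (f _)]
    refine setIntegral_eq_integral_of_forall_compl_eq_zero fun x hx => ?_
    rw [image_eq_zero_of_notMem_tsupport fun h => hx (φ.tsupport_subset
      (tsupport_classicalPartial_subset i φ h)), zero_mul]
  rw [e1, integral_mul_classicalPartial hφ hf φ.hasCompactSupport, neg_neg]

theorem Smooth.weakPartial_ae_eq (hf : Smooth f) (Ω : Opens (Euc d)) (i : Fin d) :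
    weakPartial Ω i f =ᵐ[volume.restrict (Ω : Set (Euc d))] ClampedPlate.classicalPartial i f :=
  (hf.hasWeakPartial Ω i).weakPartial_ae_eq

theorem Smooth.hasWeakPartial_weakPartial (hf : Smooth f) (Ω : Opens (Euc d)) (i j : Fin d) :
    HasWeakPartial Ω j (weakPartial Ω i f)
      (ClampedPlate.classicalPartial j (ClampedPlate.classicalPartial i f)) :=
  ((hf.classicalPartial i).hasWeakPartial Ω j).congr (hf.weakPartial_ae_eq Ω i).symm
    EventuallyEq.rfl

theorem Smooth.weakPartial_weakPartial_ae_eq (hf : Smooth f) (Ω : Opens (Euc d)) (i j : Fin d) :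
    weakPartial Ω j (weakPartial Ω i f) =ᵐ[volume.restrict (Ω : Set (Euc d))]
      ClampedPlate.classicalPartial j (ClampedPlate.classicalPartial i f) :=
  (hf.hasWeakPartial_weakPartial Ω i j).weakPartial_ae_eq

theorem Smooth.weakLaplacian_ae_eq (hf : Smooth f) (Ω : Opens (Euc d)) :
    weakLaplacian Ω f =ᵐ[volume.restrict (Ω : Set (Euc d))] ClampedPlate.lap f := by
  have := eventually_countable_forall.2 fun i => hf.weakPartial_weakPartial_ae_eq Ω i i
  filter_upwards [this] with x hx
  exact Finset.sum_congr rfl fun i _ => hx i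

theorem MemH2.memLp_weakPartial (h : MemH2 Ω u) (i : Fin d) :
    MemLp (weakPartial Ω i u) 2 (volume.restrict (Ω : Set (Euc d))) := by
  obtain ⟨g, hg, hm⟩ := h.first i
  exact (memLp_congr_ae hg.weakPartial_ae_eq).2 hm

theorem MemH2.memLp_weakPartial_weakPartial (h : MemH2 Ω u) (i j : Fin d) :
    MemLp (weakPartial Ω j (weakPartial Ω i u)) 2 (volume.restrict (Ω : Set (Euc d))) := by
  obtain ⟨g, hg, hm⟩ := h.second i j
  exact (memLp_congr_ae hg.weakPartial_ae_eq).2 hm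

theorem MemH2.memLp_weakLaplacian (h : MemH2 Ω u) :
    MemLp (weakLaplacian Ω u) 2 (volume.restrict (Ω : Set (Euc d))) :=
  memLp_finsetSum _ fun i _ => h.memLp_weakPartial_weakPartial i i

end Weak

/-! ### The space `H₀²` of a ball -/

section Ball

variable {d : ℕ} {c : Euc d} {R : ℝ} {u f : Euc d → ℝ}

theorem memLp_ball_of_continuous (hf : Continuous f) :
    MemLp f 2 (volume.restrict (openBall c R : Set (Euc d))) := by
  obtain ⟨C, hC⟩ := (isCompact_closedBall c R).exists_bound_of_continuousOn hf.continuousOn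
  have : IsFiniteMeasure (volume.restrict (openBall c R : Set (Euc d))) :=
    ⟨by simpa [openBall] using measure_ball_lt_top⟩
  refine MemLp.of_bound hf.aestronglyMeasurable C ?_
  filter_upwards [ae_restrict_mem (openBall c R).isOpen.measurableSet] with x hx
  exact hC x (Metric.ball_subset_closedBall hx)

theorem Smooth.memH2 (hf : Smooth f) (c : Euc d) (R : ℝ) : MemH2 (openBall c R) f :=
  ⟨memLp_ball_of_continuous hf.continuous,
    fun i => ⟨_, hf.hasWeakPartial _ i, memLp_ball_of_continuous (hf.classicalPartial i).continuous⟩,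
    fun i j => ⟨_, hf.hasWeakPartial_weakPartial _ i j,
      memLp_ball_of_continuous ((hf.classicalPartial i).classicalPartial j).continuous⟩⟩

theorem Smooth.h2Dist_eq (hf : Smooth f) (φ : 𝓓(openBall c R, ℝ)) :
    h2Dist (openBall c R) f φ =
      eLpNorm (fun x => f x - φ x) 2 (volume.restrict (openBall c R : Set (Euc d))) +
      ∑ i, eLpNorm (fun x => ClampedPlate.classicalPartial i f x -
        ClampedPlate.classicalPartial i φ x) 2 (volume.restrict (openBall c R : Set (Euc d))) +
      ∑ i, ∑ j, eLpNorm (fun x => ClampedPlate.classicalPartial j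
        (ClampedPlate.classicalPartial i f) x -
        ClampedPlate.classicalPartial j (ClampedPlate.classicalPartial i φ) x) 2
        (volume.restrict (openBall c R : Set (Euc d))) := by
  unfold h2Dist
  congr 1
  · congr 1
    refine Finset.sum_congr rfl fun i _ => eLpNorm_congr_ae ?_
    filter_upwards [hf.weakPartial_ae_eq (openBall c R) i] with x hx
    rw [hx]
  · refine Finset.sum_congr rfl fun i _ => Finset.sum_congr rfl fun j _ => eLpNorm_congr_ae ?_
    filter_upwards [hf.weakPartial_weakPartial_ae_eq (openBall c R) i j] with x hx
    rw [hx]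

theorem memH20_testFunction (φ : 𝓓(openBall c R, ℝ)) : MemH20 (openBall c R) φ := by
  have hφ : Smooth φ := φ.contDiff
  refine ⟨hφ.memH2 c R, fun ε hε => ⟨φ, ?_⟩⟩
  rw [hφ.h2Dist_eq]
  simpa using hε

theorem exists_seq_of_memH20 (h : MemH20 (openBall c R) u) :
    ∃ φ : ℕ → 𝓓(openBall c R, ℝ),
      Tendsto (fun n => h2Dist (openBall c R) u (φ n)) atTop (𝓝 0) := by
  choose φ hφ using fun n : ℕ => h.2 ((n : ℝ≥0∞) + 1)⁻¹ (by simp)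
  refine ⟨φ, tendsto_of_tendsto_of_tendsto_of_le_of_le tendsto_const_nhds ?_
    (fun _ => zero_le) fun n => (hφ n).le⟩
  have := (tendsto_add_atTop_iff_nat 1).2 ENNReal.tendsto_inv_nat_nhds_zero
  simpa using this

theorem eLpNorm_sub_le_h2Dist (u : Euc d → ℝ) (φ : 𝓓(openBall c R, ℝ)) :
    eLpNorm (⇑φ - u) 2 (volume.restrict (openBall c R : Set (Euc d))) ≤
      h2Dist (openBall c R) u φ := by
  rw [eLpNorm_sub_comm]
  exact le_add_right (le_add_right le_rfl)

theorem eLpNorm_classicalPartial_sub_le_h2Dist (u : Euc d → ℝ) (φ : 𝓓(openBall c R, ℝ))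
    (i : Fin d) :
    eLpNorm (classicalPartial i φ - weakPartial (openBall c R) i u) 2
      (volume.restrict (openBall c R : Set (Euc d))) ≤ h2Dist (openBall c R) u φ := by
  rw [eLpNorm_sub_comm]
  refine le_add_right (le_add_left ?_)
  exact Finset.single_le_sum (f := fun i => eLpNorm (fun x => weakPartial (openBall c R) i u x -
    classicalPartial i φ x) 2 (volume.restrict (openBall c R : Set (Euc d))))
    (fun _ _ => zero_le) (Finset.mem_univ i)

theorem eLpNorm_lap_sub_le_h2Dist (h : MemH2 (openBall c R) u) (φ : 𝓓(openBall c R, ℝ)) :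
    eLpNorm (lap φ - weakLaplacian (openBall c R) u) 2
      (volume.restrict (openBall c R : Set (Euc d))) ≤ h2Dist (openBall c R) u φ := by
  have hφ : Smooth φ := φ.contDiff
  rw [eLpNorm_sub_comm]
  have e : weakLaplacian (openBall c R) u - lap φ = ∑ i, fun x =>
      weakPartial (openBall c R) i (weakPartial (openBall c R) i u) x -
        classicalPartial i (classicalPartial i φ) x := by
    funext x
    simp [weakLaplacian, lap, Finset.sum_apply]
  rw [e]
  refine (eLpNorm_sum_le (fun i _ => ?_) (by norm_num)).trans (le_add_left ?_)
  · exact (h.memLp_weakPartial_weakPartial i i).aestronglyMeasurable.sub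
      ((hφ.classicalPartial i).classicalPartial i).continuous.aestronglyMeasurable
  · refine Finset.sum_le_sum fun i _ => ?_
    exact Finset.single_le_sum (f := fun j => eLpNorm (fun x =>
      weakPartial (openBall c R) j (weakPartial (openBall c R) i u) x -
        classicalPartial j (classicalPartial i φ) x) 2
        (volume.restrict (openBall c R : Set (Euc d))))
      (fun _ _ => zero_le) (Finset.mem_univ i)

theorem tendsto_zero_of_le_h2Dist {φ : ℕ → 𝓓(openBall c R, ℝ)} {a : ℕ → ℝ≥0∞}
    (hφ : Tendsto (fun n => h2Dist (openBall c R) u (φ n)) atTop (𝓝 0))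
    (h : ∀ n, a n ≤ h2Dist (openBall c R) u (φ n)) : Tendsto a atTop (𝓝 0) :=
  tendsto_of_tendsto_of_tendsto_of_le_of_le tendsto_const_nhds hφ (fun _ => zero_le) h

/-- Green's formula for `∫ |∇u|²` in `H₀²`. -/
theorem integral_gradSq (h : MemH20 (openBall c R) u) :
    ∫ x in openBall c R, gradSq (openBall c R) u x =
      -∫ x in openBall c R, u x * weakLaplacian (openBall c R) u x := by
  obtain ⟨φ, hφ⟩ := exists_seq_of_memH20 h
  have hs : ∀ n, Smooth (φ n) := fun n => (φ n).contDiff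
  have l0 := tendsto_zero_of_le_h2Dist hφ fun n => eLpNorm_sub_le_h2Dist u (φ n)
  have l1 := fun i => tendsto_zero_of_le_h2Dist hφ fun n =>
    eLpNorm_classicalPartial_sub_le_h2Dist u (φ n) i
  have l2 := tendsto_zero_of_le_h2Dist hφ fun n => eLpNorm_lap_sub_le_h2Dist h.1 (φ n)
  have m1 : ∀ n i, MemLp (classicalPartial i (φ n)) 2
      (volume.restrict (openBall c R : Set (Euc d))) := fun n i =>
    memLp_ball_of_continuous ((hs n).classicalPartial i).continuous
  have t1 := tendsto_finsetSum Finset.univ fun i _ => tendsto_integral_mul (fun n => m1 n i)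
    (fun n => m1 n i) (h.1.memLp_weakPartial i) (h.1.memLp_weakPartial i) (l1 i) (l1 i)
  have t2 := (tendsto_integral_mul (fun n => memLp_ball_of_continuous (hs n).continuous)
    (fun n => memLp_ball_of_continuous (hs n).lap.continuous) h.1.memLp
    h.1.memLp_weakLaplacian l0 l2).neg
  have e1 : ∫ x in openBall c R, gradSq (openBall c R) u x =
      ∑ i, ∫ x in openBall c R, weakPartial (openBall c R) i u x *
        weakPartial (openBall c R) i u x := by
    unfold gradSq
    simp only [sq]
    exact integral_finsetSum _ fun i _ =>
      MemLp.integrable_mul (h.1.memLp_weakPartial i) (h.1.memLp_weakPartial i)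
  rw [e1]
  refine tendsto_nhds_unique t1 (t2.congr fun n => ?_)
  have hz : ∀ x, x ∉ (openBall c R : Set (Euc d)) → (φ n) x = 0 := fun x hx =>
    image_eq_zero_of_notMem_tsupport fun h => hx ((φ n).tsupport_subset h)
  have hz' : ∀ i x, x ∉ (openBall c R : Set (Euc d)) → classicalPartial i (φ n) x = 0 :=
    fun i x hx => image_eq_zero_of_notMem_tsupport fun h => hx ((φ n).tsupport_subset
      (tsupport_classicalPartial_subset i _ h))
  rw [setIntegral_eq_integral_of_forall_compl_eq_zero fun x hx => by rw [hz x hx, zero_mul],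
    ← integral_sum_classicalPartial_mul (hs n) (hs n) (φ n).hasCompactSupport,
    integral_finsetSum _ fun i _ => integrable_mul_of_hasCompactSupport
      ((hs n).classicalPartial i).continuous ((hs n).classicalPartial i).continuous
      (hasCompactSupport_classicalPartial (φ n).hasCompactSupport i)]
  refine Finset.sum_congr rfl fun i _ => ?_
  exact (setIntegral_eq_integral_of_forall_compl_eq_zero fun x hx => by
    rw [hz' i x hx, zero_mul]).symm

/-! ### Translation to the origin -/

theorem measurePreserving_add_ball (c : Euc d) (R : ℝ) :
    MeasurePreserving (fun x : Euc d => x + c) (ballMeasure d R)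
      (volume.restrict (openBall c R : Set (Euc d))) := by
  have h := (measurePreserving_add_right (volume : Measure (Euc d)) c).restrict_preimage
    (s := (openBall c R : Set (Euc d))) (openBall c R).isOpen.measurableSet
  have e : (fun x : Euc d => x + c) ⁻¹' (openBall c R : Set (Euc d)) = Metric.ball 0 R := by
    ext x
    simp [openBall, dist_eq_norm]
  rwa [e] at h

theorem integral_ball_translate (c : Euc d) (R : ℝ) (f : Euc d → ℝ) :
    ∫ x in openBall c R, f x = ∫ x, f (x + c) ∂(ballMeasure d R) :=
  ((measurePreserving_add_ball c R).integral_comp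
    (Homeomorph.addRight c).measurableEmbedding f).symm

theorem isTest_translate (φ : 𝓓(openBall c R, ℝ)) : IsTest R fun x => φ (x + c) := by
  have hφ : Smooth φ := φ.contDiff
  refine ⟨hφ.comp (contDiff_id.add contDiff_const),
    φ.hasCompactSupport.comp_homeomorph (Homeomorph.addRight c), ?_⟩
  have hsub : tsupport (fun x => φ (x + c)) ⊆ (fun x => x + c) ⁻¹' tsupport φ :=
    closure_minimal (fun x hx => subset_tsupport φ hx)
      ((isClosed_tsupport φ).preimage (continuous_id.add continuous_const))
  refine hsub.trans fun x hx => ?_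
  have := φ.tsupport_subset hx
  simpa [openBall, dist_eq_norm] using this

/-- The test function on the ball about `c` obtained from one about the origin. -/
def IsTest.translate {φ : Euc d → ℝ} (h : IsTest R φ) (c : Euc d) : 𝓓(openBall c R, ℝ) where
  toFun x := φ (x + -c)
  contDiff' := h.smooth.comp (contDiff_id.add contDiff_const)
  hasCompactSupport' := h.compact.comp_homeomorph (Homeomorph.addRight (-c))
  tsupport_subset' := by
    have hsub : tsupport (fun x => φ (x + -c)) ⊆ (fun x => x + -c) ⁻¹' tsupport φ :=
      closure_minimal (fun x hx => subset_tsupport φ hx)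
        ((isClosed_tsupport φ).preimage (continuous_id.add continuous_const))
    refine hsub.trans fun x hx => ?_
    have := h.supp hx
    simpa [openBall, dist_eq_norm, ← sub_eq_add_neg] using this

/-- Of the `H²` approximation only the convergence of `u` and of `Δu` is kept; the remainder of the
proof needs no other derivatives. -/
theorem ClampedPair.of_memH20 (h : MemH20 (openBall c R) u) :
    ClampedPair R (fun x => u (x + c)) (fun x => weakLaplacian (openBall c R) u (x + c)) := by
  obtain ⟨φ, hφ⟩ := exists_seq_of_memH20 h
  have hs : ∀ n, Smooth (φ n) := fun n => (φ n).contDiff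
  have l0 := tendsto_zero_of_le_h2Dist hφ fun n => eLpNorm_sub_le_h2Dist u (φ n)
  have l2 := tendsto_zero_of_le_h2Dist hφ fun n => eLpNorm_lap_sub_le_h2Dist h.1 (φ n)
  have mp := measurePreserving_add_ball c R
  refine ⟨h.1.memLp.comp_measurePreserving mp,
    h.1.memLp_weakLaplacian.comp_measurePreserving mp, fun n x => φ n (x + c),
    fun n => isTest_translate (φ n), l0.congr fun n => ?_, l2.congr fun n => ?_⟩
  · exact (eLpNorm_comp_measurePreserving (f := fun x : Euc d => x + c)
      ((memLp_ball_of_continuous (hs n).continuous).sub h.1.memLp).aestronglyMeasurable mp).symm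
  · rw [lap_comp_add]
    exact (eLpNorm_comp_measurePreserving (f := fun x : Euc d => x + c)
      ((memLp_ball_of_continuous (hs n).lap.continuous).sub
        h.1.memLp_weakLaplacian).aestronglyMeasurable mp).symm

theorem IsEigenfunction.eigenPair {Λ : ℝ} (h : IsEigenfunction (openBall c R) Λ u) :
    EigenPair R Λ (fun x => u (x + c)) (fun x => weakLaplacian (openBall c R) u (x + c)) := by
  refine ⟨ClampedPair.of_memH20 h.memH20, fun φ hφ => ?_⟩
  have e := h.weak_eq _ (memH20_testFunction (hφ.translate c))
  have hs : Smooth (hφ.translate c) := (hφ.translate c).contDiff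
  have e1 : ∫ x in openBall c R, weakLaplacian (openBall c R) u x *
      weakLaplacian (openBall c R) (hφ.translate c) x =
      ∫ x in openBall c R, weakLaplacian (openBall c R) u x * lap (hφ.translate c) x := by
    refine integral_congr_ae ?_
    filter_upwards [hs.weakLaplacian_ae_eq (openBall c R)] with x hx
    rw [hx]
  rw [e1, integral_ball_translate, integral_ball_translate] at e
  have e2 : (hφ.translate c : Euc d → ℝ) = fun x => φ (x + -c) := rfl
  rw [e2, lap_comp_add] at e
  simpa using e

/-- Green's formula is applied on the side of `v`, with `Δw` as the smooth multiplier; it is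
available because `w` is smooth beyond the closed ball. -/
theorem isEigenfunction_of_smooth {Λ : ℝ} {w : Euc d → ℝ} (hw : Smooth w)
    (hlap : ∀ x, lap (lap w) x = Λ * w x) (hmem : MemH20 (openBall c R) w)
    (hne : ¬ (∀ᵐ x ∂(volume.restrict (openBall c R : Set (Euc d))), w x = 0)) :
    IsEigenfunction (openBall c R) Λ w := by
  refine ⟨hmem, hne, fun v hv => ?_⟩
  have hpair := ClampedPair.of_memH20 hv
  have hwt : Smooth fun x => lap w (x + c) := hw.lap.comp (contDiff_id.add contDiff_const)
  have e := hpair.integral_mul_smooth hwt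
  rw [lap_comp_add] at e
  simp only [hlap] at e
  have e1 : ∫ x in openBall c R, weakLaplacian (openBall c R) w x *
      weakLaplacian (openBall c R) v x =
      ∫ x in openBall c R, weakLaplacian (openBall c R) v x * lap w x := by
    refine integral_congr_ae ?_
    filter_upwards [hw.weakLaplacian_ae_eq (openBall c R)] with x hx
    rw [hx, mul_comm]
  rw [e1, integral_ball_translate, integral_ball_translate, e, ← integral_const_mul]
  congr 1
  funext x
  ring

end Ball

/-! ### Radial functions with vanishing Cauchy data are in `H₀²` -/

theorem tendsto_eLpNorm_zero_of_bounded {α : Type*} [MeasurableSpace α] {μ : Measure α}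
    [IsFiniteMeasure μ] {f : ℕ → α → ℝ} {K : ℝ} (hm : ∀ n, AEStronglyMeasurable (f n) μ)
    (hK : ∀ n, ∀ᵐ x ∂μ, |f n x| ≤ K) (h0 : ∀ᵐ x ∂μ, ∀ᶠ n in atTop, f n x = 0) :
    Tendsto (fun n => eLpNorm (f n) 2 μ) atTop (𝓝 0) := by
  have e : ∀ n, eLpNorm (f n) 2 μ = (∫⁻ x, ‖f n x‖ₑ ^ (2 : ℝ) ∂μ) ^ (1 / 2 : ℝ) := fun n => by
    rw [eLpNorm_eq_lintegral_rpow_enorm_toReal (by norm_num) (by norm_num)]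
    norm_num
  have l : Tendsto (fun n => ∫⁻ x, ‖f n x‖ₑ ^ (2 : ℝ) ∂μ) atTop (𝓝 (∫⁻ _, 0 ∂μ)) := by
    refine tendsto_lintegral_of_dominated_convergence' (fun _ => ENNReal.ofReal K ^ (2 : ℝ))
      (fun n => (hm n).enorm.pow_const _) (fun n => ?_) ?_ ?_
    · filter_upwards [hK n] with x hx
      refine ENNReal.rpow_le_rpow ?_ (by norm_num)
      rw [← ofReal_norm]
      exact ENNReal.ofReal_le_ofReal hx
    · rw [lintegral_const]
      exact ENNReal.mul_ne_top (ENNReal.rpow_ne_top_of_nonneg (by norm_num) ENNReal.ofReal_ne_top)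
        (measure_ne_top _ _)
    · filter_upwards [h0] with x hx
      refine tendsto_const_nhds.congr' ?_
      filter_upwards [hx] with n hn
      simp [hn]
  simp only [e]
  have := l.ennrpow_const (1 / 2 : ℝ)
  simpa using this

/-! ### Cut-offs near the boundary sphere -/

section Cutoff

theorem hasDerivAt_smoothTransition (x : ℝ) :
    HasDerivAt Real.smoothTransition (deriv Real.smoothTransition x) x :=
  ((Real.smoothTransition.contDiff (n := 1)).differentiable (by norm_num) x).hasDerivAt

theorem hasDerivAt_deriv_smoothTransition (x : ℝ) :
    HasDerivAt (deriv Real.smoothTransition) (deriv (deriv Real.smoothTransition) x) x :=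
  (((Real.smoothTransition.contDiff (n := 2)).deriv' (n := 1)).differentiable
    (by norm_num) x).hasDerivAt

theorem smoothTransition_eventually {x : ℝ} (h : x < 0 ∨ 1 < x) :
    ∃ c, Real.smoothTransition =ᶠ[𝓝 x] fun _ => c := by
  rcases h with h | h
  · exact ⟨0, by filter_upwards [Iio_mem_nhds h] with y hy using
      Real.smoothTransition.zero_of_nonpos (le_of_lt hy)⟩
  · exact ⟨1, by filter_upwards [Ioi_mem_nhds h] with y hy using
      Real.smoothTransition.one_of_one_le (le_of_lt hy)⟩

theorem deriv_smoothTransition_eq_zero {x : ℝ} (h : x < 0 ∨ 1 < x) :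
    deriv Real.smoothTransition x = 0 ∧ deriv (deriv Real.smoothTransition) x = 0 := by
  obtain ⟨c, hc⟩ := smoothTransition_eventually h
  have h1 := hc.deriv
  have h2 := h1.deriv
  exact ⟨by simpa using h1.eq_of_nhds, by simpa using h2.eq_of_nhds⟩

/-- With `a = N(T - y)`, the powers of `a` absorb the factors `N` and `N²` produced by
differentiating the cut-off. Both derivatives vanish unless `1 ≤ a ≤ 2`. -/
theorem exists_bound_smoothTransition : ∃ M, ∀ a : ℝ,
    |a * deriv Real.smoothTransition (a - 1)| ≤ M ∧
      |a ^ 2 * deriv (deriv Real.smoothTransition) (a - 1)| ≤ M := by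
  have c1 : Continuous (deriv Real.smoothTransition) :=
    continuous_iff_continuousAt.2 fun x => (hasDerivAt_deriv_smoothTransition x).continuousAt
  have c2 : Continuous (deriv (deriv Real.smoothTransition)) :=
    ((Real.smoothTransition.contDiff (n := 2)).deriv' (n := 1)).continuous_deriv (by norm_num)
  obtain ⟨M1, h1⟩ := (isCompact_Icc (a := (1 : ℝ)) (b := 2)).exists_bound_of_continuousOn
    (f := fun a => a * deriv Real.smoothTransition (a - 1)) (by fun_prop)
  obtain ⟨M2, h2⟩ := (isCompact_Icc (a := (1 : ℝ)) (b := 2)).exists_bound_of_continuousOn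
    (f := fun a => a ^ 2 * deriv (deriv Real.smoothTransition) (a - 1)) (by fun_prop)
  have p1 : 0 ≤ M1 := (norm_nonneg _).trans (h1 1 (by norm_num))
  have p2 : 0 ≤ M2 := (norm_nonneg _).trans (h2 1 (by norm_num))
  refine ⟨max M1 M2, fun a => ?_⟩
  by_cases ha : a ∈ Icc (1 : ℝ) 2
  · exact ⟨(h1 a ha).trans (le_max_left _ _), (h2 a ha).trans (le_max_right _ _)⟩
  · have : a - 1 < 0 ∨ 1 < a - 1 := by
      by_contra! h
      exact ha ⟨by linarith, by linarith⟩
    obtain ⟨e1, e2⟩ := deriv_smoothTransition_eq_zero this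
    rw [e1, e2]
    simp [p1]

/-- Cut-off of a function with a double zero at `T`, with uniformly bounded second derivatives. -/
theorem exists_cutoff {W W1 W2 : ℝ → ℝ} {T : ℝ} (hT : 0 < T) (hW : ContDiff ℝ (⊤ : ℕ∞) W)
    (h1 : ∀ y, HasDerivAt W (W1 y) y) (h2 : ∀ y, HasDerivAt W1 (W2 y) y) (hc : Continuous W2)
    (hWT : W T = 0) (hW1T : W1 T = 0) :
    ∃ (Φ Φ1 Φ2 : ℕ → ℝ → ℝ) (K : ℝ), (∀ n, ContDiff ℝ (⊤ : ℕ∞) (Φ n)) ∧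
      (∀ n y, HasDerivAt (Φ n) (Φ1 n y) y) ∧ (∀ n y, HasDerivAt (Φ1 n) (Φ2 n y) y) ∧
      (∀ n, ∃ T' < T, ∀ y, T' ≤ y → Φ n y = 0) ∧
      (∀ n, ∀ y ∈ Icc 0 T, |W y - Φ n y| ≤ K ∧ |W1 y - Φ1 n y| ≤ K ∧ |W2 y - Φ2 n y| ≤ K) ∧
      ∀ y < T, ∀ᶠ n in atTop, W y - Φ n y = 0 ∧ W1 y - Φ1 n y = 0 ∧ W2 y - Φ2 n y = 0 := by
  obtain ⟨M, hM⟩ := exists_bound_smoothTransition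
  obtain ⟨C, hC⟩ := (isCompact_Icc (a := (0 : ℝ)) (b := T)).exists_bound_of_continuousOn
    hc.continuousOn
  have hM0 : 0 ≤ M := (abs_nonneg _).trans (hM 0).1
  have hC0 : 0 ≤ C := (norm_nonneg _).trans (hC 0 ⟨le_rfl, hT.le⟩)
  -- The double zero at `T` gives `|W1| ≤ C(T - y)` and `|W| ≤ C(T - y)²`, exactly the decay needed
  -- against `N` and `N²`.
  have b1 : ∀ y ∈ Icc 0 T, |W1 y| ≤ C * (T - y) := fun y hy => by
    have := (convex_Icc (0 : ℝ) T).norm_image_sub_le_of_norm_hasDerivWithin_le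
      (fun x _ => (h2 x).hasDerivWithinAt) hC hy (right_mem_Icc.2 hT.le)
    rw [hW1T, zero_sub, norm_neg, Real.norm_eq_abs, Real.norm_eq_abs,
      abs_of_nonneg (sub_nonneg.2 hy.2)] at this
    exact this
  have b0 : ∀ y ∈ Icc 0 T, |W y| ≤ C * (T - y) ^ 2 := fun y hy => by
    have := (convex_Icc y T).norm_image_sub_le_of_norm_hasDerivWithin_le (C := C * (T - y))
      (fun x _ => (h1 x).hasDerivWithinAt) (fun x hx => (b1 x ⟨hy.1.trans hx.1, hx.2⟩).trans
        (mul_le_mul_of_nonneg_left (by linarith [hx.1]) hC0)) (left_mem_Icc.2 hy.2)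
        (right_mem_Icc.2 hy.2)
    rw [hWT, zero_sub, norm_neg, Real.norm_eq_abs, Real.norm_eq_abs,
      abs_of_nonneg (sub_nonneg.2 hy.2)] at this
    linarith
  set χ := Real.smoothTransition
  set N : ℕ → ℝ := fun n => (n : ℝ) + 1 with hN
  have hNp : ∀ n, 0 < N n := fun n => by positivity
  -- This is `0` when `T - y ≤ 1/N` and `1` when `T - y ≥ 2/N`.
  set ψ : ℕ → ℝ → ℝ := fun n y => χ (N n * (T - y) - 1) with hψ
  set ψ1 : ℕ → ℝ → ℝ := fun n y => -N n * deriv χ (N n * (T - y) - 1) with hψ1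
  set ψ2 : ℕ → ℝ → ℝ := fun n y => N n ^ 2 * deriv (deriv χ) (N n * (T - y) - 1) with hψ2
  have hin : ∀ n y, HasDerivAt (fun y => N n * (T - y) - 1) (-N n) y := fun n y => by
    simpa using (((hasDerivAt_id y).const_sub T).const_mul (N n)).sub_const 1
  have d1 : ∀ n y, HasDerivAt (ψ n) (ψ1 n y) y := fun n y =>
    (HasDerivAt.comp y (hasDerivAt_smoothTransition _) (hin n y)).congr_deriv (mul_comm _ _)
  have d2 : ∀ n y, HasDerivAt (ψ1 n) (ψ2 n y) y := fun n y =>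
    ((HasDerivAt.comp y (hasDerivAt_deriv_smoothTransition _) (hin n y)).const_mul
      (-N n)).congr_deriv (by simp only [hψ2]; ring)
  have q0 : ∀ n y, 0 ≤ ψ n y ∧ ψ n y ≤ 1 := fun n y =>
    ⟨Real.smoothTransition.nonneg _, Real.smoothTransition.le_one _⟩
  refine ⟨fun n y => W y * ψ n y, fun n y => W1 y * ψ n y + W y * ψ1 n y,
    fun n y => (W2 y * ψ n y + W1 y * ψ1 n y) + (W1 y * ψ1 n y + W y * ψ2 n y),
    C * T ^ 2 + (C * T + C * T * M) + (C + 2 * (C * M) + C * M), fun n => ?_,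
    fun n y => (h1 y).mul (d1 n y),
    fun n y => ((h2 y).mul (d1 n y)).add ((h1 y).mul (d2 n y)), fun n => ?_, fun n y hy => ?_,
    fun y hy => ?_⟩
  · exact hW.mul (Real.smoothTransition.contDiff.comp (by fun_prop))
  · refine ⟨T - 1 / N n, by have := one_div_pos.2 (hNp n); linarith, fun y hy => ?_⟩
    have : N n * (T - y) - 1 ≤ 0 := by
      have h3 : T - y ≤ 1 / N n := by linarith
      have h4 := mul_le_mul_of_nonneg_left h3 (hNp n).le
      rw [mul_one_div_cancel (hNp n).ne'] at h4
      linarith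
    simp only [hψ, χ, Real.smoothTransition.zero_of_nonpos this, mul_zero]
  · obtain ⟨m1, m2⟩ := hM (N n * (T - y))
    have hy0 : 0 ≤ T - y := sub_nonneg.2 hy.2
    have hyT : T - y ≤ T := by linarith [hy.1]
    have c0 := b0 y hy
    have c1 := b1 y hy
    have c2 : |W2 y| ≤ C := hC y hy
    have w1 : C * (T - y) ≤ C * T := mul_le_mul_of_nonneg_left hyT hC0
    have w0 : C * (T - y) ^ 2 ≤ C * T ^ 2 :=
      mul_le_mul_of_nonneg_left (pow_le_pow_left₀ hy0 hyT 2) hC0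
    have one : |1 - ψ n y| ≤ 1 := by
      rw [abs_le]; constructor <;> linarith [(q0 n y).1, (q0 n y).2]
    have mulone : ∀ {a A : ℝ}, |a| ≤ A → |a - a * ψ n y| ≤ A := fun {a A} h => by
      rw [show a - a * ψ n y = a * (1 - ψ n y) by ring, abs_mul]
      exact (mul_le_of_le_one_right (abs_nonneg _) one).trans h
    have p01 : |W y * ψ1 n y| ≤ C * T * M := by
      have e : |W y * ψ1 n y| = |W y| * |N n * deriv χ (N n * (T - y) - 1)| := by
        rw [abs_mul]; simp only [hψ1]; rw [neg_mul, abs_neg]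
      rw [e]
      calc _ ≤ C * (T - y) ^ 2 * |N n * deriv χ (N n * (T - y) - 1)| := by gcongr
        _ = C * (T - y) * |N n * (T - y) * deriv χ (N n * (T - y) - 1)| := by
          simp only [abs_mul, abs_of_nonneg hy0]; ring
        _ ≤ C * T * M := by gcongr
    have p11 : |W1 y * ψ1 n y| ≤ C * M := by
      have e : |W1 y * ψ1 n y| = |W1 y| * |N n * deriv χ (N n * (T - y) - 1)| := by
        rw [abs_mul]; simp only [hψ1]; rw [neg_mul, abs_neg]
      rw [e]
      calc _ ≤ C * (T - y) * |N n * deriv χ (N n * (T - y) - 1)| := by gcongr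
        _ = C * |N n * (T - y) * deriv χ (N n * (T - y) - 1)| := by
          simp only [abs_mul, abs_of_nonneg hy0]; ring
        _ ≤ C * M := by gcongr
    have p02 : |W y * ψ2 n y| ≤ C * M := by
      rw [abs_mul]
      calc _ ≤ C * (T - y) ^ 2 * |N n ^ 2 * deriv (deriv χ) (N n * (T - y) - 1)| := by gcongr
        _ = C * |(N n * (T - y)) ^ 2 * deriv (deriv χ) (N n * (T - y) - 1)| := by
          simp only [abs_mul, abs_pow, abs_of_nonneg hy0]; ring
        _ ≤ C * M := by gcongr
    have r0 := mulone (c0.trans w0)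
    have r1 := mulone (c1.trans w1)
    have r2 := mulone c2
    have s0 : 0 ≤ C * T ^ 2 := by positivity
    have s1 : 0 ≤ C * T := by positivity
    have s2 : 0 ≤ C * T * M := by positivity
    have s3 : 0 ≤ C * M := by positivity
    rw [abs_le] at r0 r1 r2 p01 p11 p02
    simp only [abs_le]
    refine ⟨⟨?_, ?_⟩, ⟨?_, ?_⟩, ?_, ?_⟩ <;>
      linarith [r0.1, r0.2, r1.1, r1.2, r2.1, r2.2, p01.1, p01.2, p11.1, p11.2, p02.1, p02.2]
  · have hy0 : 0 < T - y := sub_pos.2 hy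
    obtain ⟨m, hm⟩ := exists_nat_gt (2 / (T - y))
    filter_upwards [eventually_ge_atTop m] with n hn
    have hlt : 1 < N n * (T - y) - 1 := by
      have h3 : 2 / (T - y) < N n := hm.trans_le (by
        have : (m : ℝ) ≤ n := by exact_mod_cast hn
        simp only [hN]; linarith)
      rw [div_lt_iff₀ hy0] at h3
      linarith
    obtain ⟨e1, e2⟩ := deriv_smoothTransition_eq_zero (Or.inr hlt)
    have e0 : χ (N n * (T - y) - 1) = 1 := Real.smoothTransition.one_of_one_le hlt.le
    simp only [hψ, hψ1, hψ2, e0, χ, e1, e2]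
    refine ⟨?_, ?_, ?_⟩ <;> ring

end Cutoff

/-- The cut-off functions differ from `W` only in a shrinking shell, with uniformly bounded
derivatives up to order two. Dominated convergence makes the `H²` distance tend to zero, so no trace
theorem is needed. -/
theorem memH20_radial {d : ℕ} {W W1 W2 : ℝ → ℝ} {R : ℝ} (c : Euc d) (hR : 0 < R)
    (hW : ContDiff ℝ (⊤ : ℕ∞) W) (h1 : ∀ y, HasDerivAt W (W1 y) y)
    (h2 : ∀ y, HasDerivAt W1 (W2 y) y) (hc : Continuous W2)
    (hWT : W (R ^ 2) = 0) (hW1T : W1 (R ^ 2) = 0) :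
    MemH20 (openBall c R) fun x => W (‖x - c‖ ^ 2) := by
  have hs : Smooth fun x : Euc d => W (‖x - c‖ ^ 2) := smooth_radial c hW
  refine ⟨hs.memH2 c R, ?_⟩
  obtain ⟨Φ, Φ1, Φ2, K, cΦ, d1, d2, hsupp, hK, hev⟩ :=
    exists_cutoff (by positivity : 0 < R ^ 2) hW h1 h2 hc hWT hW1T
  have htest : ∀ n, IsTest R fun x : Euc d => Φ n (‖x - 0‖ ^ 2) := fun n => by
    obtain ⟨T', hT', hz⟩ := hsupp n
    exact isTest_radial (cΦ n) ((Real.sqrt_lt' hR).2 hT') fun r hr =>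
      hz _ (Real.sqrt_le_iff.1 hr).2
  set φ : ℕ → 𝓓(openBall c R, ℝ) := fun n => (htest n).translate c with hφ
  have eφ : ∀ n, (φ n : Euc d → ℝ) = fun x => Φ n (‖x - c‖ ^ 2) := fun n => by
    funext x
    change Φ n (‖x + -c - 0‖ ^ 2) = _
    rw [sub_zero, ← sub_eq_add_neg]
  set μ := volume.restrict (openBall c R : Set (Euc d)) with hμ
  have : IsFiniteMeasure μ := ⟨by simpa [hμ, openBall] using measure_ball_lt_top⟩
  have hmem : ∀ᵐ x ∂μ, ‖x - c‖ < R := by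
    filter_upwards [ae_restrict_mem (openBall c R).isOpen.measurableSet] with x hx
    simpa [openBall, dist_eq_norm] using hx
  have hsq : ∀ {x : Euc d}, ‖x - c‖ < R → ‖x - c‖ ^ 2 < R ^ 2 := fun h =>
    pow_lt_pow_left₀ h (norm_nonneg _) two_ne_zero
  have hcoord : ∀ {x : Euc d} (i), ‖x - c‖ < R → |x i - c i| ≤ R := fun {x} i h =>
    (PiLp.norm_apply_le (x - c) i).trans h.le
  have hK0 : 0 ≤ K := (abs_nonneg _).trans (hK 0 0 ⟨le_rfl, by positivity⟩).1
  have cΦ' : ∀ n, Smooth (φ n) := fun n => (φ n).contDiff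
  have t0 : Tendsto (fun n => eLpNorm (fun x => W (‖x - c‖ ^ 2) - φ n x) 2 μ) atTop (𝓝 0) := by
    refine tendsto_eLpNorm_zero_of_bounded (K := K)
      (fun n => (hs.continuous.sub (cΦ' n).continuous).aestronglyMeasurable) (fun n => ?_) ?_
    · filter_upwards [hmem] with x hx
      rw [eφ]
      exact (hK n _ ⟨by positivity, (hsq hx).le⟩).1
    · filter_upwards [hmem] with x hx
      filter_upwards [hev _ (hsq hx)] with n hn
      rw [eφ]
      exact hn.1
  have t1 : ∀ i, Tendsto (fun n => eLpNorm (fun x =>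
      classicalPartial i (fun x => W (‖x - c‖ ^ 2)) x - classicalPartial i (φ n) x) 2 μ)
      atTop (𝓝 0) := fun i => by
    have e : ∀ n x, classicalPartial i (fun x => W (‖x - c‖ ^ 2)) x - classicalPartial i (φ n) x =
        (x i - c i) * (2 * (W1 (‖x - c‖ ^ 2) - Φ1 n (‖x - c‖ ^ 2))) := fun n x => by
      rw [eφ, classicalPartial_radial c h1, classicalPartial_radial c (d1 n)]
      ring
    refine tendsto_eLpNorm_zero_of_bounded (K := R * (2 * K))
      (fun n => ((hs.classicalPartial i).continuous.sub
        ((cΦ' n).classicalPartial i).continuous).aestronglyMeasurable) (fun n => ?_) ?_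
    · filter_upwards [hmem] with x hx
      rw [e, abs_mul, abs_mul, abs_two]
      have := (hK n _ ⟨by positivity, (hsq hx).le⟩).2.1
      have := hcoord i hx
      gcongr
    · filter_upwards [hmem] with x hx
      filter_upwards [hev _ (hsq hx)] with n hn
      rw [e, hn.2.1]
      ring
  have t2 : ∀ i j, Tendsto (fun n => eLpNorm (fun x =>
      classicalPartial j (classicalPartial i (fun x => W (‖x - c‖ ^ 2))) x -
        classicalPartial j (classicalPartial i (φ n)) x) 2 μ)
      atTop (𝓝 0) := fun i j => by
    have e : ∀ n x, classicalPartial j (classicalPartial i (fun x => W (‖x - c‖ ^ 2))) x -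
        classicalPartial j (classicalPartial i (φ n)) x =
        (if i = j then 2 else 0) * (W1 (‖x - c‖ ^ 2) - Φ1 n (‖x - c‖ ^ 2)) +
        4 * (x i - c i) * (x j - c j) * (W2 (‖x - c‖ ^ 2) - Φ2 n (‖x - c‖ ^ 2)) := fun n x => by
      rw [eφ, classicalPartial_classicalPartial_radial c h1 h2,
        classicalPartial_classicalPartial_radial c (d1 n) (d2 n)]
      by_cases hij : i = j
      · simp only [hij, if_true]; ring
      · simp only [hij, if_false]; ring
    refine tendsto_eLpNorm_zero_of_bounded (K := 2 * K + 4 * R * R * K)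
      (fun n => (((hs.classicalPartial i).classicalPartial j).continuous.sub
        (((cΦ' n).classicalPartial i).classicalPartial j).continuous).aestronglyMeasurable)
        (fun n => ?_) ?_
    · filter_upwards [hmem] with x hx
      rw [e]
      refine (abs_add_le _ _).trans ?_
      simp only [abs_mul]
      have k := (hK n _ ⟨by positivity, (hsq hx).le⟩).2
      have := k.1
      have := k.2
      have := hcoord i hx
      have := hcoord j hx
      have i2 : |(if i = j then (2 : ℝ) else 0)| ≤ 2 := by split_ifs <;> simp
      rw [show |(4 : ℝ)| = 4 by norm_num]
      gcongr
    · filter_upwards [hmem] with x hx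
      filter_upwards [hev _ (hsq hx)] with n hn
      rw [e, hn.2.1, hn.2.2]
      ring
  have t : Tendsto (fun n => h2Dist (openBall c R) (fun x => W (‖x - c‖ ^ 2)) (φ n)) atTop
      (𝓝 0) := by
    simp only [hs.h2Dist_eq]
    have := (t0.add (tendsto_finsetSum Finset.univ fun i _ => t1 i)).add
      (tendsto_finsetSum Finset.univ fun i _ => tendsto_finsetSum Finset.univ fun j _ => t2 i j)
    simpa using this
  intro ε hε
  obtain ⟨n, hn⟩ := (t.eventually (gt_mem_nhds hε)).exists
  exact ⟨φ n, hn⟩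

/-! ### Lommel's integrals -/

/-- Hypothesis `e` is the statement that `rᵈ H(sr²/4)/2` is an antiderivative, rewritten in `z =
sr²/4`; each Lommel integral then reduces to one algebraic identity. -/
theorem integral_pow_mul_comp_sq {d : ℕ} (hd : 1 ≤ d) {R : ℝ} (hR : 0 ≤ R) {H H' K : ℝ → ℝ}
    (hH : ∀ z, HasDerivAt H (H' z) z) (hK : Continuous K)
    (e : ∀ z, (d : ℝ) * H z + 2 * z * H' z = 2 * K z) (s : ℝ) :
    ∫ r in Ioo 0 R, r ^ (d - 1) * K (s * r ^ 2 / 4) = R ^ d * H (s * R ^ 2 / 4) / 2 := by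
  have hder : ∀ r, HasDerivAt (fun r => r ^ d * H (s * r ^ 2 / 4) / 2)
      (r ^ (d - 1) * K (s * r ^ 2 / 4)) r := fun r => by
    have hz : HasDerivAt (fun r : ℝ => s * r ^ 2 / 4) (s * (2 * r) / 4) r := by
      simpa using ((hasDerivAt_pow 2 r).const_mul s).div_const 4
    refine (((hasDerivAt_pow d r).mul (HasDerivAt.comp r (hH _) hz)).div_const 2).congr_deriv ?_
    have e1 := e (s * r ^ 2 / 4)
    have e2 : r ^ d = r ^ (d - 1) * r := by rw [← pow_succ, Nat.sub_add_cancel hd]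
    simp only [Function.comp_apply]
    rw [e2]
    linear_combination (r ^ (d - 1) / 2) * e1
  have hc : Continuous fun r : ℝ => r ^ (d - 1) * K (s * r ^ 2 / 4) := by fun_prop
  rw [← integral_Ioc_eq_integral_Ioo, ← intervalIntegral.integral_of_le hR,
    intervalIntegral.integral_eq_sub_of_hasDerivAt (fun r _ => hder r)
      (hc.intervalIntegrable 0 R)]
  rw [zero_pow (by omega)]
  ring

section Integrals

variable {d : ℕ} [Nontrivial (Euc d)] {R : ℝ}

/-- By `bes_pred` the function `H` equals `bes ν ^ 2 - bes (ν-1) * bes (ν+1)`, Lommel's classical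
antiderivative. It is the source of the product `J_{ν+1} J_{ν-1}` in the final formula. -/
theorem integral_radialSol_mul_self (hR : 0 ≤ R) (s : ℝ) :
    ∫ x, radialSol s 0 x * radialSol s 0 x ∂(ballMeasure d R) =
      sphereArea d * R ^ d / 2 * (bes ((d : ℝ) / 2 - 1) (s * R ^ 2 / 4) ^ 2 -
        s * R ^ 2 / 4 * bes ((d : ℝ) / 2 - 1 + 1) (s * R ^ 2 / 4) ^ 2 -
        ((d : ℝ) / 2 - 1) * bes ((d : ℝ) / 2 - 1) (s * R ^ 2 / 4) *
          bes ((d : ℝ) / 2 - 1 + 1) (s * R ^ 2 / 4)) := by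
  set ν := (d : ℝ) / 2 - 1 with hν
  have hd : (d : ℝ) = 2 * ν + 2 := by rw [hν]; ring
  have hb := continuous_bes ν
  have e := integral_ballMeasure_radial (d := d) (R := R)
    fun r => bes ν (s * r ^ 2 / 4) * bes ν (s * r ^ 2 / 4)
  have e' := integral_pow_mul_comp_sq (one_le_dim (d := d)) hR
    (H := fun z => bes ν z ^ 2 - z * bes (ν + 1) z ^ 2 - ν * bes ν z * bes (ν + 1) z)
    (K := fun z => bes ν z * bes ν z)
    (fun z => ((((hasDerivAt_bes ν z).pow 2).sub ((hasDerivAt_id z).mul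
      ((hasDerivAt_bes (ν + 1) z).pow 2))).sub (((hasDerivAt_bes ν z).const_mul ν).mul
      (hasDerivAt_bes (ν + 1) z)))) (by fun_prop) (fun z => by
        have r := bes_recurrence ν z
        rw [show ν + 2 = ν + 1 + 1 by ring] at r
        simp only [hd, id]
        norm_num
        linear_combination (-4 * z * bes (ν + 1) z - 2 * ν * bes ν z) * r) s
  rw [e'] at e
  simp only [radialSol, sub_zero, ← hν]
  rw [e]
  ring

/-- The integral is a boundary Wronskian. It is positive below the frequency, which excludes lower
eigenvalues, and zero at the frequency, which makes the two solutions orthogonal. -/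
theorem integral_radialSol_mul_neg (hR : 0 ≤ R) (s : ℝ) :
    ∫ x, radialSol s 0 x * radialSol (-s) 0 x ∂(ballMeasure d R) =
      sphereArea d * R ^ d / 4 * besWronskian ((d : ℝ) / 2 - 1) (s * R ^ 2 / 4) := by
  set ν := (d : ℝ) / 2 - 1 with hν
  have hd : (d : ℝ) = 2 * ν + 2 := by rw [hν]; ring
  have hb := continuous_bes ν
  have e := integral_ballMeasure_radial (d := d) (R := R)
    fun r => bes ν (s * r ^ 2 / 4) * bes ν (-(s * r ^ 2 / 4))
  have e' := integral_pow_mul_comp_sq (one_le_dim (d := d)) hR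
    (H := fun z => 1 / 2 * besWronskian ν z) (K := fun z => bes ν z * bes ν (-z))
    (fun z => (hasDerivAt_besWronskian ν z).const_mul (1 / 2)) (by fun_prop) (fun z => by
        have r := bes_recurrence ν z
        have r' := bes_recurrence ν (-z)
        simp only [hd, besWronskian]
        linear_combination bes ν (-z) * r + bes ν z * r') s
  rw [e'] at e
  simp only [radialSol, sub_zero, ← hν, neg_mul, neg_div]
  rw [e]
  ring

end Integrals

/-! ### The radial ground state -/

section GroundState

variable {d : ℕ} {R : ℝ}

/-- The frequency `γ_ν² / R²`, where `ν = d / 2 - 1`. -/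
def frequency (d : ℕ) (R : ℝ) : ℝ := firstZero ((d : ℝ) / 2 - 1) ^ 2 / R ^ 2

/-- The argument `γ_ν² / 4`, where `ν = d / 2 - 1`. -/
def groundArg (d : ℕ) : ℝ := firstZero ((d : ℝ) / 2 - 1) ^ 2 / 4

/-- The radial eigenfunction of the clamped ball for the eigenvalue `γ_ν⁴ / R⁴`. -/
def groundState (R : ℝ) (c x : Euc d) : ℝ :=
  (bes ((d : ℝ) / 2 - 1) (-groundArg d))⁻¹ * radialSol (-frequency d R) c x +
    -(bes ((d : ℝ) / 2 - 1) (groundArg d))⁻¹ * radialSol (frequency d R) c x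

theorem frequency_mul (hR : 0 < R) : frequency d R * R ^ 2 / 4 = groundArg d := by
  unfold frequency groundArg
  field_simp

theorem smooth_groundState (R : ℝ) (c : Euc d) : Smooth (groundState R c) :=
  (contDiff_const.mul (smooth_radialSol _ c)).add (contDiff_const.mul (smooth_radialSol _ c))

theorem lap_groundState (R : ℝ) (c : Euc d) : lap (groundState R c) = fun x =>
    (bes ((d : ℝ) / 2 - 1) (-groundArg d))⁻¹ * (-frequency d R * radialSol (-frequency d R) c x) +
    -(bes ((d : ℝ) / 2 - 1) (groundArg d))⁻¹ * (frequency d R * radialSol (frequency d R) c x) := by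
  have e : groundState R c = fun x => (bes ((d : ℝ) / 2 - 1) (-groundArg d))⁻¹ *
    radialSol (-frequency d R) c x +
    -(bes ((d : ℝ) / 2 - 1) (groundArg d))⁻¹ * radialSol (frequency d R) c x := rfl
  rw [e, lap_add (contDiff_const.mul (smooth_radialSol _ c))
    (contDiff_const.mul (smooth_radialSol _ c)), lap_const_mul (smooth_radialSol _ c),
    lap_const_mul (smooth_radialSol _ c), lap_radialSol, lap_radialSol]

theorem lap_lap_groundState (R : ℝ) (c x : Euc d) :
    lap (lap (groundState R c)) x = frequency d R ^ 2 * groundState R c x := by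
  have hs := fun s => smooth_radialSol s c
  rw [lap_groundState, lap_add (contDiff_const.mul (contDiff_const.mul (hs _)))
    (contDiff_const.mul (contDiff_const.mul (hs _))),
    lap_const_mul (contDiff_const.mul (hs _)), lap_const_mul (contDiff_const.mul (hs _)),
    lap_const_mul (hs _), lap_const_mul (hs _), lap_radialSol, lap_radialSol, groundState]
  ring

variable [Nontrivial (Euc d)]

theorem neg_one_lt_order : -1 < (d : ℝ) / 2 - 1 := by
  have : (1 : ℝ) ≤ d := by exact_mod_cast one_le_dim
  linarith

theorem groundArg_pos : 0 < groundArg d := by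
  have := (firstZero_spec (neg_one_lt_order (d := d))).2.1
  unfold groundArg
  positivity

theorem frequency_pos (hR : 0 < R) : 0 < frequency d R := by
  have := (firstZero_spec (neg_one_lt_order (d := d))).2.1
  unfold frequency
  positivity

theorem bes_neg_groundArg_neg : bes ((d : ℝ) / 2 - 1) (-groundArg d) < 0 :=
  (firstZero_spec neg_one_lt_order).2.2.2.2.1

theorem bes_groundArg_pos : 0 < bes ((d : ℝ) / 2 - 1) (groundArg d) :=
  bes_pos neg_one_lt_order groundArg_pos.le

theorem besWronskian_groundArg : besWronskian ((d : ℝ) / 2 - 1) (groundArg d) = 0 :=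
  (firstZero_spec neg_one_lt_order).2.2.1

/-- The coefficients make the boundary value `1 - 1`; the vanishing of the radial derivative is the
equation `besWronskian = 0`. -/
theorem memH20_const_mul_groundState (hR : 0 < R) (c : Euc d) (a : ℝ) :
    MemH20 (openBall c R) fun x => a * groundState R c x := by
  have j := (bes_neg_groundArg_neg (d := d)).ne
  have i := (bes_groundArg_pos (d := d)).ne'
  have w := besWronskian_groundArg (d := d)
  have hf := frequency_mul (d := d) hR
  have hf' : -frequency d R * R ^ 2 / 4 = -groundArg d := by rw [← hf]; ring
  unfold besWronskian at w
  set ν := (d : ℝ) / 2 - 1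
  have h1 := hasDerivAt_bes_scaled ν
  have h2 := hasDerivAt_bes_scaled (ν + 1)
  have hc := continuous_bes (ν + 1 + 1)
  refine memH20_radial c hR (W := fun y => a * ((bes ν (-groundArg d))⁻¹ *
      bes ν (-frequency d R * y / 4) + -(bes ν (groundArg d))⁻¹ * bes ν (frequency d R * y / 4)))
    (contDiff_const.mul ((contDiff_const.mul (contDiff_bes_scaled _ _)).add
      (contDiff_const.mul (contDiff_bes_scaled _ _))))
    (fun y => (((h1 _ y).const_mul _).add ((h1 _ y).const_mul _)).const_mul a)
    (fun y => ((((h2 _ y).const_mul _).const_mul _).add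
      (((h2 _ y).const_mul _).const_mul _)).const_mul a)
    (by fun_prop) ?_ ?_
  · rw [hf, hf']
    field_simp
    ring
  · rw [hf, hf']
    field_simp
    linear_combination (-frequency d R * a) * w

/-- The ratio `I_{ν+1}/I_ν = -J_{ν+1}/J_ν` at `γ_ν`, up to a factor. -/
def groundRatio (d : ℕ) : ℝ :=
  bes ((d : ℝ) / 2 - 1 + 1) (groundArg d) / bes ((d : ℝ) / 2 - 1) (groundArg d)

theorem bes_succ_groundArg : bes ((d : ℝ) / 2 - 1 + 1) (groundArg d) =
    groundRatio d * bes ((d : ℝ) / 2 - 1) (groundArg d) := by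
  rw [groundRatio, div_mul_cancel₀ _ bes_groundArg_pos.ne']

theorem bes_succ_neg_groundArg : bes ((d : ℝ) / 2 - 1 + 1) (-groundArg d) =
    -groundRatio d * bes ((d : ℝ) / 2 - 1) (-groundArg d) := by
  have w := besWronskian_groundArg (d := d)
  have i := (bes_groundArg_pos (d := d)).ne'
  unfold besWronskian at w
  rw [groundRatio]
  generalize (d : ℝ) / 2 - 1 = ν at *
  field_simp
  linear_combination w

/-! ### Integrals of the ground state -/

theorem integral_radialSol_frequency (hR : 0 < R) :
    ∫ x, radialSol (frequency d R) 0 x * radialSol (frequency d R) 0 x ∂(ballMeasure d R) =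
      sphereArea d * R ^ d / 2 * bes ((d : ℝ) / 2 - 1) (groundArg d) ^ 2 *
        (1 - groundRatio d * ((d : ℝ) / 2 - 1 + groundArg d * groundRatio d)) := by
  rw [integral_radialSol_mul_self hR.le, frequency_mul hR, bes_succ_groundArg]
  ring

theorem integral_radialSol_neg_frequency (hR : 0 < R) :
    ∫ x, radialSol (-frequency d R) 0 x * radialSol (-frequency d R) 0 x ∂(ballMeasure d R) =
      sphereArea d * R ^ d / 2 * bes ((d : ℝ) / 2 - 1) (-groundArg d) ^ 2 *
        (1 + groundRatio d * ((d : ℝ) / 2 - 1 + groundArg d * groundRatio d)) := by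
  rw [integral_radialSol_mul_self hR.le, neg_mul, neg_div, frequency_mul hR,
    bes_succ_neg_groundArg]
  ring

theorem integral_radialSol_frequency_mul_neg (hR : 0 < R) :
    ∫ x, radialSol (frequency d R) 0 x * radialSol (-frequency d R) 0 x ∂(ballMeasure d R) = 0 := by
  rw [integral_radialSol_mul_neg hR.le, frequency_mul hR, besWronskian_groundArg, mul_zero]

theorem integral_combination_mul_combination (hR : 0 < R) (a b a' b' : ℝ) :
    ∫ x, (a * radialSol (-frequency d R) 0 x + b * radialSol (frequency d R) 0 x) *
        (a' * radialSol (-frequency d R) 0 x + b' * radialSol (frequency d R) 0 x)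
        ∂(ballMeasure d R) =
      a * a' * ∫ x, radialSol (-frequency d R) 0 x * radialSol (-frequency d R) 0 x
        ∂(ballMeasure d R) +
      b * b' * ∫ x, radialSol (frequency d R) 0 x * radialSol (frequency d R) 0 x
        ∂(ballMeasure d R) := by
  have m := fun s => (smooth_radialSol s (0 : Euc d)).memLp (R := R)
  have e : ∀ x : Euc d, (a * radialSol (-frequency d R) 0 x + b * radialSol (frequency d R) 0 x) *
      (a' * radialSol (-frequency d R) 0 x + b' * radialSol (frequency d R) 0 x) =
      a * a' * (radialSol (-frequency d R) 0 x * radialSol (-frequency d R) 0 x) +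
      b * b' * (radialSol (frequency d R) 0 x * radialSol (frequency d R) 0 x) +
      (a * b' + b * a') * (radialSol (frequency d R) 0 x * radialSol (-frequency d R) 0 x) :=
    fun x => by ring
  have i := fun k s s' => (integrable_mul_ball (m s) (m s')).const_mul k
  have i2 := (i (a * a') (-frequency d R) (-frequency d R)).add
    (i (b * b') (frequency d R) (frequency d R))
  simp only [e]
  rw [integral_add (f := fun x : Euc d =>
      a * a' * (radialSol (-frequency d R) 0 x * radialSol (-frequency d R) 0 x) +
      b * b' * (radialSol (frequency d R) 0 x * radialSol (frequency d R) 0 x)) i2 (i _ _ _),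
    integral_add (i _ _ _) (i _ _ _), integral_const_mul,
    integral_const_mul, integral_const_mul, integral_radialSol_frequency_mul_neg hR, mul_zero,
    add_zero]

/-- With `X = ρ(ν + zρ)`, where `ρ` is `groundRatio d` and `z` is `groundArg d`, the two components
contribute `(1 + X)/2` and `(1 - X)/2`, so `X` cancels. -/
theorem integral_groundState_sq (hR : 0 < R) :
    ∫ x, groundState R 0 x * groundState R 0 x ∂(ballMeasure d R) = sphereArea d * R ^ d := by
  have j := (bes_neg_groundArg_neg (d := d)).ne
  have i := (bes_groundArg_pos (d := d)).ne'
  unfold groundState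
  rw [integral_combination_mul_combination hR, integral_radialSol_frequency hR,
    integral_radialSol_neg_frequency hR]
  generalize (d : ℝ) / 2 - 1 = ν at *
  field_simp
  ring

/-- The Laplacian changes the sign of one component relative to the other, so now the constants
cancel and the `X` terms add. -/
theorem integral_groundState_mul_lap (hR : 0 < R) :
    ∫ x, groundState R 0 x * lap (groundState R 0) x ∂(ballMeasure d R) =
      -(sphereArea d * R ^ d * (frequency d R *
        (groundRatio d * ((d : ℝ) / 2 - 1 + groundArg d * groundRatio d)))) := by
  have j := (bes_neg_groundArg_neg (d := d)).ne
  have i := (bes_groundArg_pos (d := d)).ne'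
  rw [lap_groundState]
  unfold groundState
  simp only [← mul_assoc]
  rw [integral_combination_mul_combination hR, integral_radialSol_frequency hR,
    integral_radialSol_neg_frequency hR]
  generalize (d : ℝ) / 2 - 1 = ν at *
  field_simp
  ring

theorem integral_ball_const_mul_groundState_sq (hR : 0 < R) (c : Euc d) (a : ℝ) :
    ∫ x in openBall c R, (a * groundState R c x) ^ 2 = a ^ 2 * (sphereArea d * R ^ d) := by
  have e : ∀ x : Euc d, (a * groundState R c (x + c)) ^ 2 =
      a ^ 2 * (groundState R 0 x * groundState R 0 x) := fun x => by
    simp only [groundState, radialSol, add_sub_cancel_right, sub_zero]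
    ring
  rw [integral_ball_translate]
  simp only [e]
  rw [integral_const_mul, integral_groundState_sq hR]

theorem isEigenfunction_const_mul_groundState (hR : 0 < R) (c : Euc d) {a : ℝ} (ha : a ≠ 0) :
    IsEigenfunction (openBall c R) (frequency d R ^ 2) fun x => a * groundState R c x := by
  have hs := smooth_groundState (d := d) R c
  refine isEigenfunction_of_smooth (contDiff_const.mul hs) (fun x => ?_)
    (memH20_const_mul_groundState hR c a) fun h => ?_
  · rw [lap_const_mul hs, lap_const_mul hs.lap]
    simp only [lap_lap_groundState]
    ring
  · have e := integral_ball_const_mul_groundState_sq hR c a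
    rw [(integral_congr_ae (by filter_upwards [h] with x hx; rw [hx, zero_pow two_ne_zero])).trans
      (integral_zero _ _)] at e
    have := sphereArea_pos (d := d)
    exact absurd e.symm (by positivity)

end GroundState

/-! ### Classification of the low eigenfunctions -/

section Classification

variable {d : ℕ} {R Λ κ : ℝ} {u g : Euc d → ℝ}

theorem ae_eq_zero_of_integral_mul_self (hg : MemLp g 2 (ballMeasure d R))
    (h : ∫ x, g x * g x ∂(ballMeasure d R) = 0) : g =ᵐ[ballMeasure d R] fun _ => 0 := by
  have := (integral_eq_zero_iff_of_nonneg (fun x => mul_self_nonneg (g x))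
    (integrable_mul_ball hg hg)).1 h
  filter_upwards [this] with x hx
  exact mul_self_eq_zero.1 hx

/-- Positivity of `J_{ν+1}` holds up to and including `γ`, hence slightly beyond. The available
factor `ρ > 1` is shared as `√ρ` each, leaving room both in the frequency and in the radius. -/
theorem exists_symmetry_radius [Nontrivial (Euc d)] (hR : 0 < R) :
    ∃ s y1, frequency d R < s ∧ R ^ 2 < y1 ∧
      ∀ t, 0 ≤ t → t ≤ s * y1 / 4 → 0 < bes ((d : ℝ) / 2) (-t) := by
  have hz := groundArg_pos (d := d)
  have hs := frequency_pos (d := d) hR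
  have hspec := (firstZero_spec (neg_one_lt_order (d := d))).2.2.2.2.2
  rw [sub_add_cancel] at hspec
  change ∀ t, 0 ≤ t → t ≤ groundArg d → _ at hspec
  have hc : Continuous fun t => bes ((d : ℝ) / 2) (-t) := (continuous_bes _).comp continuous_neg
  obtain ⟨δ, hδ, hball⟩ := Metric.eventually_nhds_iff.1
    (hc.continuousAt.eventually (lt_mem_nhds (hspec _ hz.le le_rfl)))
  set ρ := (groundArg d + δ / 2) / groundArg d with hρ
  have hρ1 : 1 < ρ := by rw [hρ, one_lt_div hz]; linarith
  have hsq : 1 < √ρ := Real.lt_sqrt_of_sq_lt (by simpa using hρ1)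
  refine ⟨frequency d R * √ρ, R ^ 2 * √ρ, lt_mul_of_one_lt_right hs hsq,
    lt_mul_of_one_lt_right (by positivity) hsq, fun t ht0 ht => ?_⟩
  have e : frequency d R * √ρ * (R ^ 2 * √ρ) / 4 = groundArg d + δ / 2 := by
    have h1 := Real.mul_self_sqrt (by linarith : 0 ≤ ρ)
    have h2 := frequency_mul (d := d) hR
    have h3 : groundArg d * ρ = groundArg d + δ / 2 := by rw [hρ]; field_simp
    rw [← h3, ← h2]
    linear_combination (frequency d R * R ^ 2 / 4) * h1
  rw [e] at ht
  rcases le_or_gt t (groundArg d) with h | h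
  · exact hspec t ht0 h
  · refine hball ?_
    rw [Real.dist_eq, abs_lt]
    constructor <;> linarith

/-- The energy of `u ∘ σ - u` is `Λ` times its `L²` norm squared, hence zero, and this energy is the
squared norm of `g ∘ σ - g`. -/
theorem EigenPair.comp_right_ae_eq (h : EigenPair R Λ u g) (σ : Euc d ≃ₗᵢ[ℝ] Euc d)
    (hu : (fun x => u (σ x)) =ᵐ[ballMeasure d R] u) :
    (fun x => g (σ x)) =ᵐ[ballMeasure d R] g := by
  have h' := (h.comp σ).add_mul h (-1)
  have e := h'.weak_pair h'.pair
  have e0 : ∫ x, (u (σ x) + -1 * u x) * (u (σ x) + -1 * u x) ∂(ballMeasure d R) = 0 := by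
    refine (integral_congr_ae ?_).trans (integral_zero _ _)
    filter_upwards [hu] with x hx
    rw [hx]
    ring
  rw [e0, mul_zero] at e
  filter_upwards [ae_eq_zero_of_integral_mul_self h'.pair.memLp_right e] with x hx
  linarith

variable [Nontrivial (Euc d)]

/-- The factorisation `Δ² - κ² = (Δ - κ)(Δ + κ)` shows that `g + κu` is annihilated weakly by `Δ -
κ`. It is rotation invariant since `κ < s`, even when `κ` equals the frequency. -/
theorem EigenPair.exists_ae_eq_radialSol (h : EigenPair R (κ ^ 2) u g) (hR : 0 < R) (hκ : 0 < κ)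
    (hκ' : κ ≤ frequency d R) :
    ∃ β, (fun x => g x + κ * u x) =ᵐ[ballMeasure d R] fun x => β * radialSol κ 0 x := by
  obtain ⟨s, y1, hs, hy1, hpos⟩ := exists_symmetry_radius (d := d) hR
  have hsκ : κ < s := hκ'.trans_lt hs
  have hu := fun σ => h.comp_ae_eq (hκ.trans hsκ) (pow_lt_pow_left₀ hsκ hκ.le two_ne_zero) hy1
    hpos σ
  have hg := fun σ => h.comp_right_ae_eq σ (hu σ)
  have hb : MemLp (fun x => g x + κ * u x) 2 (ballMeasure d R) :=
    h.pair.memLp_right.add (h.pair.memLp_left.const_mul κ)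
  obtain ⟨f, hf⟩ := exists_radial_of_invariant hb.aestronglyMeasurable fun σ => by
    filter_upwards [hu σ, hg σ] with x hx hx'
    rw [hx, hx']
  refine ae_eq_radialSol_of_weak hκ hR hb hf fun φ hφ => ?_
  have m := hφ.smooth.memLp (R := R)
  have ml := hφ.smooth.lap.memLp (R := R)
  have e : ∀ x, (g x + κ * u x) * (lap φ x - κ * φ x) =
      (g x * lap φ x - κ ^ 2 * (u x * φ x)) - κ * (g x * φ x - u x * lap φ x) :=
    fun x => by ring
  have igl := integrable_mul_ball h.pair.memLp_right ml
  have igm := integrable_mul_ball h.pair.memLp_right m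
  have iul := integrable_mul_ball h.pair.memLp_left ml
  have ium := integrable_mul_ball h.pair.memLp_left m
  simp only [e]
  rw [integral_sub (f := fun x => g x * lap φ x - κ ^ 2 * (u x * φ x))
      (g := fun x => κ * (g x * φ x - u x * lap φ x))
      (igl.sub (ium.const_mul _)) ((igm.sub iul).const_mul κ),
    integral_sub igl (ium.const_mul _), integral_const_mul, integral_const_mul,
    integral_sub igm iul, h.weak φ hφ, h.pair.integral_mul_smooth hφ.smooth]
  ring

theorem EigenPair.ae_eq_zero_of_add_ae_eq_zero (h : EigenPair R Λ u g)
    (hb : (fun x => g x + κ * u x) =ᵐ[ballMeasure d R] fun _ => 0) :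
    u =ᵐ[ballMeasure d R] fun _ => 0 :=
  h.pair.ae_eq_zero_of_helmholtz (κ := κ) (by
    filter_upwards [hb] with x hx
    linarith)

/-- Eigenvalues below that of the ground state do not occur. -/
theorem EigenPair.ae_eq_zero_of_lt (h : EigenPair R Λ u g) (hR : 0 < R)
    (hΛ : Λ < frequency d R ^ 2) : u =ᵐ[ballMeasure d R] fun _ => 0 := by
  have hw := h.weak_pair h.pair
  -- For `Λ ≤ 0` the identity `∫g² = Λ∫u²` forces `g = 0`, which is the Helmholtz equation with `κ =
  -- 0`.
  rcases le_or_gt Λ 0 with h0 | h0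
  · have hu : 0 ≤ ∫ x, u x * u x ∂(ballMeasure d R) := integral_nonneg fun x => mul_self_nonneg _
    have hg : 0 ≤ ∫ x, g x * g x ∂(ballMeasure d R) := integral_nonneg fun x => mul_self_nonneg _
    have e : ∫ x, g x * g x ∂(ballMeasure d R) = 0 := by
      have := mul_nonpos_of_nonpos_of_nonneg h0 hu
      linarith
    refine h.ae_eq_zero_of_add_ae_eq_zero (κ := 0) ?_
    filter_upwards [ae_eq_zero_of_integral_mul_self h.pair.memLp_right e] with x hx
    rw [hx]
    ring
  · obtain ⟨κ, hκ, rfl⟩ : ∃ κ, 0 < κ ∧ κ ^ 2 = Λ :=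
      ⟨√Λ, Real.sqrt_pos.2 h0, Real.sq_sqrt h0.le⟩
    have hlt : κ < frequency d R := lt_of_pow_lt_pow_left₀ 2 (frequency_pos hR).le hΛ
    obtain ⟨β, hβ⟩ := h.exists_ae_eq_radialSol hR hκ hlt.le
    have e := h.pair.integral_mul_smooth (smooth_radialSol (-κ) 0)
    have m := (smooth_radialSol (-κ) (0 : Euc d)).memLp (R := R)
    rw [lap_radialSol] at e
    -- By Green's formula `Δ + κ` moves onto `radialSol (-κ)`, which it annihilates. Evaluating the
    -- same integral through `β` yields `β` times a positive Wronskian.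
    have e1 : ∫ x, (g x + κ * u x) * radialSol (-κ) 0 x ∂(ballMeasure d R) = 0 := by
      have e2 : ∀ x, (g x + κ * u x) * radialSol (-κ) 0 x =
          g x * radialSol (-κ) 0 x - u x * (-κ * radialSol (-κ) 0 x) := fun x => by ring
      simp only [e2]
      rw [integral_sub (integrable_mul_ball h.pair.memLp_right m)
        (integrable_mul_ball h.pair.memLp_left (m.const_mul _)), e, sub_self]
    have e3 : ∫ x, (g x + κ * u x) * radialSol (-κ) 0 x ∂(ballMeasure d R) =
        β * ∫ x, radialSol κ 0 x * radialSol (-κ) 0 x ∂(ballMeasure d R) := by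
      rw [← integral_const_mul]
      refine integral_congr_ae ?_
      filter_upwards [hβ] with x hx
      rw [hx, mul_assoc]
    rw [e1, integral_radialSol_mul_neg hR.le] at e3
    have hW : 0 < besWronskian ((d : ℝ) / 2 - 1) (κ * R ^ 2 / 4) := by
      refine (firstZero_spec neg_one_lt_order).2.2.2.1 _ (by positivity) ?_
      change _ < groundArg d
      rw [← frequency_mul hR]
      gcongr
    have hS := sphereArea_pos (d := d)
    have hβ0 : β = 0 := by
      rcases mul_eq_zero.1 e3.symm with h | h
      · exact h
      · exact absurd h (by positivity)
    refine h.ae_eq_zero_of_add_ae_eq_zero (κ := κ) ?_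
    filter_upwards [hβ] with x hx
    rw [hx, hβ0, zero_mul]

/-- The lowest eigenspace is spanned by the radial ground state. -/
theorem EigenPair.exists_ae_eq_groundState (h : EigenPair R (frequency d R ^ 2) u g)
    (hR : 0 < R) : ∃ α, u =ᵐ[ballMeasure d R] (fun x => α * groundState R 0 x) ∧
      g =ᵐ[ballMeasure d R] fun x => α * lap (groundState R 0) x := by
  have hs := frequency_pos (d := d) hR
  have hi := (bes_groundArg_pos (d := d)).ne'
  obtain ⟨β, hβ⟩ := h.exists_ae_eq_radialSol hR hs le_rfl
  have hw := (isEigenfunction_const_mul_groundState (d := d) hR 0 one_ne_zero).eigenPair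
  have hwl := (smooth_groundState (d := d) R 0).weakLaplacian_ae_eq (openBall 0 R)
  simp only [add_zero, one_mul] at hw
  -- Since `(Δ + κ)groundState = -2κ radialSol κ / bes ν (groundArg d)` with `κ = frequency d R`,
  -- this `α` is the one for which `Δ + κ` annihilates `u - α · groundState`.
  set α := -(β * bes ((d : ℝ) / 2 - 1) (groundArg d) / (2 * frequency d R)) with hα
  have h' := h.add_mul hw (-α)
  have hu := h'.ae_eq_zero_of_add_ae_eq_zero (κ := frequency d R) (by
    filter_upwards [hβ, hwl] with x hx hx'
    rw [hx', lap_groundState]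
    simp only [groundState]
    have : g x = β * radialSol (frequency d R) 0 x - frequency d R * u x := by linarith
    rw [this, hα]
    generalize (d : ℝ) / 2 - 1 = ν at *
    field_simp
    ring)
  refine ⟨α, ?_, ?_⟩
  · filter_upwards [hu] with x hx
    linarith
  · have e := h'.weak_pair h'.pair
    have e0 : ∫ x, (u x + -α * groundState R 0 x) * (u x + -α * groundState R 0 x)
        ∂(ballMeasure d R) = 0 := by
      refine (integral_congr_ae ?_).trans (integral_zero _ _)
      filter_upwards [hu] with x hx
      rw [hx, mul_zero]
    rw [e0, mul_zero] at e
    filter_upwards [ae_eq_zero_of_integral_mul_self h'.pair.memLp_right e, hwl] with x hx hx'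
    rw [hx'] at hx
    linarith

end Classification

/-! ### First eigenfunctions -/

section First

variable {d : ℕ} [Nontrivial (Euc d)] {R : ℝ} {u : Euc d → ℝ}

theorem isLeast_eigenvalues (hR : 0 < R) (c : Euc d) :
    IsLeast (eigenvalues (openBall c R)) (frequency d R ^ 2) := by
  refine ⟨⟨_, isEigenfunction_const_mul_groundState hR c one_ne_zero⟩, fun Λ ⟨u, hu⟩ => ?_⟩
  by_contra! hlt
  have h0 := hu.eigenPair.ae_eq_zero_of_lt hR hlt
  have e : ∫ x in openBall c R, u x * u x = 0 := by
    rw [integral_ball_translate]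
    refine (integral_congr_ae ?_).trans (integral_zero _ _)
    filter_upwards [h0] with x hx
    rw [hx, mul_zero]
  refine hu.ne_zero ?_
  have := (integral_eq_zero_iff_of_nonneg (fun x => mul_self_nonneg (u x))
    (MemLp.integrable_mul hu.memH20.1.memLp hu.memH20.1.memLp)).1 e
  filter_upwards [this] with x hx
  exact mul_self_eq_zero.1 hx

theorem exists_isFirstNormalisedEigenfunction (hR : 0 < R) (c : Euc d) :
    ∃ u, IsFirstNormalisedEigenfunction (openBall c R) u := by
  have hS := sphereArea_pos (d := d)
  have hp : 0 < sphereArea d * R ^ d := by positivity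
  refine ⟨fun x => (√(sphereArea d * R ^ d))⁻¹ * groundState R c x, _, isLeast_eigenvalues hR c,
    isEigenfunction_const_mul_groundState hR c (by positivity), ?_⟩
  rw [integral_ball_const_mul_groundState_sq hR, inv_pow, Real.sq_sqrt hp.le,
    inv_mul_cancel₀ hp.ne']

/-- Both `∫u²` and `-∫uΔu` scale with `α²`, and normalisation gives `α² · sphereArea d · Rᵈ = 1`, so
the sign of `α` plays no role. -/
theorem IsFirstNormalisedEigenfunction.integral_gradSq {c : Euc d}
    (h : IsFirstNormalisedEigenfunction (openBall c R) u) (hR : 0 < R) :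
    ∫ x in openBall c R, gradSq (openBall c R) u x =
      frequency d R * (groundRatio d * ((d : ℝ) / 2 - 1 + groundArg d * groundRatio d)) := by
  obtain ⟨Λ, hΛ, hu, hnorm⟩ := h
  obtain rfl := hΛ.unique (isLeast_eigenvalues hR c)
  obtain ⟨α, h1, h2⟩ := hu.eigenPair.exists_ae_eq_groundState hR
  have e1 : ∫ x, u (x + c) ^ 2 ∂(ballMeasure d R) = α ^ 2 * (sphereArea d * R ^ d) := by
    rw [← integral_groundState_sq hR, ← integral_const_mul]
    refine integral_congr_ae ?_
    filter_upwards [h1] with x hx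
    rw [hx]
    ring
  have e2 : ∫ x, u (x + c) * weakLaplacian (openBall c R) u (x + c) ∂(ballMeasure d R) =
      α ^ 2 * ∫ x, groundState R 0 x * lap (groundState R 0) x ∂(ballMeasure d R) := by
    rw [← integral_const_mul]
    refine integral_congr_ae ?_
    filter_upwards [h1, h2] with x hx hx'
    rw [hx, hx']
    ring
  rw [integral_ball_translate, e1] at hnorm
  rw [ClampedPlate.integral_gradSq hu.memH20, integral_ball_translate, e2,
    integral_groundState_mul_lap hR]
  linear_combination (frequency d R *
    (groundRatio d * ((d : ℝ) / 2 - 1 + groundArg d * groundRatio d))) * hnorm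

/-- At `γ`, `bes (ν+1)` equals `-ρ` and `bes (ν-1)` equals `ν + zρ` times `bes ν`, all at `-z`; the
extra powers of `γ/2` in the two outer orders cancel. -/
theorem besselJ_succ_mul_pred : besselJ ((d : ℝ) / 2 - 1 + 1) (firstZero ((d : ℝ) / 2 - 1)) *
    besselJ ((d : ℝ) / 2 - 1 - 1) (firstZero ((d : ℝ) / 2 - 1)) =
    -(groundRatio d * ((d : ℝ) / 2 - 1 + groundArg d * groundRatio d)) *
      besselJ ((d : ℝ) / 2 - 1) (firstZero ((d : ℝ) / 2 - 1)) ^ 2 := by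
  have hγ := (firstZero_spec (neg_one_lt_order (d := d))).2.1
  have hj := bes_succ_neg_groundArg (d := d)
  have hp := bes_pred ((d : ℝ) / 2 - 1) (-groundArg d)
  rw [besselJ_eq _ hγ, besselJ_eq _ hγ, besselJ_eq _ hγ]
  change _ * bes _ (-groundArg d) * (_ * bes _ (-groundArg d)) =
    _ * (_ * bes _ (-groundArg d)) ^ 2
  rw [hp, hj]
  have hx : (firstZero ((d : ℝ) / 2 - 1) / 2) ≠ 0 := by positivity
  rw [Real.rpow_add_one hx, Real.rpow_sub_one hx ((d : ℝ) / 2 - 1)]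
  generalize firstZero ((d : ℝ) / 2 - 1) / 2 = y at *
  generalize y ^ ((d : ℝ) / 2 - 1) = p
  field_simp

/-- The sign inside the absolute value needs no inequality between Bessel functions: it follows from
`∫|∇u|² ≥ 0` and positivity of the frequency. -/
theorem eq_abs_besselJ_quotient (hR : 0 < R) {G : ℝ} (hG0 : 0 ≤ G) (hG : G =
    frequency d R * (groundRatio d * ((d : ℝ) / 2 - 1 + groundArg d * groundRatio d))) :
    G = firstZero ((d : ℝ) / 2 - 1) ^ 2 / R ^ 2 *
      (|besselJ ((d : ℝ) / 2 - 1 + 1) (firstZero ((d : ℝ) / 2 - 1)) *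
        besselJ ((d : ℝ) / 2 - 1 - 1) (firstZero ((d : ℝ) / 2 - 1))| /
        besselJ ((d : ℝ) / 2 - 1) (firstZero ((d : ℝ) / 2 - 1)) ^ 2) := by
  have hf := frequency_pos (d := d) hR
  have hne : besselJ ((d : ℝ) / 2 - 1) (firstZero ((d : ℝ) / 2 - 1)) ≠ 0 :=
    (firstZero_spec (neg_one_lt_order (d := d))).1.1.2.1
  have hpos : 0 ≤ groundRatio d * ((d : ℝ) / 2 - 1 + groundArg d * groundRatio d) := by
    rw [hG] at hG0
    exact nonneg_of_mul_nonneg_right hG0 hf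
  rw [besselJ_succ_mul_pred, abs_mul, abs_neg, abs_of_nonneg hpos, abs_sq,
    mul_div_cancel_right₀ _ (pow_ne_zero 2 hne)]
  exact hG

end First

end ClampedPlate

end

theorem mainTheorem9 (d : ℕ) (hd : 1 ≤ d) (c : EuclideanSpace ℝ (Fin d)) (R : ℝ) (hR : 0 < R)
    (ν : ℝ) (hν : ν = (d : ℝ) / 2 - 1) :
    IsLeast (ClampedPlate.besselQuotientZeros ν) (ClampedPlate.firstZero ν) ∧
    (∃ u, ClampedPlate.IsFirstNormalisedEigenfunction (ClampedPlate.openBall c R) u) ∧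
    ∀ u, ClampedPlate.IsFirstNormalisedEigenfunction (ClampedPlate.openBall c R) u →
      ∫ x in ClampedPlate.openBall c R, ClampedPlate.gradSq (ClampedPlate.openBall c R) u x =
        (ClampedPlate.firstZero ν) ^ 2 / R ^ 2 *
          (|ClampedPlate.besselJ (ν + 1) (ClampedPlate.firstZero ν) *
              ClampedPlate.besselJ (ν - 1) (ClampedPlate.firstZero ν)| /
            (ClampedPlate.besselJ ν (ClampedPlate.firstZero ν)) ^ 2) := by
  have : Nonempty (Fin d) := ⟨⟨0, hd⟩⟩
  have : Nontrivial (EuclideanSpace ℝ (Fin d)) :=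
    (WithLp.equiv 2 (Fin d → ℝ)).nontrivial
  subst hν
  refine ⟨(ClampedPlate.firstZero_spec (ClampedPlate.neg_one_lt_order (d := d))).1,
    ClampedPlate.exists_isFirstNormalisedEigenfunction hR c, fun u hu => ?_⟩
  exact ClampedPlate.eq_abs_besselJ_quotient hR
    (integral_nonneg fun x => Finset.sum_nonneg fun i _ => sq_nonneg _) (hu.integral_gradSq hR)
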